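/- Theorem 5.1. Let $k$ be a field and let $H=(H,\Delta,\varepsilon,\Phi,S,\alpha,\beta)$ be a finite-dimensional quasi-Hopf algebra over $k$: an associative unital $k$-algebra with algebra maps $\Delta:H\to H\otimes H$, $\varepsilon:H\to k$ and an invertible $\Phi\in H^{\otimes 3}$ such that $(id\otimes\Delta)\Delta(h)=\Phi\,(\Delta\otimes id)\Delta(h)\,\Phi^{-1}$, $(id\otimes\varepsilon)\Delta(h)=h\otimes 1$, $(\varepsilon\otimes id)\Delta(h)=1\otimes h$, $(1\otimes\Phi)(id\otimes\Delta\otimes id)(\Phi)(\Phi\otimes1)=(id\otimes id\otimes\Delta)(\Phi)(\Delta\otimes id\otimes id)(\Phi)$, $(id\otimes\varepsilon\otimes id)(\Phi)=1\otimes1\otimes 1$, together with a unital algebra anti-endomorphism $S$ and $\alpha,\beta\in H$ such that, writing $\Delta(h)=h_1\otimes h_2$, $\Phi=X^1\otimes X^2\otimes X^3$, $\Phi^{-1}=x^1\otimes x^2\otimes x^3$ (summation understood), $S(h_1)\alpha h_2=\varepsilon(h)\alpha$, $h_1\beta S(h_2)=\varepsilon(h)\beta$, $X^1\beta S(X^2)\alpha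 X^3=1$ and $S(x^1)\alpha x^2\beta S(x^3)=1$. The antipode $S$ is then bijective, and the following notions are used. Put $$p^1\otimes p^2=x^1\otimes x^2\beta S(x^3),\qquad q^1\otimes q^2=X^1\otimes S^{-1}(\alpha X^3)X^2 .$$ With $A^1\otimes A^2\otimes A^3\otimes A^4=(\Phi\otimes1)(\Delta\otimes id\otimes id)(\Phi^{-1})$, $B^1\otimes B^2\otimes B^3\otimes B^4=(\Delta\otimes id\otimes id)(\Phi)(\Phi^{-1}\otimes1)$, $\gamma=S(A^2)\alpha A^3\otimes S(A^1)\alpha A^4$ and $\delta=B^1\beta S(B^4)\otimes B^2\beta S(B^3)$, let $$f=f^1\otimes f^2=(S\otimes S)(\Delta^{op}(x^1))\,\gamma\,\Delta(x^2\beta S(x^3)),\qquad f^{-1}=g^1\otimes g^2=\Delta(S(x^1)\alpha x^2)\,\delta\,(S\otimes S)(\Delta^{op}(x^3)),$$ $$U^1\otimes U^2=g^1S(q^2)\otimes g^2S(q^1),\qquad V^1\otimes V^2=S^{-1}(f^2p^2)\otimes S^{-1}(f^1p^1).$$ A left (right) integral in $H$ is an element $t$ with $ht=\varepsilon(h)t$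 (respectively $th=\varepsilon(h)t$) for all $h\in H$. The distinguished group-like element of $H^*$ is the $\mu\in H^*$ with $th=\mu(h)t$ for all left integrals $t$ and all $h\in H$. A left cointegral in $H$ is a $\lambda\in H^*$ with $\lambda(V^2h_2U^2)V^1h_1U^1=\mu(x^1)\lambda(hS(x^2))x^3$ for all $h\in H$. $H$ is semisimple if it is semisimple as an algebra, and cosemisimple if it has a left cointegral $\lambda$ with $\lambda(S^{-1}(\alpha)\beta)=1$. Let $\lambda$ be a nonzero left cointegral in $H$ and let $r$ be a right integral in $H$ with $\lambda(S(r))=1$. Then: (i) for every $k$-linear endomorphism $\chi$ of $H$, $$\mathrm{Tr}(\chi)=\mu(q^1_1x^1)\,\lambda\bigl(\chi(q^2x^3r_2p^2)\,S(q^1_2x^2r_1p^1)\bigr);$$ (ii) $\mathrm{Tr}\bigl(h\mapsto\beta S(\alpha)S^2(h)S(\beta)\alpha\bigr)=\varepsilon(r)\,\lambda(S^{-1}(\alpha)\beta)$. In particular, for every finite-dimensional quasi-Hopf algebra $H$: $H$ is semisimple and cosemisimple if and only if $\mathrm{Tr}\bigl(h\mapsto\beta S(\alpha)S^2(h)S(\beta)\alpha\bigr)\neq0$.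 -/

import Mathlib

open scoped TensorProduct

/-- A quasi-bialgebra `(H, Δ, ε, Φ)` over a field `k`. The triple tensor product is bracketed as
`H ⊗ (H ⊗ H)`, and the fourfold one as `H ⊗ (H ⊗ (H ⊗ H))`. -/
structure QuasiBialgebra (k H : Type*) [Field k] [Ring H] [Algebra k H] where
  /-- the coproduct `Δ` -/
  comul : H →ₐ[k] H ⊗[k] H
  /-- the counit `ε` -/
  counit : H →ₐ[k] k
  /-- the reassociator `Φ = X¹ ⊗ X² ⊗ X³`, with inverse `Φ⁻¹ = x¹ ⊗ x² ⊗ x³` -/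
  reassoc : (H ⊗[k] (H ⊗[k] H))ˣ
  /-- `(id ⊗ Δ)(Δ h) = Φ (Δ ⊗ id)(Δ h) Φ⁻¹` -/
  quasi_coassoc : ∀ h : H,
    Algebra.TensorProduct.map (AlgHom.id k H) comul (comul h) =
      (reassoc : H ⊗[k] (H ⊗[k] H)) *
        Algebra.TensorProduct.assoc k k k H H H
          (Algebra.TensorProduct.map comul (AlgHom.id k H) (comul h)) *
        ((reassoc⁻¹ : (H ⊗[k] (H ⊗[k] H))ˣ) : H ⊗[k] (H ⊗[k] H))
  /-- `(id ⊗ ε)(Δ h) = h ⊗ 1` -/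
  id_counit_comul : ∀ h : H,
    Algebra.TensorProduct.map (AlgHom.id k H) counit (comul h) = h ⊗ₜ[k] (1 : k)
  /-- `(ε ⊗ id)(Δ h) = 1 ⊗ h` -/
  counit_id_comul : ∀ h : H,
    Algebra.TensorProduct.map counit (AlgHom.id k H) (comul h) = (1 : k) ⊗ₜ[k] h
  /-- `(1 ⊗ Φ) (id ⊗ Δ ⊗ id)(Φ) (Φ ⊗ 1) = (id ⊗ id ⊗ Δ)(Φ) (Δ ⊗ id ⊗ id)(Φ)` -/
  cocycle :
    ((1 : H) ⊗ₜ[k] (reassoc : H ⊗[k] (H ⊗[k] H))) *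
        Algebra.TensorProduct.map (AlgHom.id k H)
          ((Algebra.TensorProduct.assoc k k k H H H).toAlgHom.comp
            (Algebra.TensorProduct.map comul (AlgHom.id k H))) reassoc *
        Algebra.TensorProduct.map (AlgHom.id k H)
          (Algebra.TensorProduct.assoc k k k H H H).toAlgHom
          (Algebra.TensorProduct.assoc k k k H (H ⊗[k] H) H
            ((reassoc : H ⊗[k] (H ⊗[k] H)) ⊗ₜ[k] (1 : H))) =
      Algebra.TensorProduct.map (AlgHom.id k H)
          (Algebra.TensorProduct.map (AlgHom.id k H) comul) reassoc *
        Algebra.TensorProduct.assoc k k k H H (H ⊗[k] H)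
          (Algebra.TensorProduct.map comul (AlgHom.id k (H ⊗[k] H)) reassoc)
  /-- `(id ⊗ ε ⊗ id)(Φ) = 1 ⊗ 1 ⊗ 1` in `H ⊗ (k ⊗ H)` -/
  id_counit_id_reassoc :
    Algebra.TensorProduct.map (AlgHom.id k H)
      (Algebra.TensorProduct.map counit (AlgHom.id k H))
      (reassoc : H ⊗[k] (H ⊗[k] H)) = (1 : H ⊗[k] (k ⊗[k] H))

/-- The linear map `A ⊗ A → A`, `x ⊗ y ↦ x a y`. -/
noncomputable def mulMid (k : Type*) {A : Type*} [Field k] [Ring A] [Algebra k A] (a : A) :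
    A ⊗[k] A →ₗ[k] A :=
  LinearMap.mul' k A ∘ₗ TensorProduct.map (LinearMap.mulRight k a) LinearMap.id

/-- A quasi-Hopf algebra `(H, Δ, ε, Φ, S, α, β)`; the antipode `S` is not required to be
bijective. -/
structure QuasiHopfAlgebra (k H : Type*) [Field k] [Ring H] [Algebra k H] extends
    QuasiBialgebra k H where
  /-- the antipode `S` -/
  antipode : H →ₗ[k] H
  α : H
  β : H
  antipode_one : antipode 1 = 1
  antipode_mul : ∀ a b : H, antipode (a * b) = antipode b * antipode a
  /-- `S(h₁) α h₂ = ε(h) α` -/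
  antipode_left : ∀ h : H,
    mulMid k α (TensorProduct.map antipode LinearMap.id (comul h)) = counit h • α
  /-- `h₁ β S(h₂) = ε(h) β` -/
  antipode_right : ∀ h : H,
    mulMid k β (TensorProduct.map LinearMap.id antipode (comul h)) = counit h • β
  /-- `X¹ β S(X²) α X³ = 1` -/
  reassoc_antipode :
    mulMid k β (TensorProduct.map LinearMap.id
      (mulMid k α ∘ₗ TensorProduct.map antipode LinearMap.id)
      (reassoc : H ⊗[k] (H ⊗[k] H))) = 1
  /-- `S(x¹) α x² β S(x³) = 1` -/
  reassoc_inv_antipode :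
    mulMid k α (TensorProduct.map antipode
      (mulMid k β ∘ₗ TensorProduct.map LinearMap.id antipode)
      ((reassoc⁻¹ : (H ⊗[k] (H ⊗[k] H))ˣ) : H ⊗[k] (H ⊗[k] H))) = 1

namespace QuasiHopfAlgebra

variable {k H : Type*} [Field k] [Ring H] [Algebra k H] (Q : QuasiHopfAlgebra k H)

/-- `Φ = X¹ ⊗ X² ⊗ X³` as an element. -/
def Phi : H ⊗[k] (H ⊗[k] H) := Q.reassoc

/-- `Φ⁻¹ = x¹ ⊗ x² ⊗ x³` as an element. -/
def PhiInv : H ⊗[k] (H ⊗[k] H) := ((Q.reassoc⁻¹ : (H ⊗[k] (H ⊗[k] H))ˣ) : H ⊗[k] (H ⊗[k] H))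

/-- The inverse `S⁻¹` of the antipode, that is, the two-sided inverse of `S` in the ring of
linear endomorphisms (with value `0` in case `S` is not bijective). -/
noncomputable def antipodeInv : H →ₗ[k] H := Ring.inverse (Q.antipode : Module.End k H)

/-- `x ⊗ y ↦ S(x) α y`. -/
noncomputable def evMap : H ⊗[k] H →ₗ[k] H :=
  mulMid k Q.α ∘ₗ TensorProduct.map Q.antipode LinearMap.id

/-- `x ⊗ y ↦ x β S(y)`. -/
noncomputable def coevMap : H ⊗[k] H →ₗ[k] H :=
  mulMid k Q.β ∘ₗ TensorProduct.map LinearMap.id Q.antipode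

/-- `p_R = p¹ ⊗ p² = x¹ ⊗ x² β S(x³)`. -/
noncomputable def pR : H ⊗[k] H := TensorProduct.map LinearMap.id Q.coevMap Q.PhiInv

/-- `q_R = q¹ ⊗ q² = X¹ ⊗ S⁻¹(α X³) X²`. -/
noncomputable def qR : H ⊗[k] H :=
  TensorProduct.map LinearMap.id
    (LinearMap.mul' k H ∘ₗ
      TensorProduct.map (Q.antipodeInv ∘ₗ LinearMap.mulLeft k Q.α) LinearMap.id ∘ₗ
      (TensorProduct.comm k H H).toLinearMap)
    Q.Phi

/-- `q_L = S(x¹) α x² ⊗ x³`. -/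
noncomputable def qL : H ⊗[k] H :=
  TensorProduct.map Q.evMap LinearMap.id ((TensorProduct.assoc k H H H).symm Q.PhiInv)

/-- `(Δ ⊗ id ⊗ id) : H ⊗ H ⊗ H → H ⊗ H ⊗ H ⊗ H`. -/
noncomputable def comulFst : H ⊗[k] (H ⊗[k] H) →ₐ[k] H ⊗[k] (H ⊗[k] (H ⊗[k] H)) :=
  (Algebra.TensorProduct.assoc k k k H H (H ⊗[k] H)).toAlgHom.comp
    (Algebra.TensorProduct.map Q.comul (AlgHom.id k (H ⊗[k] H)))

/-- `t ↦ t ⊗ 1 : H ⊗ H ⊗ H → H ⊗ H ⊗ H ⊗ H`. -/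
noncomputable def tmulOne (k H : Type*) [Field k] [Ring H] [Algebra k H]
    (t : H ⊗[k] (H ⊗[k] H)) : H ⊗[k] (H ⊗[k] (H ⊗[k] H)) :=
  TensorProduct.map LinearMap.id (TensorProduct.assoc k H H H).toLinearMap
    (TensorProduct.assoc k H (H ⊗[k] H) H (t ⊗ₜ[k] (1 : H)))

/-- `A¹ ⊗ A² ⊗ A³ ⊗ A⁴ ↦ S(A²) α A³ ⊗ S(A¹) α A⁴`. -/
noncomputable def gammaMap : H ⊗[k] (H ⊗[k] (H ⊗[k] H)) →ₗ[k] H ⊗[k] H :=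
  TensorProduct.map LinearMap.id Q.evMap ∘ₗ
    (TensorProduct.leftComm k H H H).toLinearMap ∘ₗ
    TensorProduct.map LinearMap.id
      (TensorProduct.map Q.evMap LinearMap.id ∘ₗ (TensorProduct.assoc k H H H).symm.toLinearMap)

/-- `B¹ ⊗ B² ⊗ B³ ⊗ B⁴ ↦ B¹ β S(B⁴) ⊗ B² β S(B³)`. -/
noncomputable def deltaMap : H ⊗[k] (H ⊗[k] (H ⊗[k] H)) →ₗ[k] H ⊗[k] H :=
  TensorProduct.map Q.coevMap LinearMap.id ∘ₗ
    (TensorProduct.assoc k H H H).symm.toLinearMap ∘ₗ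
    TensorProduct.map LinearMap.id
      ((TensorProduct.comm k H H).toLinearMap ∘ₗ
        TensorProduct.map Q.coevMap LinearMap.id ∘ₗ
        (TensorProduct.assoc k H H H).symm.toLinearMap)

/-- `γ = S(A²) α A³ ⊗ S(A¹) α A⁴`, where `A = (Φ ⊗ 1) (Δ ⊗ id ⊗ id)(Φ⁻¹)`. -/
noncomputable def gammaElt : H ⊗[k] H := Q.gammaMap (tmulOne k H Q.Phi * Q.comulFst Q.PhiInv)

/-- `δ = B¹ β S(B⁴) ⊗ B² β S(B³)`, where `B = (Δ ⊗ id ⊗ id)(Φ) (Φ⁻¹ ⊗ 1)`. -/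
noncomputable def deltaElt : H ⊗[k] H := Q.deltaMap (Q.comulFst Q.Phi * tmulOne k H Q.PhiInv)

/-- `h ↦ (S ⊗ S)(Δᵒᵖ(h)) = S(h₂) ⊗ S(h₁)`. -/
noncomputable def antipodeComulOp : H →ₗ[k] H ⊗[k] H :=
  TensorProduct.map Q.antipode Q.antipode ∘ₗ (TensorProduct.comm k H H).toLinearMap ∘ₗ
    Q.comul.toLinearMap

/-- The Drinfeld twist `f = (S ⊗ S)(Δᵒᵖ(x¹)) γ Δ(x² β S(x³))`. -/
noncomputable def twist : H ⊗[k] H :=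
  mulMid k Q.gammaElt (TensorProduct.map Q.antipodeComulOp Q.comul.toLinearMap Q.pR)

/-- The inverse Drinfeld twist `f⁻¹ = g¹ ⊗ g² = Δ(S(x¹) α x²) δ (S ⊗ S)(Δᵒᵖ(x³))`. -/
noncomputable def twistInv : H ⊗[k] H :=
  mulMid k Q.deltaElt (TensorProduct.map Q.comul.toLinearMap Q.antipodeComulOp Q.qL)

/-- `U = g¹ S(q²) ⊗ g² S(q¹)`. -/
noncomputable def U : H ⊗[k] H :=
  Q.twistInv * TensorProduct.comm k H H (TensorProduct.map Q.antipode Q.antipode Q.qR)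

/-- `V = S⁻¹(f² p²) ⊗ S⁻¹(f¹ p¹)`. -/
noncomputable def V : H ⊗[k] H :=
  TensorProduct.comm k H H (TensorProduct.map Q.antipodeInv Q.antipodeInv (Q.twist * Q.pR))

/-- `t` is a left integral in `H`. -/
def IsLeftIntegral (t : H) : Prop := ∀ h : H, h * t = Q.counit h • t

/-- `r` is a right integral in `H`. -/
def IsRightIntegral (r : H) : Prop := ∀ h : H, r * h = Q.counit h • r

/-- `μ ∈ H*` is the distinguished group-like element of `H*`: `t h = μ(h) t` for all left integrals
`t` and all `h ∈ H`. -/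
def IsDistinguished (μ : Module.Dual k H) : Prop :=
  ∀ t : H, Q.IsLeftIntegral t → ∀ h : H, t * h = μ h • t

/-- `lam ∈ H*` is a left cointegral in `H` (relative to the distinguished group-like element `μ`):
`lam(V² h₂ U²) V¹ h₁ U¹ = μ(x¹) lam(h S(x²)) x³` for all `h ∈ H`. -/
def IsLeftCointegral (μ lam : Module.Dual k H) : Prop :=
  ∀ h : H,
    TensorProduct.rid k H
        (TensorProduct.map LinearMap.id lam (Q.V * Q.comul h * Q.U)) =
      TensorProduct.lid k H
        (TensorProduct.map μ
          ((TensorProduct.lid k H).toLinearMap ∘ₗ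
            TensorProduct.map (lam ∘ₗ LinearMap.mulLeft k h ∘ₗ Q.antipode) LinearMap.id)
          Q.PhiInv)

/-- `H` is cosemisimple: it has a left cointegral `lam` with `lam(S⁻¹(α) β) = 1`. -/
def IsCosemisimple : Prop :=
  ∃ μ lam : Module.Dual k H, Q.IsDistinguished μ ∧ Q.IsLeftCointegral μ lam ∧
    lam (Q.antipodeInv Q.α * Q.β) = 1

/-- `q¹₁ x¹ ⊗ q¹₂ x² r₁ p¹ ⊗ q² x³ r₂ p²`. -/
noncomputable def traceElt (r : H) : H ⊗[k] (H ⊗[k] H) :=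
  TensorProduct.assoc k H H H (TensorProduct.map Q.comul.toLinearMap LinearMap.id Q.qR) *
    Q.PhiInv * ((1 : H) ⊗ₜ[k] (Q.comul r * Q.pR))

/-- `μ(q¹₁ x¹) lam(χ(q² x³ r₂ p²) S(q¹₂ x² r₁ p¹))`. -/
noncomputable def traceForm (μ lam : Module.Dual k H) (r : H) (χ : H →ₗ[k] H) : k :=
  TensorProduct.lid k k
    (TensorProduct.map μ
      (lam ∘ₗ LinearMap.mul' k H ∘ₗ TensorProduct.map χ Q.antipode ∘ₗ
        (TensorProduct.comm k H H).toLinearMap)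
      (Q.traceElt r))

/-- The endomorphism `h ↦ β S(α) S²(h) S(β) α`. -/
noncomputable def sqAntipodeEnd : H →ₗ[k] H :=
  LinearMap.mulLeft k (Q.β * Q.antipode Q.α) ∘ₗ
    LinearMap.mulRight k (Q.antipode Q.β * Q.α) ∘ₗ Q.antipode ∘ₗ Q.antipode

end QuasiHopfAlgebra

/-! The trace formula is a dual-basis formula. A tensor `E = E¹ ⊗ E²` defines the endomorphism `h ↦
λ(h S(E¹)) E²`; when this is the identity, composing with `χ` and taking traces gives `Tr(χ) =
λ(χ(E²) S(E¹))`. Once `μ` is applied to its first leg, the tensor in (i) is `E = (1 ⊗ S⁻¹(c)) q Δ(r)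
p` with `c = (μ ⊗ μS ⊗ id)(Φ)` (`IsRightIntegral.traceElt_char`). Since `r` is a right integral,
`Δ(r) p (h ⊗ 1) = Δ(r) p (1 ⊗ S(h))`, so the endomorphism of `q Δ(r) p` commutes with right
multiplications and is left multiplication by its value at `1`. The cointegral equation at `S(r)`
says that `S` sends this value to `λ(S(r)) c⁻¹` (`IsRightIntegral.antipode_pairing_one`), and the
two factors `c` cancel.

For (ii), conjugating by `S` replaces the endomorphism by `h ↦ S⁻¹(α) β S²(h) α S⁻¹(β)`. Inserted in
the dual-basis formula, it collapses through `r₁ β S(r₂) = ε(r) β` and `q¹ β S(q²) = 1`. Both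
formulas are proved with the factor `λ(S(r))` kept, so that the equivalence needs no normalisation
of `r`.

If `H` is semisimple, there is a left integral `t` with `ε(t) = 1`; then (ii) with `r = S(t)` and a
normalised cointegral shows that the trace is nonzero. Conversely, the trace is itself `ε` of a left
integral, namely a slice of the invariant tensor that corresponds to left multiplication by `β`. If
it is nonzero, rescaling gives `ε(t) = 1`, and `q_L Δ(t)` yields a Casimir element for Maschke's
argument. The functional `z ↦ Tr(x ↦ z S²(x) α S⁻¹(β))` is then a left cointegral whose value at
`S⁻¹(α) β` is the trace.

The identities for `p`, `q`, `f`, `U`, `V` all come from one device. Several copies of `H` act with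
commuting images ("slots"), by left multiplications and by right multiplications through `S`. The
pentagon is evaluated in four or five slots, and a pair of slots that meets `β` at the vector, or
`α` in the outer linear map, acts through `ε`, which removes the reassociators it enters. The
bijection `a ⊗ b ↦ Δ(a) p (1 ⊗ b)` obtained in this way gives nonzero integrals and the bijectivity
of `S`. -/

/-- The images of two algebra homomorphisms commute elementwise. -/
class SlotsCommute {k A B C : Type*} [Field k] [Semiring A] [Algebra k A] [Semiring B] [Algebra k B]
    [Semiring C] [Algebra k C] (f : B →ₐ[k] A) (g : C →ₐ[k] A) : Prop where
  comm : ∀ x y, Commute (f x) (g y)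

/-! ### Evaluating tensors in commuting slots -/

section Slots

variable {k A B C D : Type*} [Field k] [Semiring A] [Algebra k A] [Semiring B] [Algebra k B]
    [Semiring C] [Algebra k C] [Semiring D] [Algebra k D]

/-- `x ⊗ y ↦ f x * g y` for homomorphisms with commuting images. -/
noncomputable def slotEval (f : B →ₐ[k] A) (g : C →ₐ[k] A) [h : SlotsCommute f g] :
    B ⊗[k] C →ₐ[k] A :=
  Algebra.TensorProduct.lift f g h.comm

@[simp]
theorem slotEval_tmul (f : B →ₐ[k] A) (g : C →ₐ[k] A) [SlotsCommute f g] (x : B) (y : C) :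
    slotEval f g (x ⊗ₜ y) = f x * g y := rfl

/-- Commutation passes to products of slots, so nested evaluations and iterated coproducts obtain
their commutation hypotheses by instance search. -/
instance SlotsCommute.slotEval_right (f : B →ₐ[k] A) (g : C →ₐ[k] A) (h : D →ₐ[k] A)
    [SlotsCommute f g] [SlotsCommute f h] [SlotsCommute g h] :
    SlotsCommute f (slotEval g h) where
  comm x y := by
    induction y using TensorProduct.induction_on with
    | zero => simp
    | tmul y z =>
      exact (SlotsCommute.comm (f := f) (g := g) x y).mul_right (SlotsCommute.comm x z)
    | add y z hy hz => rw [map_add]; exact hy.add_right hz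

instance SlotsCommute.slotEval_left (f : B →ₐ[k] A) (g : C →ₐ[k] A) (h : D →ₐ[k] A)
    [SlotsCommute f g] [SlotsCommute f h] [SlotsCommute g h] :
    SlotsCommute (slotEval f g) h where
  comm x y := by
    induction x using TensorProduct.induction_on with
    | zero => simp
    | tmul w z =>
      exact (SlotsCommute.comm (f := f) (g := h) w y).mul_left (SlotsCommute.comm z y)
    | add w z hw hz => rw [map_add]; exact hw.add_left hz

theorem slotEval_assoc (f : B →ₐ[k] A) (g : C →ₐ[k] A) (h : D →ₐ[k] A)
    [SlotsCommute f g] [SlotsCommute f h] [SlotsCommute g h] (t : (B ⊗[k] C) ⊗[k] D) :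
    slotEval f (slotEval g h) (TensorProduct.assoc k B C D t) = slotEval (slotEval f g) h t := by
  have : ((slotEval f (slotEval g h)).toLinearMap ∘ₗ
      (TensorProduct.assoc k B C D).toLinearMap) = (slotEval (slotEval f g) h).toLinearMap := by
    ext x y z; simp [mul_assoc]
  exact congrArg (fun F => F t) this

end Slots

/-! ### Coproduct, reassociator and pentagon in slots -/

namespace QuasiHopfAlgebra

variable {k H A : Type*} [Field k] [Ring H] [Algebra k H] (Q : QuasiHopfAlgebra k H)
  [Semiring A] [Algebra k A]

/-- The homomorphism `h ↦ f(h₁) g(h₂)`. -/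
noncomputable def conv (f g : H →ₐ[k] A) [SlotsCommute f g] : H →ₐ[k] A :=
  (slotEval f g).comp Q.comul

theorem conv_apply (f g : H →ₐ[k] A) [SlotsCommute f g] (x : H) :
    Q.conv f g x = slotEval f g (Q.comul x) := rfl

instance conv_right (f g h : H →ₐ[k] A) [SlotsCommute f g] [SlotsCommute f h] [SlotsCommute g h] :
    SlotsCommute f (Q.conv g h) where
  comm x y := SlotsCommute.comm (f := f) (g := slotEval g h) x (Q.comul y)

instance conv_left (f g h : H →ₐ[k] A) [SlotsCommute f g] [SlotsCommute f h] [SlotsCommute g h] :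
    SlotsCommute (Q.conv f g) h where
  comm x y := SlotsCommute.comm (f := slotEval f g) (g := h) (Q.comul x) y

/-- The counit, as a homomorphism to any algebra. -/
noncomputable def unitSlot (A : Type*) [Semiring A] [Algebra k A] : H →ₐ[k] A :=
  (Algebra.ofId k A).comp Q.counit

theorem unitSlot_apply (x : H) : Q.unitSlot A x = algebraMap k A (Q.counit x) := rfl

instance unitSlot_left (f : H →ₐ[k] A) : SlotsCommute (Q.unitSlot A) f where
  comm x y := Algebra.commutes (Q.counit x) (f y)

instance unitSlot_right (f : H →ₐ[k] A) : SlotsCommute f (Q.unitSlot A) where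
  comm x y := (Algebra.commutes (Q.counit y) (f x)).symm

theorem slotEval_conv_right (f g h : H →ₐ[k] A) [SlotsCommute f g] [SlotsCommute f h]
    [SlotsCommute g h] (t : H ⊗[k] H) :
    slotEval f (slotEval g h) (Algebra.TensorProduct.map (AlgHom.id k H) Q.comul t) =
      slotEval f (Q.conv g h) t := by
  have : (slotEval f (slotEval g h)).comp (Algebra.TensorProduct.map (AlgHom.id k H) Q.comul) =
      slotEval f (Q.conv g h) := by
    ext x <;> simp [conv_apply]
  exact congrArg (fun F => F t) this

theorem slotEval_conv_left {B : Type*} [Semiring B] [Algebra k B] (f g : H →ₐ[k] A) (h : B →ₐ[k] A)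
    [SlotsCommute f g] [SlotsCommute f h] [SlotsCommute g h] [SlotsCommute (Q.conv f g) h]
    (t : H ⊗[k] B) :
    slotEval (slotEval f g) h (Algebra.TensorProduct.map Q.comul (AlgHom.id k B) t) =
      slotEval (Q.conv f g) h t := by
  have : (slotEval (slotEval f g) h).comp (Algebra.TensorProduct.map Q.comul (AlgHom.id k B)) =
      slotEval (Q.conv f g) h := by
    ext x <;> simp [conv_apply]
  exact congrArg (fun F => F t) this

/-- `f(X¹) g(X²) h(X³)`. -/
noncomputable def phiAt (f g h : H →ₐ[k] A) [SlotsCommute f g] [SlotsCommute f h]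
    [SlotsCommute g h] : A := slotEval f (slotEval g h) Q.Phi

/-- `f(x¹) g(x²) h(x³)`. -/
noncomputable def phiInvAt (f g h : H →ₐ[k] A) [SlotsCommute f g] [SlotsCommute f h]
    [SlotsCommute g h] : A := slotEval f (slotEval g h) Q.PhiInv

theorem Phi_mul_PhiInv : Q.Phi * Q.PhiInv = 1 := Q.reassoc.mul_inv

theorem PhiInv_mul_Phi : Q.PhiInv * Q.Phi = 1 := Q.reassoc.inv_mul

section

variable (f g h i : H →ₐ[k] A) [SlotsCommute f g] [SlotsCommute f h] [SlotsCommute g h]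
  [SlotsCommute f i] [SlotsCommute g i] [SlotsCommute h i]

@[simp]
theorem phiAt_mul_phiInvAt : Q.phiAt f g h * Q.phiInvAt f g h = 1 := by
  rw [phiAt, phiInvAt, ← map_mul, Phi_mul_PhiInv, map_one]

@[simp]
theorem phiInvAt_mul_phiAt : Q.phiInvAt f g h * Q.phiAt f g h = 1 := by
  rw [phiAt, phiInvAt, ← map_mul, PhiInv_mul_Phi, map_one]

@[simp]
theorem phiAt_mul_phiInvAt_mul (a : A) : Q.phiAt f g h * (Q.phiInvAt f g h * a) = a := by
  rw [← mul_assoc, phiAt_mul_phiInvAt, one_mul]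

@[simp]
theorem phiInvAt_mul_phiAt_mul (a : A) : Q.phiInvAt f g h * (Q.phiAt f g h * a) = a := by
  rw [← mul_assoc, phiInvAt_mul_phiAt, one_mul]

theorem phiAt_mul_conv (x : H) :
    Q.phiAt f g h * Q.conv (Q.conv f g) h x = Q.conv f (Q.conv g h) x * Q.phiAt f g h := by
  have e := congrArg (slotEval f (slotEval g h)) (Q.quasi_coassoc x)
  rw [slotEval_conv_right, map_mul, map_mul] at e
  have e2 : slotEval f (slotEval g h) (Algebra.TensorProduct.assoc k k k H H H
      (Algebra.TensorProduct.map Q.comul (AlgHom.id k H) (Q.comul x))) =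
      Q.conv (Q.conv f g) h x := by
    rw [conv_apply, ← slotEval_conv_left]
    exact slotEval_assoc f g h _
  rw [e2] at e
  have e3 : Q.conv f (Q.conv g h) x =
    Q.phiAt f g h * Q.conv (Q.conv f g) h x * Q.phiInvAt f g h := e
  rw [e3, mul_assoc _ (Q.phiInvAt f g h), phiInvAt_mul_phiAt, mul_one]

theorem phiInvAt_mul_conv (x : H) :
    Q.phiInvAt f g h * Q.conv f (Q.conv g h) x = Q.conv (Q.conv f g) h x * Q.phiInvAt f g h := by
  have := congrArg (fun a => Q.phiInvAt f g h * a * Q.phiInvAt f g h) (Q.phiAt_mul_conv f g h x)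
  simp only [mul_assoc, phiAt_mul_phiInvAt, phiInvAt_mul_phiAt_mul, mul_one] at this
  exact this.symm

theorem slotEval_comulFst (t : H ⊗[k] (H ⊗[k] H)) :
    slotEval f (slotEval g (slotEval h i)) (Q.comulFst t) =
      slotEval (Q.conv f g) (slotEval h i) t := by
  rw [← slotEval_conv_left]
  exact slotEval_assoc f g (slotEval h i) _

theorem slotEval_tmulOne (t : H ⊗[k] (H ⊗[k] H)) :
    slotEval f (slotEval g (slotEval h i)) (tmulOne k H t) = slotEval f (slotEval g h) t := by
  have : (slotEval f (slotEval g (slotEval h i))).toLinearMap ∘ₗ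
      TensorProduct.map LinearMap.id (TensorProduct.assoc k H H H).toLinearMap ∘ₗ
      (TensorProduct.assoc k H (H ⊗[k] H) H).toLinearMap ∘ₗ
      (TensorProduct.mk k (H ⊗[k] (H ⊗[k] H)) H).flip 1 =
      (slotEval f (slotEval g h)).toLinearMap := by
    ext x y z; simp
  exact congrArg (fun F => F t) this

/-- The pentagon identity. -/
theorem pentagon :
    Q.phiAt g h i * (Q.phiAt f (Q.conv g h) i * Q.phiAt f g h) =
      Q.phiAt f g (Q.conv h i) * Q.phiAt (Q.conv f g) h i := by
  have e := congrArg (slotEval f (slotEval g (slotEval h i))) Q.cocycle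
  rw [map_mul, map_mul, map_mul] at e
  have e1 : slotEval f (slotEval g (slotEval h i)) ((1 : H) ⊗ₜ[k] (Q.reassoc : H ⊗[k] (H ⊗[k] H)))
      = Q.phiAt g h i := by
    rw [slotEval_tmul, map_one, one_mul]; rfl
  have e2 : slotEval f (slotEval g (slotEval h i)) (Algebra.TensorProduct.map (AlgHom.id k H)
          ((Algebra.TensorProduct.assoc k k k H H H).toAlgHom.comp
            (Algebra.TensorProduct.map Q.comul (AlgHom.id k H))) Q.reassoc) =
      Q.phiAt f (Q.conv g h) i := by
    have : (slotEval f (slotEval g (slotEval h i))).comp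
        (Algebra.TensorProduct.map (AlgHom.id k H)
          ((Algebra.TensorProduct.assoc k k k H H H).toAlgHom.comp
            (Algebra.TensorProduct.map Q.comul (AlgHom.id k H)))) =
        slotEval f (slotEval (Q.conv g h) i) := by
      apply Algebra.TensorProduct.ext'
      intro x y
      rw [AlgHom.comp_apply, Algebra.TensorProduct.map_tmul, slotEval_tmul, slotEval_tmul]
      congr 1
      rw [← slotEval_conv_left]
      exact slotEval_assoc g h i _
    exact congrArg (fun F => F (Q.reassoc : H ⊗[k] (H ⊗[k] H))) this
  have e3 : slotEval f (slotEval g (slotEval h i)) (Algebra.TensorProduct.map (AlgHom.id k H)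
          (Algebra.TensorProduct.assoc k k k H H H).toAlgHom
          (Algebra.TensorProduct.assoc k k k H (H ⊗[k] H) H
            ((Q.reassoc : H ⊗[k] (H ⊗[k] H)) ⊗ₜ[k] (1 : H)))) = Q.phiAt f g h :=
    slotEval_tmulOne f g h i Q.Phi
  have e4 : slotEval f (slotEval g (slotEval h i)) (Algebra.TensorProduct.map (AlgHom.id k H)
          (Algebra.TensorProduct.map (AlgHom.id k H) Q.comul) Q.reassoc) =
      Q.phiAt f g (Q.conv h i) := by
    have : (slotEval f (slotEval g (slotEval h i))).comp (Algebra.TensorProduct.map (AlgHom.id k H)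
          (Algebra.TensorProduct.map (AlgHom.id k H) Q.comul)) =
        slotEval f (slotEval g (Q.conv h i)) := by
      apply Algebra.TensorProduct.ext'
      intro x y
      rw [AlgHom.comp_apply, Algebra.TensorProduct.map_tmul, slotEval_tmul, slotEval_tmul,
        slotEval_conv_right]
      rfl
    exact congrArg (fun F => F (Q.reassoc : H ⊗[k] (H ⊗[k] H))) this
  have e5 := Q.slotEval_comulFst f g h i Q.Phi
  rw [e1, e2, e3, e4, mul_assoc] at e
  exact e.trans (congrArg (_ * ·) e5)

@[simp]
theorem conv_unitSlot : Q.conv f (Q.unitSlot A) = f := by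
  ext x
  have : slotEval f (Q.unitSlot A) = (slotEval f (Algebra.ofId k A)
      (h := ⟨fun x y => (Algebra.commutes y (f x)).symm⟩)).comp
      (Algebra.TensorProduct.map (AlgHom.id k H) Q.counit) := by
    ext <;> simp [unitSlot]
  rw [conv_apply, this, AlgHom.comp_apply, Q.id_counit_comul]
  simp

@[simp]
theorem unitSlot_conv : Q.conv (Q.unitSlot A) f = f := by
  ext x
  have : slotEval (Q.unitSlot A) f = (slotEval (Algebra.ofId k A) f
      (h := ⟨fun y x => (Algebra.commutes y (f x))⟩)).comp
      (Algebra.TensorProduct.map Q.counit (AlgHom.id k H)) := by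
    ext <;> simp [unitSlot]
  rw [conv_apply, this, AlgHom.comp_apply, Q.counit_id_comul]
  simp

theorem phiAt_unit_mid : Q.phiAt f (Q.unitSlot A) g = 1 := by
  let r : k →ₐ[k] A := Algebra.ofId k A
  have h1 : SlotsCommute f r := ⟨fun x y => (Algebra.commutes y (f x)).symm⟩
  have h2 : SlotsCommute r g := ⟨fun y x => (Algebra.commutes y (g x))⟩
  have : slotEval f (slotEval (Q.unitSlot A) g) = (slotEval f (slotEval r g)).comp
      (Algebra.TensorProduct.map (AlgHom.id k H)
        (Algebra.TensorProduct.map Q.counit (AlgHom.id k H))) := by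
    apply Algebra.TensorProduct.ext'
    intro x y
    rw [AlgHom.comp_apply, Algebra.TensorProduct.map_tmul, slotEval_tmul, slotEval_tmul]
    congr 1
    induction y using TensorProduct.induction_on with
    | zero => simp
    | tmul a b => simp [unitSlot, r]
    | add a b ha hb => simp [ha, hb]
  rw [phiAt, this, AlgHom.comp_apply, Phi, Q.id_counit_id_reassoc, map_one]

end

section

variable (f g h : H →ₐ[k] A) [SlotsCommute f g] [SlotsCommute f h] [SlotsCommute g h]

theorem phiAt_congr {f f' g g' h h' : H →ₐ[k] A} [SlotsCommute f g] [SlotsCommute f h]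
    [SlotsCommute g h] [SlotsCommute f' g'] [SlotsCommute f' h'] [SlotsCommute g' h']
    (hf : f = f') (hg : g = g') (hh : h = h') : Q.phiAt f g h = Q.phiAt f' g' h' := by
  subst hf hg hh; rfl

/-- With the counit in the first two slots the pentagon reads `P * P = P`, where `P` is the element
in question, and `P` is invertible. Thus the middle counit axiom alone normalises the outer legs;
`phiAt_unit_right` is the mirror image. -/
theorem phiAt_unit_left : Q.phiAt (Q.unitSlot A) f g = 1 := by
  have e := Q.pentagon (Q.unitSlot A) (Q.unitSlot A) f g
  rw [Q.phiAt_congr rfl (Q.unitSlot_conv f) rfl, Q.phiAt_unit_mid,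
    Q.phiAt_unit_mid, Q.phiAt_congr (Q.unitSlot_conv _) rfl rfl, mul_one, one_mul] at e
  have e' := congrArg (· * Q.phiInvAt (Q.unitSlot A) f g) e
  simpa [mul_assoc] using e'

theorem phiAt_unit_right : Q.phiAt f g (Q.unitSlot A) = 1 := by
  have e := Q.pentagon f g (Q.unitSlot A) (Q.unitSlot A)
  rw [Q.phiAt_congr rfl (Q.conv_unitSlot g) rfl, Q.phiAt_unit_mid, one_mul,
    Q.phiAt_unit_mid, Q.phiAt_congr rfl rfl (Q.conv_unitSlot _), mul_one] at e
  have e' := congrArg (Q.phiInvAt f g (Q.unitSlot A) * ·) e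
  simpa using e'

theorem phiInvAt_congr {f f' g g' h h' : H →ₐ[k] A} [SlotsCommute f g] [SlotsCommute f h]
    [SlotsCommute g h] [SlotsCommute f' g'] [SlotsCommute f' h'] [SlotsCommute g' h']
    (hf : f = f') (hg : g = g') (hh : h = h') : Q.phiInvAt f g h = Q.phiInvAt f' g' h' := by
  subst hf hg hh; rfl

theorem phiInvAt_unit_mid : Q.phiInvAt f (Q.unitSlot A) g = 1 := by
  simpa [phiAt_unit_mid] using Q.phiAt_mul_phiInvAt f (Q.unitSlot A) g

theorem phiInvAt_unit_left : Q.phiInvAt (Q.unitSlot A) f g = 1 := by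
  simpa [phiAt_unit_left] using Q.phiAt_mul_phiInvAt (Q.unitSlot A) f g

theorem phiInvAt_unit_right : Q.phiInvAt f g (Q.unitSlot A) = 1 := by
  simpa [phiAt_unit_right] using Q.phiAt_mul_phiInvAt f g (Q.unitSlot A)

end

end QuasiHopfAlgebra

/-! ### Replacing slots under a linear map -/

section

variable {k A B C N : Type*} [Field k] [Semiring A] [Algebra k A] [Semiring B] [Algebra k B]
    [Semiring C] [Algebra k C] [AddCommMonoid N] [Module k N]

/-- Two homomorphisms agree under `c` as right-hand factors. -/
def SlotEqRight (c : A →ₗ[k] N) (f g : B →ₐ[k] A) : Prop := ∀ w x, c (w * f x) = c (w * g x)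

/-- Two homomorphisms agree under `c` as left-hand factors. -/
def SlotEqLeft (c : A →ₗ[k] N) (f g : B →ₐ[k] A) : Prop := ∀ w x, c (f x * w) = c (g x * w)

variable {c : A →ₗ[k] N} {f f' : B →ₐ[k] A}

theorem SlotEqRight.slotEval_right (hf : SlotEqRight c f f') (g : C →ₐ[k] A) [SlotsCommute g f]
    [SlotsCommute g f'] : SlotEqRight c (slotEval g f) (slotEval g f') := by
  intro w x
  induction x using TensorProduct.induction_on with
  | zero => simp
  | tmul x y => simp only [slotEval_tmul, ← mul_assoc]; exact hf _ _
  | add x y hx hy => simp only [map_add, mul_add, hx, hy]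

theorem SlotEqRight.slotEval_left (hf : SlotEqRight c f f') (g : C →ₐ[k] A) [SlotsCommute f g]
    [SlotsCommute f' g] : SlotEqRight c (slotEval f g) (slotEval f' g) := by
  intro w x
  induction x using TensorProduct.induction_on with
  | zero => simp
  | tmul x y =>
    rw [slotEval_tmul, slotEval_tmul, (SlotsCommute.comm x y).eq, (SlotsCommute.comm x y).eq,
      ← mul_assoc, ← mul_assoc, hf]
  | add x y hx hy => simp only [map_add, mul_add, hx, hy]

theorem SlotEqLeft.slotEval_left (hf : SlotEqLeft c f f') (g : C →ₐ[k] A) [SlotsCommute f g]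
    [SlotsCommute f' g] : SlotEqLeft c (slotEval f g) (slotEval f' g) := by
  intro w x
  induction x using TensorProduct.induction_on with
  | zero => simp
  | tmul x y => simp only [slotEval_tmul, mul_assoc]; exact hf _ _
  | add x y hx hy => simp only [map_add, add_mul, hx, hy]

theorem SlotEqLeft.slotEval_right (hf : SlotEqLeft c f f') (g : C →ₐ[k] A) [SlotsCommute g f]
    [SlotsCommute g f'] : SlotEqLeft c (slotEval g f) (slotEval g f') := by
  intro w x
  induction x using TensorProduct.induction_on with
  | zero => simp
  | tmul x y =>
    rw [slotEval_tmul, slotEval_tmul, (SlotsCommute.comm x y).eq, (SlotsCommute.comm x y).eq,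
      mul_assoc, mul_assoc, hf]
  | add x y hx hy => simp only [map_add, add_mul, hx, hy]

/-- A factor that commutes with both slots can be absorbed into the linear map; this reaches
reassociators that are not outermost in a product. -/
theorem SlotEqRight.mulRight (hf : SlotEqRight c f f') {u : A} (h : ∀ x, Commute (f x) u)
    (h' : ∀ x, Commute (f' x) u) : SlotEqRight (c ∘ₗ LinearMap.mulRight k u) f f' := by
  intro w x
  simp only [LinearMap.comp_apply, LinearMap.mulRight_apply, mul_assoc, (h x).eq, (h' x).eq]
  rw [← mul_assoc, hf, mul_assoc]

theorem SlotEqLeft.mulLeft (hf : SlotEqLeft c f f') {u : A} (h : ∀ x, Commute (f x) u)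
    (h' : ∀ x, Commute (f' x) u) : SlotEqLeft (c ∘ₗ LinearMap.mulLeft k u) f f' := by
  intro w x
  simp only [LinearMap.comp_apply, LinearMap.mulLeft_apply]
  rw [← mul_assoc, ← mul_assoc, ← (h x).eq, ← (h' x).eq, mul_assoc, mul_assoc, hf]

end

namespace QuasiHopfAlgebra

variable {k H A N : Type*} [Field k] [Ring H] [Algebra k H] {Q : QuasiHopfAlgebra k H}
  [Semiring A] [Algebra k A] [AddCommMonoid N] [Module k N] {c : A →ₗ[k] N}

section Right

variable {f f' g h : H →ₐ[k] A}

theorem _root_.SlotEqRight.conv_left (hf : SlotEqRight c f f') (g : H →ₐ[k] A) [SlotsCommute f g]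
    [SlotsCommute f' g] : SlotEqRight c (Q.conv f g) (Q.conv f' g) :=
  fun w x => hf.slotEval_left g w (Q.comul x)

theorem _root_.SlotEqRight.conv_right (hf : SlotEqRight c f f') (g : H →ₐ[k] A) [SlotsCommute g f]
    [SlotsCommute g f'] : SlotEqRight c (Q.conv g f) (Q.conv g f') :=
  fun w x => hf.slotEval_right g w (Q.comul x)

theorem _root_.SlotEqLeft.conv_left (hf : SlotEqLeft c f f') (g : H →ₐ[k] A) [SlotsCommute f g]
    [SlotsCommute f' g] : SlotEqLeft c (Q.conv f g) (Q.conv f' g) :=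
  fun w x => hf.slotEval_left g w (Q.comul x)

theorem _root_.SlotEqLeft.conv_right (hf : SlotEqLeft c f f') (g : H →ₐ[k] A) [SlotsCommute g f]
    [SlotsCommute g f'] : SlotEqLeft c (Q.conv g f) (Q.conv g f') :=
  fun w x => hf.slotEval_right g w (Q.comul x)

theorem _root_.SlotEqRight.phiAt_mid (hf : SlotEqRight c f f')
    [SlotsCommute g f] [SlotsCommute g h] [SlotsCommute f h]
    [SlotsCommute g f'] [SlotsCommute f' h] (w : A) :
      c (w * Q.phiAt g f h) = c (w * Q.phiAt g f' h) :=
  (hf.slotEval_left h).slotEval_right g w Q.Phi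

/-- A slot that acts under `c` as the counit may be exchanged for the counit, and a reassociator
with a counit in some leg is `1`. The variants that follow differ in the leg, in the side, and in
`Φ` versus `Φ⁻¹`. -/
theorem _root_.SlotEqRight.phiAt_mid_unit (hf : SlotEqRight c f (Q.unitSlot A))
    [SlotsCommute g f] [SlotsCommute g h] [SlotsCommute f h]
    (w : A) :
      c (w * Q.phiAt g f h) = c w := by
  rw [hf.phiAt_mid, phiAt_unit_mid, mul_one]

theorem _root_.SlotEqLeft.phiInvAt_right (hf : SlotEqLeft c f f')
    [SlotsCommute g h] [SlotsCommute g f] [SlotsCommute h f]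
    [SlotsCommute g f'] [SlotsCommute h f'] (w : A) :
      c (Q.phiInvAt g h f * w) = c (Q.phiInvAt g h f' * w) :=
  (hf.slotEval_right h).slotEval_right g w Q.PhiInv

theorem _root_.SlotEqLeft.phiInvAt_right_unit (hf : SlotEqLeft c f (Q.unitSlot A))
    [SlotsCommute g h] [SlotsCommute g f] [SlotsCommute h f]
    (w : A) :
      c (Q.phiInvAt g h f * w) = c w := by
  rw [hf.phiInvAt_right, phiInvAt_unit_right, one_mul]

theorem _root_.SlotEqLeft.phiAt_mid (hf : SlotEqLeft c f f')
    [SlotsCommute g f] [SlotsCommute g h] [SlotsCommute f h]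
    [SlotsCommute g f'] [SlotsCommute f' h] (w : A) :
      c (Q.phiAt g f h * w) = c (Q.phiAt g f' h * w) :=
  (hf.slotEval_left h).slotEval_right g w Q.Phi

theorem _root_.SlotEqLeft.phiAt_mid_unit (hf : SlotEqLeft c f (Q.unitSlot A))
    [SlotsCommute g f] [SlotsCommute g h] [SlotsCommute f h]
    (w : A) :
      c (Q.phiAt g f h * w) = c w := by
  rw [hf.phiAt_mid, phiAt_unit_mid, one_mul]

theorem _root_.SlotEqRight.phiInvAt_left (hf : SlotEqRight c f f')
    [SlotsCommute f g] [SlotsCommute f h] [SlotsCommute g h]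
    [SlotsCommute f' g] [SlotsCommute f' h] (w : A) :
      c (w * Q.phiInvAt f g h) = c (w * Q.phiInvAt f' g h) :=
  hf.slotEval_left (slotEval g h) w Q.PhiInv

theorem _root_.SlotEqRight.phiInvAt_left_unit (hf : SlotEqRight c f (Q.unitSlot A))
    [SlotsCommute f g] [SlotsCommute f h] [SlotsCommute g h]
    (w : A) :
      c (w * Q.phiInvAt f g h) = c w := by
  rw [hf.phiInvAt_left, phiInvAt_unit_left, mul_one]

theorem _root_.SlotEqLeft.phiAt_left (hf : SlotEqLeft c f f')
    [SlotsCommute f g] [SlotsCommute f h] [SlotsCommute g h]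
    [SlotsCommute f' g] [SlotsCommute f' h] (w : A) :
      c (Q.phiAt f g h * w) = c (Q.phiAt f' g h * w) :=
  hf.slotEval_left (slotEval g h) w Q.Phi

theorem _root_.SlotEqLeft.phiAt_left_unit (hf : SlotEqLeft c f (Q.unitSlot A))
    [SlotsCommute f g] [SlotsCommute f h] [SlotsCommute g h]
    (w : A) :
      c (Q.phiAt f g h * w) = c w := by
  rw [hf.phiAt_left, phiAt_unit_left, one_mul]

theorem _root_.SlotEqRight.phiAt_left (hf : SlotEqRight c f f')
    [SlotsCommute f g] [SlotsCommute f h] [SlotsCommute g h]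
    [SlotsCommute f' g] [SlotsCommute f' h] (w : A) :
      c (w * Q.phiAt f g h) = c (w * Q.phiAt f' g h) :=
  hf.slotEval_left (slotEval g h) w Q.Phi

theorem _root_.SlotEqRight.phiAt_left_unit (hf : SlotEqRight c f (Q.unitSlot A))
    [SlotsCommute f g] [SlotsCommute f h] [SlotsCommute g h]
    (w : A) :
      c (w * Q.phiAt f g h) = c w := by
  rw [hf.phiAt_left, phiAt_unit_left, mul_one]

theorem _root_.SlotEqLeft.phiInvAt_left (hf : SlotEqLeft c f f')
    [SlotsCommute f g] [SlotsCommute f h] [SlotsCommute g h]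
    [SlotsCommute f' g] [SlotsCommute f' h] (w : A) :
      c (Q.phiInvAt f g h * w) = c (Q.phiInvAt f' g h * w) :=
  hf.slotEval_left (slotEval g h) w Q.PhiInv

theorem _root_.SlotEqLeft.phiInvAt_left_unit (hf : SlotEqLeft c f (Q.unitSlot A))
    [SlotsCommute f g] [SlotsCommute f h] [SlotsCommute g h]
    (w : A) :
      c (Q.phiInvAt f g h * w) = c w := by
  rw [hf.phiInvAt_left, phiInvAt_unit_left, one_mul]

theorem _root_.SlotEqRight.phiInvAt_right (hf : SlotEqRight c f f')
    [SlotsCommute g h] [SlotsCommute g f] [SlotsCommute h f]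
    [SlotsCommute g f'] [SlotsCommute h f'] (w : A) :
      c (w * Q.phiInvAt g h f) = c (w * Q.phiInvAt g h f') :=
  (hf.slotEval_right h).slotEval_right g w Q.PhiInv

theorem _root_.SlotEqRight.phiInvAt_mid (hf : SlotEqRight c f f')
    [SlotsCommute g f] [SlotsCommute g h] [SlotsCommute f h]
    [SlotsCommute g f'] [SlotsCommute f' h] (w : A) :
      c (w * Q.phiInvAt g f h) = c (w * Q.phiInvAt g f' h) :=
  (hf.slotEval_left h).slotEval_right g w Q.PhiInv

theorem _root_.SlotEqRight.phiInvAt_mid_unit (hf : SlotEqRight c f (Q.unitSlot A))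
    [SlotsCommute g f] [SlotsCommute g h] [SlotsCommute f h]
    (w : A) :
      c (w * Q.phiInvAt g f h) = c w := by
  rw [hf.phiInvAt_mid, phiInvAt_unit_mid, mul_one]

theorem _root_.SlotEqLeft.phiAt_right (hf : SlotEqLeft c f f')
    [SlotsCommute g h] [SlotsCommute g f] [SlotsCommute h f]
    [SlotsCommute g f'] [SlotsCommute h f'] (w : A) :
      c (Q.phiAt g h f * w) = c (Q.phiAt g h f' * w) :=
  (hf.slotEval_right h).slotEval_right g w Q.Phi

theorem _root_.SlotEqLeft.phiAt_right_unit (hf : SlotEqLeft c f (Q.unitSlot A))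
    [SlotsCommute g h] [SlotsCommute g f] [SlotsCommute h f]
    (w : A) :
      c (Q.phiAt g h f * w) = c w := by
  rw [hf.phiAt_right, phiAt_unit_right, one_mul]

theorem _root_.SlotEqLeft.phiInvAt_mid (hf : SlotEqLeft c f f')
    [SlotsCommute g f] [SlotsCommute g h] [SlotsCommute f h]
    [SlotsCommute g f'] [SlotsCommute f' h] (w : A) :
      c (Q.phiInvAt g f h * w) = c (Q.phiInvAt g f' h * w) :=
  (hf.slotEval_left h).slotEval_right g w Q.PhiInv

theorem _root_.SlotEqLeft.phiInvAt_mid_unit (hf : SlotEqLeft c f (Q.unitSlot A))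
    [SlotsCommute g f] [SlotsCommute g h] [SlotsCommute f h]
    (w : A) :
      c (Q.phiInvAt g f h * w) = c w := by
  rw [hf.phiInvAt_mid, phiInvAt_unit_mid, one_mul]

theorem _root_.SlotEqRight.phiAt_right (hf : SlotEqRight c f f')
    [SlotsCommute g h] [SlotsCommute g f] [SlotsCommute h f]
    [SlotsCommute g f'] [SlotsCommute h f'] (w : A) :
      c (w * Q.phiAt g h f) = c (w * Q.phiAt g h f') :=
  (hf.slotEval_right h).slotEval_right g w Q.Phi

theorem _root_.SlotEqRight.phiAt_right_unit (hf : SlotEqRight c f (Q.unitSlot A))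
    [SlotsCommute g h] [SlotsCommute g f] [SlotsCommute h f]
    (w : A) :
      c (w * Q.phiAt g h f) = c w := by
  rw [hf.phiAt_right, phiAt_unit_right, mul_one]

end Right

/-- Used with `u` a reassociator and `f`, `f'` the two bracketings of an iterated coproduct: one
reassociator moves past another by quasi-coassociativity. -/
theorem mul_slotEval_left {B : Type*} [Semiring B] [Algebra k B] {f f' : H →ₐ[k] A} {g : B →ₐ[k] A}
    [SlotsCommute f g] [SlotsCommute f' g] {u : A} (hu : ∀ x, u * f x = f' x * u)
    (t : H ⊗[k] B) (hg : ∀ y, Commute u (g y)) : u * slotEval f g t = slotEval f' g t * u := by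
  induction t using TensorProduct.induction_on with
  | zero => simp
  | add x y hx hy => simp only [map_add, mul_add, add_mul, hx, hy]
  | tmul x y =>
    rw [slotEval_tmul, slotEval_tmul, ← mul_assoc, hu, mul_assoc, (hg y).eq, mul_assoc]

theorem mul_slotEval_right {B C : Type*} [Semiring B] [Algebra k B] [Semiring C] [Algebra k C]
    {f : C →ₐ[k] A} {g g' : B →ₐ[k] A}
    [SlotsCommute f g] [SlotsCommute f g'] {u : A} (hu : ∀ x, u * g x = g' x * u)
    (t : C ⊗[k] B) (hf : ∀ y, Commute (f y) u) : u * slotEval f g t = slotEval f g' t * u := by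
  induction t using TensorProduct.induction_on with
  | zero => simp
  | add x y hx hy => simp only [map_add, mul_add, add_mul, hx, hy]
  | tmul x y =>
    rw [slotEval_tmul, slotEval_tmul, ← mul_assoc, ← (hf x).eq, mul_assoc, hu, mul_assoc]

end QuasiHopfAlgebra

/-! ### Contracted forms of the pentagon -/

namespace QuasiHopfAlgebra

variable {k H A N : Type*} [Field k] [Ring H] [Algebra k H] (Q : QuasiHopfAlgebra k H)
  [Semiring A] [Algebra k A] [AddCommMonoid N] [Module k N] {c : A →ₗ[k] N}

section

variable (f g h i : H →ₐ[k] A) [SlotsCommute f g] [SlotsCommute f h] [SlotsCommute g h]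
  [SlotsCommute f i] [SlotsCommute g i] [SlotsCommute h i]

theorem pentagon_delta : Q.phiAt (Q.conv f g) h i * Q.phiInvAt f g h =
    Q.phiInvAt f g (Q.conv h i) * (Q.phiAt g h i * Q.phiAt f (Q.conv g h) i) := by
  have e := congrArg (fun a => Q.phiInvAt f g (Q.conv h i) * (a * Q.phiInvAt f g h))
    (Q.pentagon f g h i)
  simpa [mul_assoc] using e.symm

theorem pentagon_gamma : Q.phiAt f g h * Q.phiInvAt (Q.conv f g) h i =
    Q.phiInvAt f (Q.conv g h) i * (Q.phiInvAt g h i * Q.phiAt f g (Q.conv h i)) := by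
  have e := congrArg (fun a => Q.phiInvAt f (Q.conv g h) i * (Q.phiInvAt g h i *
    (a * Q.phiInvAt (Q.conv f g) h i))) (Q.pentagon f g h i)
  simpa [mul_assoc] using e

theorem pentagon_inv : Q.phiInvAt f g h * (Q.phiInvAt f (Q.conv g h) i * Q.phiInvAt g h i) =
    Q.phiInvAt (Q.conv f g) h i * Q.phiInvAt f g (Q.conv h i) := by
  have e := congrArg (fun a => Q.phiInvAt f g h * (Q.phiInvAt f (Q.conv g h) i *
    (Q.phiInvAt g h i * (a * (Q.phiInvAt (Q.conv f g) h i * Q.phiInvAt f g (Q.conv h i))))))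
    (Q.pentagon f g h i)
  simpa [mul_assoc] using e.symm

theorem pentagon_right : Q.phiInvAt g h i * Q.phiAt f g (Q.conv h i) =
    Q.phiAt f (Q.conv g h) i * (Q.phiAt f g h * Q.phiInvAt (Q.conv f g) h i) := by
  have e := congrArg (fun a => Q.phiInvAt g h i * (a * Q.phiInvAt (Q.conv f g) h i))
    (Q.pentagon f g h i)
  simpa [mul_assoc] using e.symm

theorem pentagon_left_inv : Q.phiInvAt f g (Q.conv h i) * Q.phiAt g h i =
    Q.phiAt (Q.conv f g) h i * (Q.phiInvAt f g h * Q.phiInvAt f (Q.conv g h) i) := by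
  have e := congrArg (fun a => Q.phiInvAt f g (Q.conv h i) * (a * (Q.phiInvAt f g h *
    Q.phiInvAt f (Q.conv g h) i))) (Q.pentagon f g h i)
  simpa [mul_assoc] using e

variable {f g h i}

/-- The pentagon is solved so that the factors to be discarded stand outermost. In the applications
`hr` comes from `h₁ β S(h₂) = ε(h) β` at a vector containing `β`, and `hl` from `S(h₁) α h₂ = ε(h)
α` in a map that multiplies through `α`. The other contraction lemmas vary which composite slots are
trivial. -/
theorem contract_delta (hr : SlotEqRight c (Q.conv g h) (Q.unitSlot A))
    (hl : SlotEqLeft c (Q.conv h i) (Q.unitSlot A)) :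
    c (Q.phiAt (Q.conv f g) h i * Q.phiInvAt f g h) = c (Q.phiAt g h i) := by
  rw [pentagon_delta, hl.phiInvAt_right_unit, hr.phiAt_mid_unit]

theorem contract_right (hr : SlotEqRight c (Q.conv f g) (Q.unitSlot A))
    (hl : SlotEqLeft c (Q.conv g h) (Q.unitSlot A)) :
    c (Q.phiInvAt g h i * Q.phiAt f g (Q.conv h i)) = c (Q.phiAt f g h) := by
  rw [pentagon_right, hl.phiAt_mid_unit, hr.phiInvAt_left_unit]

theorem contract_left_inv (hr : SlotEqRight c (Q.conv g h) (Q.unitSlot A))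
    (hl : SlotEqLeft c (Q.conv f g) (Q.unitSlot A)) :
    c (Q.phiInvAt f g (Q.conv h i) * Q.phiAt g h i) = c (Q.phiInvAt f g h) := by
  rw [pentagon_left_inv, hl.phiAt_left_unit, hr.phiInvAt_mid_unit]

theorem contract_delta_left (hl : SlotEqLeft c (Q.conv h i) (Q.unitSlot A)) :
    c (Q.phiAt (Q.conv f g) h i * Q.phiInvAt f g h) =
      c (Q.phiAt g h i * Q.phiAt f (Q.conv g h) i) := by
  rw [pentagon_delta, hl.phiInvAt_right_unit]

theorem contract_gamma_right (hr : SlotEqRight c (Q.conv h i) (Q.unitSlot A)) :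
    c (Q.phiAt f g h * Q.phiInvAt (Q.conv f g) h i) =
      c (Q.phiInvAt f (Q.conv g h) i * Q.phiInvAt g h i) := by
  rw [pentagon_gamma, ← mul_assoc, hr.phiAt_right_unit]

theorem contract_gamma_mid (hl : SlotEqLeft c (Q.conv g h) (Q.unitSlot A)) :
    c (Q.phiAt f g h * Q.phiInvAt (Q.conv f g) h i) =
      c (Q.phiInvAt g h i * Q.phiAt f g (Q.conv h i)) := by
  rw [pentagon_gamma, hl.phiInvAt_mid_unit]

theorem contract_delta_mid (hr : SlotEqRight c (Q.conv g h) (Q.unitSlot A)) :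
    c (Q.phiAt f g (Q.conv h i) * (Q.phiAt (Q.conv f g) h i * Q.phiInvAt f g h)) =
      c (Q.phiAt g h i) := by
  rw [pentagon_delta, phiAt_mul_phiInvAt_mul, hr.phiAt_mid_unit]

theorem contract_gamma_inv (hl : SlotEqLeft c (Q.conv g h) (Q.unitSlot A)) :
    c (Q.phiAt f g h * (Q.phiInvAt (Q.conv f g) h i * Q.phiInvAt f g (Q.conv h i))) =
      c (Q.phiInvAt g h i) := by
  rw [← mul_assoc, pentagon_gamma, mul_assoc, mul_assoc, phiAt_mul_phiInvAt, mul_one,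
    hl.phiInvAt_mid_unit]

end

section

variable {f g h i j : H →ₐ[k] A} [SlotsCommute f g] [SlotsCommute f h] [SlotsCommute g h]
  [SlotsCommute f i] [SlotsCommute g i] [SlotsCommute h i]
  [SlotsCommute f j] [SlotsCommute g j] [SlotsCommute h j] [SlotsCommute i j]

theorem commute_phiAt_right (f : H →ₐ[k] A) (x : H) [SlotsCommute f g] [SlotsCommute f h]
    [SlotsCommute f i] : Commute (f x) (Q.phiAt g h i) :=
  SlotsCommute.comm (g := slotEval g (slotEval h i)) x _

theorem commute_phiInvAt_right (f : H →ₐ[k] A) (x : H) [SlotsCommute f g] [SlotsCommute f h]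
    [SlotsCommute f i] : Commute (f x) (Q.phiInvAt g h i) :=
  SlotsCommute.comm (g := slotEval g (slotEval h i)) x _

theorem commute_phiAt_left (j : H →ₐ[k] A) (x : H) [SlotsCommute g j] [SlotsCommute h j]
    [SlotsCommute i j] : Commute (Q.phiAt g h i) (j x) :=
  SlotsCommute.comm (f := slotEval g (slotEval h i)) _ x

theorem commute_phiInvAt_left (j : H →ₐ[k] A) (x : H) [SlotsCommute g j] [SlotsCommute h j]
    [SlotsCommute i j] : Commute (Q.phiInvAt g h i) (j x) :=
  SlotsCommute.comm (f := slotEval g (slotEval h i)) _ x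

/-- This is the pentagon on the slots `f g`, `h`, `i`, `j`. Quasi-coassociativity then moves `Φ⁻¹(f,
g, h)` to the left, which rebrackets `(f g) h` as `f (g h)` and exposes the trivial pair `g h` to
`hr`. -/
theorem contract_twist (hr : SlotEqRight c (Q.conv g h) (Q.unitSlot A))
    (hl : SlotEqLeft c (Q.conv i j) (Q.unitSlot A)) :
    c (Q.phiAt h i j * (Q.phiAt (Q.conv f g) (Q.conv h i) j *
      (Q.phiAt (Q.conv f g) h i * Q.phiInvAt f g h))) = c (Q.phiInvAt f g h * Q.phiAt f i j) := by
  have e : Q.phiInvAt f g h * Q.phiAt (Q.conv f (Q.conv g h)) i j =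
      Q.phiAt (Q.conv (Q.conv f g) h) i j * Q.phiInvAt f g h := by
    rw [phiAt, phiAt]
    exact mul_slotEval_left (fun x => Q.phiInvAt_mul_conv f g h x) _
      (fun x => SlotsCommute.comm (f := slotEval f (slotEval g h)) (g := slotEval i j) _ x)
  have e2 := congrArg (· * Q.phiInvAt f g h) (Q.pentagon (Q.conv f g) h i j)
  simp only [mul_assoc] at e2
  rw [e2, ← e, hl.phiAt_right_unit, (hr.conv_right f).phiAt_left]
  rw [Q.phiAt_congr (Q.conv_unitSlot f) rfl rfl]

/-- Two pentagons, on `f, g, h, i j` and on `g, h, i, j`, share the factor `Φ(g, h, i j)`, which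
cancels between them; the hypotheses remove the factors in which `f g` or `h i` is a composite leg.
-/
theorem contract_middle (hr : SlotEqRight c (Q.conv h i) (Q.unitSlot A))
    (hl : SlotEqLeft c (Q.conv f g) (Q.unitSlot A)) :
    c (Q.phiInvAt f g h * (Q.phiInvAt f (Q.conv g h) (Q.conv i j) *
      (Q.phiAt (Q.conv g h) i j * Q.phiInvAt g h i))) = c (Q.phiAt h i j * Q.phiInvAt f g j) := by
  have e0 := congrArg (· * Q.phiAt g h (Q.conv i j)) (Q.pentagon_inv f g h (Q.conv i j))
  simp only [mul_assoc, phiInvAt_mul_phiAt, mul_one] at e0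
  rw [← mul_assoc (Q.phiInvAt f g h), e0, mul_assoc, hl.phiInvAt_left_unit, mul_assoc,
    pentagon_delta, phiAt_mul_phiInvAt_mul]
  have e : Q.phiInvAt f g (Q.conv h (Q.conv i j)) * Q.phiAt h i j =
      Q.phiAt h i j * Q.phiInvAt f g (Q.conv (Q.conv h i) j) := by
    rw [phiInvAt, phiInvAt]
    exact (mul_slotEval_right (fun y => mul_slotEval_right (fun x => Q.phiAt_mul_conv h i j x) y
      fun x => Q.commute_phiAt_right g x) _ fun x => Q.commute_phiAt_right f x).symm
  rw [← mul_assoc, hr.phiAt_mid_unit, e, (hr.conv_left j).phiInvAt_right]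
  rw [Q.phiInvAt_congr rfl rfl (Q.unitSlot_conv j)]

/-- Here the pentagons are those on `f, g h, i, j` and on `f, g, h, i`. Both trivial pairs first
occur inside larger composite slots, where they are replaced by counits. -/
theorem contract_nested (hr : SlotEqRight c (Q.conv f g) (Q.unitSlot A))
    (hl : SlotEqLeft c (Q.conv h i) (Q.unitSlot A)) :
    c (Q.phiAt g h i * (Q.phiInvAt (Q.conv g h) i j * (Q.phiAt f (Q.conv g h) (Q.conv i j) *
      Q.phiAt f g h))) = c (Q.phiAt f g j * Q.phiInvAt h i j) := by
  have e1 : Q.phiInvAt (Q.conv f (Q.conv g h)) i j * Q.phiAt f g h =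
      Q.phiAt f g h * Q.phiInvAt (Q.conv (Q.conv f g) h) i j := by
    rw [phiInvAt, phiInvAt]
    exact (mul_slotEval_left (fun x => Q.phiAt_mul_conv f g h x) _
      (fun x => SlotsCommute.comm (f := slotEval f (slotEval g h)) (g := slotEval i j) _ x)).symm
  have e2 : Q.phiAt g h i * Q.phiAt f (Q.conv (Q.conv g h) i) j =
      Q.phiAt f (Q.conv g (Q.conv h i)) j * Q.phiAt g h i := by
    rw [phiAt.eq_def (f := f), phiAt.eq_def (f := f)]
    exact mul_slotEval_right (fun y => mul_slotEval_left (fun x => Q.phiAt_mul_conv g h i x) y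
      fun x => Q.commute_phiAt_left j x) _ fun x => Q.commute_phiAt_right f x
  rw [← mul_assoc (Q.phiInvAt (Q.conv g h) i j), pentagon_right, mul_assoc, mul_assoc, e1,
    ← mul_assoc (Q.phiAt g h i), e2, mul_assoc,
    ← mul_assoc (Q.phiAt f (Q.conv g h) i), ← mul_assoc (Q.phiAt g h i), Q.pentagon f g h i,
    ← mul_assoc, (hr.conv_left h).phiInvAt_left, mul_assoc, (hl.conv_right g).phiAt_mid,
    Q.phiAt_congr rfl (Q.conv_unitSlot g) rfl, Q.phiInvAt_congr (Q.unitSlot_conv h) rfl rfl]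
  have s1 : SlotsCommute (Q.conv h i) f := ⟨fun a b => (SlotsCommute.comm b a).symm⟩
  have s2 : SlotsCommute (Q.conv h i) g := ⟨fun a b => (SlotsCommute.comm b a).symm⟩
  -- Two reassociators remain in the middle, with composite legs `h i` and `f g`. The outer factor
  -- `Φ(f, g, j)` commutes with the slot `h i`, and `Φ⁻¹(h, i, j)` with the slot `f g`, so each can
  -- be absorbed into `c`.
  have hl' := hl.mulLeft (u := Q.phiAt f g j) (fun x => Q.commute_phiAt_right _ x)
    fun x => Q.commute_phiAt_right _ x
  have hr' := hr.mulRight (u := Q.phiInvAt h i j) (fun x => Q.commute_phiInvAt_right _ x)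
    fun x => Q.commute_phiInvAt_right _ x
  have a1 := hl'.phiAt_right_unit (g := f) (h := g) (Q.phiAt (Q.conv f g) h i * Q.phiInvAt h i j)
  have a2 := hr'.phiAt_left_unit (g := h) (h := i) (Q.phiAt f g j)
  simp only [LinearMap.comp_apply, LinearMap.mulLeft_apply, LinearMap.mulRight_apply,
    mul_assoc] at a1 a2 ⊢
  rw [a1, a2]

end

end QuasiHopfAlgebra

/-! ### Slots acting on tensor products of modules -/

theorem TensorProduct.triple_induction {k A B C : Type*} [CommRing k] [AddCommMonoid A] [Module k A]
    [AddCommMonoid B] [Module k B] [AddCommMonoid C] [Module k C] {P : A ⊗[k] (B ⊗[k] C) → Prop}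
    (zero : P 0) (tmul : ∀ a b c, P (a ⊗ₜ (b ⊗ₜ c))) (add : ∀ x y, P x → P y → P (x + y))
    (t : A ⊗[k] (B ⊗[k] C)) : P t := by
  induction t using TensorProduct.induction_on with
  | zero => exact zero
  | add x y hx hy => exact add x y hx hy
  | tmul x y =>
    induction y using TensorProduct.induction_on with
    | zero => simpa using zero
    | add y z hy hz => rw [TensorProduct.tmul_add]; exact add _ _ hy hz
    | tmul y z => exact tmul x y z

section

variable {k B C M N : Type*} [Field k] [Semiring B] [Algebra k B] [Semiring C] [Algebra k C]
  [AddCommMonoid M] [Module k M] [AddCommMonoid N] [Module k N]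

/-- The action on the first factor of a tensor product. -/
noncomputable def onFst (N : Type*) [AddCommMonoid N] [Module k N] (f : B →ₐ[k] Module.End k M) :
    B →ₐ[k] Module.End k (M ⊗[k] N) := (Module.End.rTensorAlgHom k M N).comp f

/-- The action on the second factor of a tensor product. -/
noncomputable def onSnd (M : Type*) [AddCommMonoid M] [Module k M] (f : B →ₐ[k] Module.End k N) :
    B →ₐ[k] Module.End k (M ⊗[k] N) := (Module.End.lTensorAlgHom k N M).comp f

@[simp]
theorem onFst_tmul (f : B →ₐ[k] Module.End k M) (b : B) (x : M) (y : N) :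
    onFst N f b (x ⊗ₜ y) = f b x ⊗ₜ y := rfl

@[simp]
theorem onSnd_tmul (f : B →ₐ[k] Module.End k N) (b : B) (x : M) (y : N) :
    onSnd M f b (x ⊗ₜ y) = x ⊗ₜ f b y := rfl

instance onFst_onSnd (f : B →ₐ[k] Module.End k M) (g : C →ₐ[k] Module.End k N) :
    SlotsCommute (onFst N f) (onSnd M g) where
  comm x y := by ext; simp

instance onSnd_onFst (f : B →ₐ[k] Module.End k M) (g : C →ₐ[k] Module.End k N) :
    SlotsCommute (onSnd M g) (onFst N f) where
  comm x y := by ext; simp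

instance onFst_onFst (f : B →ₐ[k] Module.End k M) (g : C →ₐ[k] Module.End k M)
    [SlotsCommute f g] : SlotsCommute (onFst N f) (onFst N g) where
  comm x y := (SlotsCommute.comm (f := f) (g := g) x y).map (Module.End.rTensorAlgHom k M N)

instance onSnd_onSnd (f : B →ₐ[k] Module.End k N) (g : C →ₐ[k] Module.End k N)
    [SlotsCommute f g] : SlotsCommute (onSnd M f) (onSnd M g) where
  comm x y := (SlotsCommute.comm (f := f) (g := g) x y).map (Module.End.lTensorAlgHom k N M)

/-- The matrix coefficient `w ↦ c (w v)`. -/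
def matCoef {P : Type*} [AddCommMonoid P] [Module k P] (c : M →ₗ[k] P) (v : M) :
    Module.End k M →ₗ[k] P := c ∘ₗ LinearMap.applyₗ v

@[simp]
theorem matCoef_apply {P : Type*} [AddCommMonoid P] [Module k P] (c : M →ₗ[k] P) (v : M)
    (w : Module.End k M) : matCoef c v w = c (w v) := rfl

end

/-! ### Multiplication slots and the basic identities of `p` -/

namespace QuasiHopfAlgebra

variable {k H : Type*} [Field k] [Ring H] [Algebra k H] (Q : QuasiHopfAlgebra k H)

attribute [simp] QuasiHopfAlgebra.antipode_one QuasiHopfAlgebra.antipode_mul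

/-- `a ↦ (x ↦ a x)`. -/
noncomputable def lSlot (k H : Type*) [Field k] [Ring H] [Algebra k H] : H →ₐ[k] Module.End k H :=
  Algebra.lmul k H

/-- `a ↦ (x ↦ x S(a))`. -/
noncomputable def rSlot : H →ₐ[k] Module.End k H :=
  AlgHom.ofLinearMap ((LinearMap.mul k H).flip ∘ₗ Q.antipode) (by ext; simp)
    (fun a b => by ext; simp [mul_assoc])

@[simp]
theorem lSlot_apply (a x : H) : lSlot k H a x = a * x := rfl

@[simp]
theorem rSlot_apply (a x : H) : Q.rSlot a x = x * Q.antipode a := rfl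

instance lSlot_rSlot : SlotsCommute (lSlot k H) Q.rSlot where
  comm a b := by ext; simp [mul_assoc]

@[simp]
theorem mulMid_tmul {A : Type*} [Ring A] [Algebra k A] (a x y : A) :
    mulMid k a (x ⊗ₜ y) = x * a * y := by simp [mulMid]

@[simp]
theorem evMap_tmul (x y : H) : Q.evMap (x ⊗ₜ y) = Q.antipode x * Q.α * y := by simp [evMap]

@[simp]
theorem coevMap_tmul (x y : H) : Q.coevMap (x ⊗ₜ y) = x * Q.β * Q.antipode y := by simp [coevMap]

@[simp]
theorem evMap_comul (h : H) : Q.evMap (Q.comul h) = Q.counit h • Q.α := Q.antipode_left h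

@[simp]
theorem coevMap_comul (h : H) : Q.coevMap (Q.comul h) = Q.counit h • Q.β := Q.antipode_right h

@[simp]
theorem unitSlot_end_apply {M : Type*} [AddCommMonoid M] [Module k M] (h : H) (m : M) :
    Q.unitSlot (Module.End k M) h m = Q.counit h • m := rfl

@[simp]
theorem slotEval_lr_beta (t : H ⊗[k] H) :
    slotEval (lSlot k H) Q.rSlot t Q.β = Q.coevMap t := by
  induction t using TensorProduct.induction_on with
  | zero => simp
  | add x y hx hy => simp [hx, hy]
  | tmul x y => simp [mul_assoc]

@[simp]
theorem conv_lr_beta (h : H) : Q.conv (lSlot k H) Q.rSlot h Q.β = Q.counit h • Q.β := by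
  rw [conv_apply, slotEval_lr_beta, coevMap_comul]

section

variable {M N P : Type*} [AddCommMonoid M] [Module k M] [AddCommMonoid N] [Module k N]
  [AddCommMonoid P] [Module k P]

theorem slotEval_onFst (f g : H →ₐ[k] Module.End k M) [SlotsCommute f g] (t : H ⊗[k] H) :
    slotEval (onFst N f) (onFst N g) t = Module.End.rTensorAlgHom k M N (slotEval f g t) := by
  induction t using TensorProduct.induction_on with
  | zero => simp
  | add x y hx hy => simp only [map_add, hx, hy]
  | tmul x y => simp [onFst]

theorem slotEval_onSnd (f g : H →ₐ[k] Module.End k N) [SlotsCommute f g] (t : H ⊗[k] H) :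
    slotEval (onSnd M f) (onSnd M g) t = Module.End.lTensorAlgHom k N M (slotEval f g t) := by
  induction t using TensorProduct.induction_on with
  | zero => simp
  | add x y hx hy => simp only [map_add, hx, hy]
  | tmul x y => simp [onSnd]

@[simp]
theorem conv_onFst_tmul (f g : H →ₐ[k] Module.End k M) [SlotsCommute f g] (h : H) (m : M) (n : N) :
    Q.conv (onFst N f) (onFst N g) h (m ⊗ₜ n) = Q.conv f g h m ⊗ₜ n := by
  rw [conv_apply, slotEval_onFst]; rfl

@[simp]
theorem conv_onSnd_tmul (f g : H →ₐ[k] Module.End k N) [SlotsCommute f g] (h : H) (m : M) (n : N) :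
    Q.conv (onSnd M f) (onSnd M g) h (m ⊗ₜ n) = m ⊗ₜ Q.conv f g h n := by
  rw [conv_apply, slotEval_onSnd]; rfl

/-- This is where contraction hypotheses originate: a vector that is invariant under `J`, in
practice one containing `β`, trivialises `J` as the factor acting first. `slotEqLeft_matCoef` does
the same with an invariant outer map, in practice one containing `α`. -/
theorem slotEqRight_matCoef (c : M →ₗ[k] P) {v : M} {J : H →ₐ[k] Module.End k M}
    (hJ : ∀ h, J h v = Q.counit h • v) : SlotEqRight (A := Module.End k _) (matCoef c v) J (Q.unitSlot _) :=
  fun w h => by simp [hJ]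

theorem conv_right_apply {v : M} (f : H →ₐ[k] Module.End k M) {J : H →ₐ[k] Module.End k M}
    [SlotsCommute f J] (hJ : ∀ h, J h v = Q.counit h • v) (h : H) : Q.conv f J h v = f h v := by
  simpa using (Q.slotEqRight_matCoef LinearMap.id hJ).conv_right (Q := Q) f 1 h

theorem conv_left_apply {v : M} (f : H →ₐ[k] Module.End k M) {J : H →ₐ[k] Module.End k M}
    [SlotsCommute J f] (hJ : ∀ h, J h v = Q.counit h • v) (h : H) : Q.conv J f h v = f h v := by
  simpa using (Q.slotEqRight_matCoef LinearMap.id hJ).conv_left (Q := Q) f 1 h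

theorem slotEqLeft_matCoef {c : M →ₗ[k] P} (v : M) {J : H →ₐ[k] Module.End k M}
    (hJ : ∀ h m, c (J h m) = Q.counit h • c m) : SlotEqLeft (A := Module.End k _) (matCoef c v) J (Q.unitSlot _) :=
  fun w h => by simp [hJ]

end

/-- Left multiplication on the first factor of `H ⊗ H`. -/
noncomputable abbrev lPair1 (k H : Type*) [Field k] [Ring H] [Algebra k H] :
    H →ₐ[k] Module.End k (H ⊗[k] H) := onFst H (lSlot k H)

/-- Left multiplication on the second factor of `H ⊗ H`. -/
noncomputable abbrev lPair2 (k H : Type*) [Field k] [Ring H] [Algebra k H] :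
    H →ₐ[k] Module.End k (H ⊗[k] H) := onSnd H (lSlot k H)

/-- Right multiplication by `S(a)` on the first factor of `H ⊗ H`. -/
noncomputable abbrev rPair1 : H →ₐ[k] Module.End k (H ⊗[k] H) := onFst H Q.rSlot

/-- Right multiplication by `S(a)` on the second factor of `H ⊗ H`. -/
noncomputable abbrev rPair2 : H →ₐ[k] Module.End k (H ⊗[k] H) := onSnd H Q.rSlot

/-- Left multiplication on the first factor of `H ⊗ H ⊗ H`. -/
noncomputable abbrev lTri1 (k H : Type*) [Field k] [Ring H] [Algebra k H] :
    H →ₐ[k] Module.End k (H ⊗[k] (H ⊗[k] H)) := onFst (H ⊗[k] H) (lSlot k H)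

/-- Left multiplication on the second factor of `H ⊗ H ⊗ H`. -/
noncomputable abbrev lTri2 (k H : Type*) [Field k] [Ring H] [Algebra k H] :
    H →ₐ[k] Module.End k (H ⊗[k] (H ⊗[k] H)) := onSnd H (lPair1 k H)

/-- Left multiplication on the third factor of `H ⊗ H ⊗ H`. -/
noncomputable abbrev lTri3 (k H : Type*) [Field k] [Ring H] [Algebra k H] :
    H →ₐ[k] Module.End k (H ⊗[k] (H ⊗[k] H)) := onSnd H (lPair2 k H)

/-- Right multiplication by `S(a)` on the first factor of `H ⊗ H ⊗ H`. -/
noncomputable abbrev rTri1 : H →ₐ[k] Module.End k (H ⊗[k] (H ⊗[k] H)) := onFst (H ⊗[k] H) Q.rSlot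

/-- Right multiplication by `S(a)` on the second factor of `H ⊗ H ⊗ H`. -/
noncomputable abbrev rTri2 : H →ₐ[k] Module.End k (H ⊗[k] (H ⊗[k] H)) := onSnd H (rPair1 Q)

/-- Right multiplication by `S(a)` on the third factor of `H ⊗ H ⊗ H`. -/
noncomputable abbrev rTri3 : H →ₐ[k] Module.End k (H ⊗[k] (H ⊗[k] H)) := onSnd H (rPair2 Q)

theorem comulAction_apply (h : H) (t : H ⊗[k] H) :
    Q.conv (lPair1 k H) (lPair2 k H) h t = Q.comul h * t := by
  rw [conv_apply]
  generalize Q.comul h = s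
  induction s using TensorProduct.induction_on with
  | zero => simp
  | add x y hx hy => simp [hx, hy, add_mul]
  | tmul a b =>
    induction t using TensorProduct.induction_on with
    | zero => simp
    | add x y hx hy => simp only [map_add, mul_add, hx, hy]
    | tmul x y => simp

/-- `X¹ ⊗ S(X²) α X³`. -/
noncomputable def qHat : H ⊗[k] H := TensorProduct.map LinearMap.id Q.evMap Q.Phi

/-- `X¹ β S(X²) ⊗ X³`. -/
noncomputable def pHat : H ⊗[k] H :=
  TensorProduct.map Q.coevMap LinearMap.id ((TensorProduct.assoc k H H H).symm Q.Phi)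

theorem slotEval_p (T : H ⊗[k] (H ⊗[k] H)) (x : H) :
    slotEval (lPair1 k H) (slotEval (lPair2 k H) (rPair2 Q)) T
      (x ⊗ₜ Q.β) = TensorProduct.map LinearMap.id Q.coevMap T * (x ⊗ₜ 1) := by
  induction T using TensorProduct.triple_induction with
  | zero => simp
  | add x y hx hy => simp [hx, hy, add_mul]
  | tmul a b c => simp [mul_assoc]

/-- It exhibits `p` as the result of `Φ⁻¹` acting on `1 ⊗ β`, with `S(x³)` acting from the right, so
that identities for `p` become identities for `Φ⁻¹` in slots. -/
theorem phiInvAt_beta (x : H) :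
    Q.phiInvAt (lPair1 k H) (lPair2 k H) (rPair2 Q) (x ⊗ₜ Q.β) =
      Q.pR * (x ⊗ₜ 1) := Q.slotEval_p _ x

/-- `x ⊗ y ↦ Δ(x) t (1 ⊗ y)`. -/
noncomputable def comulMid (t : H ⊗[k] H) : H ⊗[k] H →ₗ[k] H ⊗[k] H :=
  mulMid k t ∘ₗ TensorProduct.map Q.comul.toLinearMap (TensorProduct.mk k H H 1)

@[simp]
theorem comulMid_tmul (t : H ⊗[k] H) (x y : H) :
    Q.comulMid t (x ⊗ₜ y) = Q.comul x * t * (1 ⊗ₜ y) := by simp [comulMid]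

/-- `x ⊗ y ↦ (x ⊗ 1) t Δ(y)`. -/
noncomputable def midComul (t : H ⊗[k] H) : H ⊗[k] H →ₗ[k] H ⊗[k] H :=
  mulMid k t ∘ₗ TensorProduct.map ((TensorProduct.mk k H H).flip 1) Q.comul.toLinearMap

@[simp]
theorem midComul_tmul (t : H ⊗[k] H) (x y : H) :
    Q.midComul t (x ⊗ₜ y) = (x ⊗ₜ 1) * t * Q.comul y := by simp [midComul]

/-- `Δ(h₁) p (1 ⊗ S(h₂)) = p (h ⊗ 1)`. -/
theorem comulMid_pR (h : H) :
    Q.comulMid Q.pR (TensorProduct.map LinearMap.id Q.antipode (Q.comul h)) =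
      Q.pR * (h ⊗ₜ 1) := by
  have e : ∀ (s t : H ⊗[k] H),
      Q.comulMid t (TensorProduct.map LinearMap.id Q.antipode s) =
      slotEval (Q.conv (lPair1 k H) (lPair2 k H)) (rPair2 Q) s t := by
    intro s t
    induction s using TensorProduct.induction_on with
    | zero => simp
    | add x y hx hy => simp [hx, hy]
    | tmul a b =>
      simp only [TensorProduct.map_tmul, LinearMap.id_apply, comulMid_tmul, slotEval_tmul,
        Module.End.mul_apply, comulAction_apply, mul_assoc]
      congr 1
      induction t using TensorProduct.induction_on with
      | zero => simp
      | add x y hx hy => simp [hx, hy, add_mul]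
      | tmul x y => simp
  rw [e, ← conv_apply]
  have e1 := Q.phiInvAt_beta 1
  rw [← Algebra.TensorProduct.one_def, mul_one] at e1
  have e2 := Q.phiInvAt_beta h
  -- Passing through `Φ⁻¹` rebrackets the three slots. The pair formed by the second and third then
  -- meets `β` and acts by `ε`, which leaves `h` on the first factor.
  rw [← e1, ← Module.End.mul_apply, ← phiInvAt_mul_conv, Module.End.mul_apply, e1, ← e2,
    Q.conv_right_apply _ (fun h => by simp)]
  simp

/-- `Δ(X¹) p (1 ⊗ S(X²) α X³) = 1 ⊗ 1`. -/
theorem comulMid_pR_qHat : Q.comulMid Q.pR Q.qHat = 1 := by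
  let v : H ⊗[k] (H ⊗[k] H) := 1 ⊗ₜ (Q.β ⊗ₜ 1)
  let c : H ⊗[k] (H ⊗[k] H) →ₗ[k] H ⊗[k] H := TensorProduct.map LinearMap.id (mulMid k Q.α)
  have hl : ∀ h m, c (Q.conv (rTri2 Q) (lTri3 k H) h m) = Q.counit h • c m := by
    intro h m
    induction m using TensorProduct.triple_induction with
    | zero => simp
    | add x y hx hy => simp [hx, hy]
    | tmul x y z =>
      have : ∀ t : H ⊗[k] H, c (slotEval (rTri2 Q) (lTri3 k H) t (x ⊗ₜ (y ⊗ₜ z))) = x ⊗ₜ (y * Q.evMap t * z) := by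
        intro t
        induction t using TensorProduct.induction_on with
        | zero => simp
        | add a b ha hb => simp [ha, hb, mul_add, add_mul, TensorProduct.tmul_add]
        | tmul a b => simp [c, mul_assoc]
      rw [conv_apply, this]
      simp [c]
  have hr : ∀ h, Q.conv (lTri2 k H) (rTri2 Q) h v = Q.counit h • v := fun h => by
    simp [v, TensorProduct.smul_tmul]
  -- The `β` of the vector sits in the second factor and is trivial for the slots `g h`; the `α`
  -- inserted by `c` between the second and third factors makes `h i` trivial.
  have key := Q.contract_delta (f := lTri1 k H) (g := lTri2 k H)
    (h := (rTri2 Q)) (i := lTri3 k H) (Q.slotEqRight_matCoef c hr) (Q.slotEqLeft_matCoef v hl)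
  have e1 : ∀ W, slotEval (lTri1 k H) (slotEval (lTri2 k H) (rTri2 Q)) W v = TensorProduct.map LinearMap.id
      ((TensorProduct.mk k H H).flip 1) (TensorProduct.map LinearMap.id Q.coevMap W) := by
    intro W
    induction W using TensorProduct.triple_induction with
    | zero => simp
    | add x y hx hy => simp [hx, hy]
    | tmul x y z => simp [v, mul_assoc]
  have e2 : ∀ (T : H ⊗[k] (H ⊗[k] H)) (p : H ⊗[k] H), c (slotEval (Q.conv (lTri1 k H) (lTri2 k H)) (slotEval (rTri2 Q) (lTri3 k H)) T
      (TensorProduct.map LinearMap.id ((TensorProduct.mk k H H).flip 1) p)) =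
      Q.comulMid p (TensorProduct.map LinearMap.id Q.evMap T) := by
    intro T p
    induction T using TensorProduct.triple_induction with
    | zero => simp
    | add x y hx hy => simp [hx, hy]
    | tmul x y z =>
      simp only [slotEval_tmul, Module.End.mul_apply, conv_apply, TensorProduct.map_tmul,
        LinearMap.id_apply, comulMid_tmul, evMap_tmul]
      generalize Q.comul x = s
      induction s using TensorProduct.induction_on with
      | zero => simp
      | add a b ha hb => simp [ha, hb, add_mul]
      | tmul a b =>
        induction p using TensorProduct.induction_on with
        | zero => simp
        | add x y hx hy => simp only [map_add, mul_add, add_mul, hx, hy]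
        | tmul u w => simp [c, mul_assoc]
  have e3 : ∀ T, c (slotEval (lTri2 k H) (slotEval (rTri2 Q) (lTri3 k H)) T v) = 1 ⊗ₜ (mulMid k Q.β
      (TensorProduct.map LinearMap.id (mulMid k Q.α ∘ₗ TensorProduct.map Q.antipode LinearMap.id)
        T)) := by
    intro T
    induction T using TensorProduct.triple_induction with
    | zero => simp
    | add x y hx hy => simp [hx, hy, TensorProduct.tmul_add]
    | tmul x y z => simp [v, c, mul_assoc]
  rw [matCoef_apply, matCoef_apply, Module.End.mul_apply, phiAt, phiAt, phiInvAt, e1, e2, e3] at key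
  rw [qHat, pR, key, Phi, Q.reassoc_antipode]
  rfl

end QuasiHopfAlgebra

/-! ### The element `q_L` and the inverse of `a ⊗ b ↦ Δ(a) p (1 ⊗ b)` -/

namespace QuasiHopfAlgebra

variable {k H : Type*} [Field k] [Ring H] [Algebra k H] (Q : QuasiHopfAlgebra k H)

/-- `a ⊗ b ⊗ d ↦ a α b ⊗ d`. -/
noncomputable def alphaLeft : H ⊗[k] (H ⊗[k] H) →ₗ[k] H ⊗[k] H :=
  TensorProduct.map (mulMid k Q.α) LinearMap.id ∘ₗ (TensorProduct.assoc k H H H).symm.toLinearMap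

@[simp]
theorem alphaLeft_tmul (a b d : H) : Q.alphaLeft (a ⊗ₜ (b ⊗ₜ d)) = (a * Q.α * b) ⊗ₜ d := by
  simp [alphaLeft]

/-- The axiom `S(h₁) α h₂ = ε(h) α` in the form of an invariant outer map, ready for left
contractions. -/
theorem alphaLeft_conv (h : H) (m : H ⊗[k] (H ⊗[k] H)) :
    Q.alphaLeft (Q.conv (rTri1 Q) (lTri2 k H) h m) = Q.counit h • Q.alphaLeft m := by
  induction m using TensorProduct.triple_induction with
  | zero => simp
  | add x y hx hy => simp [hx, hy]
  | tmul x y z =>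
    have : ∀ t : H ⊗[k] H, Q.alphaLeft (slotEval (rTri1 Q) (lTri2 k H) t (x ⊗ₜ (y ⊗ₜ z))) =
        (x * Q.evMap t * y) ⊗ₜ z := by
      intro t
      induction t using TensorProduct.induction_on with
      | zero => simp
      | add a b ha hb => simp [ha, hb, mul_add, add_mul, TensorProduct.add_tmul]
      | tmul a b => simp [mul_assoc]
    rw [conv_apply, this]
    simp [TensorProduct.smul_tmul']

theorem slotEval_lr_beta_left (W : H ⊗[k] (H ⊗[k] H)) :
    slotEval (lTri1 k H) (slotEval (rTri1 Q) (lTri2 k H)) W (Q.β ⊗ₜ (1 ⊗ₜ 1)) =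
      TensorProduct.map LinearMap.id ((TensorProduct.mk k H H).flip 1)
        (TensorProduct.map Q.coevMap LinearMap.id ((TensorProduct.assoc k H H H).symm W)) := by
  induction W using TensorProduct.triple_induction with
  | zero => simp
  | add x y hx hy => simp [hx, hy]
  | tmul x y z => simp [mul_assoc]

theorem alphaLeft_slotEval (T : H ⊗[k] (H ⊗[k] H)) (a : H) (s : H ⊗[k] H) :
    Q.alphaLeft (slotEval (rTri1 Q) (slotEval (lTri2 k H) (lTri3 k H)) T (a ⊗ₜ s)) =
      (a ⊗ₜ 1) * TensorProduct.map Q.evMap LinearMap.id ((TensorProduct.assoc k H H H).symm T) *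
        s := by
  induction T using TensorProduct.triple_induction with
  | zero => simp
  | add x y hx hy => simp [hx, hy, mul_add, add_mul]
  | tmul x y z =>
    induction s using TensorProduct.induction_on with
    | zero => simp
    | add a b ha hb => simp only [TensorProduct.tmul_add, map_add, ha, hb, mul_add]
    | tmul b d => simp [mul_assoc]

/-- `(S(h₁) ⊗ 1) q_L Δ(h₂) = (1 ⊗ h) q_L`. -/
theorem midComul_qL (h : H) :
    Q.midComul Q.qL (TensorProduct.map Q.antipode LinearMap.id (Q.comul h)) =
      (1 ⊗ₜ h) * Q.qL := by
  have e : ∀ s : H ⊗[k] H, Q.midComul Q.qL (TensorProduct.map Q.antipode LinearMap.id s) =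
      Q.alphaLeft (Q.phiInvAt (rTri1 Q) (lTri2 k H) (lTri3 k H)
        (slotEval (rTri1 Q) (Q.conv (lTri2 k H) (lTri3 k H)) s (1 ⊗ₜ 1))) := by
    intro s
    induction s using TensorProduct.induction_on with
    | zero => simp
    | add x y hx hy => simp [hx, hy]
    | tmul a b =>
      rw [slotEval_tmul, Module.End.mul_apply, conv_onSnd_tmul, comulAction_apply, onFst_tmul,
        phiInvAt, alphaLeft_slotEval, rSlot_apply]
      simp [qL]
  rw [e, ← conv_apply, ← Module.End.mul_apply, phiInvAt_mul_conv, Module.End.mul_apply]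
  have e2 := (Q.slotEqLeft_matCoef (1 ⊗ₜ 1) Q.alphaLeft_conv).conv_left (Q := Q) (lTri3 k H)
    (Q.phiInvAt (rTri1 Q) (lTri2 k H) (lTri3 k H)) h
  rw [matCoef_apply, matCoef_apply, unitSlot_conv, Module.End.mul_apply, Module.End.mul_apply] at e2
  rw [e2]
  have e3 : ∀ m, Q.alphaLeft (lTri3 k H h m) = (1 ⊗ₜ h) * Q.alphaLeft m := by
    intro m
    induction m using TensorProduct.triple_induction with
    | zero => simp
    | add x y hx hy => simp only [map_add, mul_add, hx, hy]
    | tmul x y z => simp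
  rw [e3, phiInvAt, alphaLeft_slotEval, ← Algebra.TensorProduct.one_def, mul_one, one_mul, qL]

/-- `(X¹ β S(X²) ⊗ 1) q_L Δ(X³) = 1 ⊗ 1`. -/
theorem midComul_qL_pHat : Q.midComul Q.qL Q.pHat = 1 := by
  have hr : ∀ h, Q.conv (lTri1 k H) (rTri1 Q) h (Q.β ⊗ₜ (1 ⊗ₜ 1)) =
      Q.counit h • (Q.β ⊗ₜ (1 ⊗ₜ 1)) := fun h => by
    simp [TensorProduct.smul_tmul']
  have key := Q.contract_right (f := lTri1 k H) (g := rTri1 Q) (h := lTri2 k H) (i := lTri3 k H)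
    (Q.slotEqRight_matCoef Q.alphaLeft hr)
    (Q.slotEqLeft_matCoef _ Q.alphaLeft_conv)
  rw [matCoef_apply, matCoef_apply, Module.End.mul_apply] at key
  have e1 : ∀ T : H ⊗[k] (H ⊗[k] H), Q.midComul Q.qL (TensorProduct.map Q.coevMap LinearMap.id
      ((TensorProduct.assoc k H H H).symm T)) =
      Q.alphaLeft (Q.phiInvAt (rTri1 Q) (lTri2 k H) (lTri3 k H)
        (slotEval (lTri1 k H) (slotEval (rTri1 Q) (Q.conv (lTri2 k H) (lTri3 k H))) T
          (Q.β ⊗ₜ (1 ⊗ₜ 1)))) := by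
    intro T
    induction T using TensorProduct.triple_induction with
    | zero => simp
    | add x y hx hy => simp [hx, hy]
    | tmul a b d =>
      rw [slotEval_tmul, slotEval_tmul, Module.End.mul_apply, Module.End.mul_apply,
        conv_onSnd_tmul, comulAction_apply, onFst_tmul, onFst_tmul,
        phiInvAt, alphaLeft_slotEval]
      simp [qL, mul_assoc, ← Algebra.TensorProduct.one_def]
  rw [pHat, e1, ← phiAt, key, phiAt, slotEval_lr_beta_left]
  have e3 : ∀ T, Q.alphaLeft (TensorProduct.map LinearMap.id ((TensorProduct.mk k H H).flip 1)
      (TensorProduct.map Q.coevMap LinearMap.id ((TensorProduct.assoc k H H H).symm T))) =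
      (mulMid k Q.β (TensorProduct.map LinearMap.id (mulMid k Q.α ∘ₗ
        TensorProduct.map Q.antipode LinearMap.id) T)) ⊗ₜ 1 := by
    intro T
    induction T using TensorProduct.triple_induction with
    | zero => simp
    | add x y hx hy => simp [hx, hy, TensorProduct.add_tmul]
    | tmul x y z => simp [mul_assoc]
  rw [e3, Phi, Q.reassoc_antipode]
  rfl

/-- `a ⊗ b` acts on `H ⊗ H` by `x ⊗ y ↦ a x ⊗ y b`. -/
noncomputable def sandwich (k H : Type*) [Field k] [Ring H] [Algebra k H] :
    H ⊗[k] H →ₗ[k] H ⊗[k] H →ₗ[k] H ⊗[k] H :=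
  TensorProduct.map₂ (LinearMap.mul k H) (LinearMap.mul k H).flip

@[simp]
theorem sandwich_tmul (a b x y : H) :
    sandwich k H (a ⊗ₜ b) (x ⊗ₜ y) = (a * x) ⊗ₜ (y * b) := by simp [sandwich]

/-- `v ⊗ x ↦ X¹ v₁ ⊗ S(X² v₂) α X³ x`. -/
noncomputable def untwist : H ⊗[k] H →ₗ[k] H ⊗[k] H :=
  LinearMap.mul' k (H ⊗[k] H) ∘ₗ TensorProduct.map
    (sandwich k H Q.qHat ∘ₗ TensorProduct.map LinearMap.id Q.antipode ∘ₗ Q.comul.toLinearMap)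
    (TensorProduct.mk k H H 1)

@[simp]
theorem untwist_tmul (v x : H) : Q.untwist (v ⊗ₜ x) =
    sandwich k H Q.qHat (TensorProduct.map LinearMap.id Q.antipode (Q.comul v)) * (1 ⊗ₜ x) := by
  simp [untwist]

theorem comulMid_sandwich (t q s : H ⊗[k] H) :
    Q.comulMid t (sandwich k H q s) = Q.comulMid (Q.comulMid t s) q := by
  induction q using TensorProduct.induction_on with
  | zero => simp
  | add x y hx hy => simp [hx, hy]
  | tmul a b =>
    induction s using TensorProduct.induction_on with
    | zero => simp [comulMid]
    | add x y hx hy =>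
      simp only [map_add, hx, hy]
      simp [mul_add, add_mul]
    | tmul x y => simp [mul_assoc]

theorem comulMid_mul_right (t s : H ⊗[k] H) (x : H) :
    Q.comulMid t (s * (1 ⊗ₜ x)) = Q.comulMid t s * (1 ⊗ₜ x) := by
  induction s using TensorProduct.induction_on with
  | zero => simp
  | add x y hx hy => simp only [map_add, add_mul, hx, hy]
  | tmul a b => simp [mul_assoc]

theorem comulMid_mul_left (t s : H ⊗[k] H) (x : H) :
    Q.comulMid (t * (x ⊗ₜ 1)) s = Q.comulMid t s * (x ⊗ₜ 1) := by
  induction s using TensorProduct.induction_on with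
  | zero => simp
  | add x y hx hy => simp only [map_add, add_mul, hx, hy]
  | tmul a b => simp [mul_assoc]

/-- By `comulMid_sandwich` the map splits into two insertions: the legs of `Δ(v)` collapse `p` to `p
(v ⊗ 1)`, and `qHat` then turns `p` into `1 ⊗ 1`. -/
theorem comulMid_untwist (s : H ⊗[k] H) : Q.comulMid Q.pR (Q.untwist s) = s := by
  induction s using TensorProduct.induction_on with
  | zero => simp
  | add x y hx hy => simp [hx, hy]
  | tmul v x =>
    rw [untwist_tmul, comulMid_mul_right, comulMid_sandwich, comulMid_pR, comulMid_mul_left,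
      comulMid_pR_qHat]
    simp

/-- Dimension count: a one-sided inverse between finite-dimensional spaces is two-sided. -/
theorem untwist_comulMid [FiniteDimensional k H] (s : H ⊗[k] H) :
    Q.untwist (Q.comulMid Q.pR s) = s := by
  have h : Function.LeftInverse (Q.comulMid Q.pR) Q.untwist := Q.comulMid_untwist
  have h2 : Function.Injective Q.untwist := h.injective
  have h3 := LinearMap.injective_iff_surjective.mp h2
  exact h.rightInverse_of_surjective h3 s

theorem untwist_pR [FiniteDimensional k H] : Q.untwist Q.pR = 1 := by
  have := Q.untwist_comulMid 1
  rwa [Algebra.TensorProduct.one_def, comulMid_tmul, map_one, one_mul,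
    ← Algebra.TensorProduct.one_def, mul_one] at this

end QuasiHopfAlgebra

/-! ### Untwisting the diagonal action and existence of left integrals -/

namespace QuasiHopfAlgebra

variable {k H : Type*} [Field k] [Ring H] [Algebra k H] (Q : QuasiHopfAlgebra k H)

section

variable {N : Type*} [AddCommGroup N] [Module k N] (ρ : H →ₐ[k] Module.End k N)

/-- `a ⊗ b ↦ (n ↦ a ⊗ b n)`. -/
noncomputable def tensorAct : H ⊗[k] H →ₗ[k] N →ₗ[k] H ⊗[k] N :=
  TensorProduct.lTensorHomToHomLTensor (RingHom.id k) N H N ∘ₗ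
    TensorProduct.map LinearMap.id ρ.toLinearMap

@[simp]
theorem tensorAct_tmul (a b : H) (n : N) : tensorAct ρ (a ⊗ₜ b) n = a ⊗ₜ ρ b n := rfl

/-- `h ⊗ n ↦ h₁ p¹ ⊗ h₂ p² n`. -/
noncomputable def twistMod : H ⊗[k] N →ₗ[k] H ⊗[k] N :=
  TensorProduct.lift (tensorAct ρ ∘ₗ LinearMap.mulRight k Q.pR ∘ₗ Q.comul.toLinearMap)

@[simp]
theorem twistMod_tmul (h : H) (n : N) :
    Q.twistMod ρ (h ⊗ₜ n) = tensorAct ρ (Q.comul h * Q.pR) n := rfl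

/-- `v ⊗ n ↦ X¹ v₁ ⊗ S(X² v₂) α X³ n`. -/
noncomputable def untwistMod : H ⊗[k] N →ₗ[k] H ⊗[k] N :=
  TensorProduct.lift (tensorAct ρ ∘ₗ Q.untwist ∘ₗ (TensorProduct.mk k H H).flip 1)

@[simp]
theorem untwistMod_tmul (h : H) (n : N) :
    Q.untwistMod ρ (h ⊗ₜ n) = tensorAct ρ (Q.untwist (h ⊗ₜ 1)) n := rfl

theorem tensorAct_mul_right (s : H ⊗[k] H) (b : H) (n : N) :
    tensorAct ρ (s * (1 ⊗ₜ b)) n = tensorAct ρ s (ρ b n) := by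
  induction s using TensorProduct.induction_on with
  | zero => simp
  | add x y hx hy => simp [add_mul, hx, hy]
  | tmul x y => simp

theorem twistMod_tensorAct (s : H ⊗[k] H) (n : N) :
    Q.twistMod ρ (tensorAct ρ s n) = tensorAct ρ (Q.comulMid Q.pR s) n := by
  induction s using TensorProduct.induction_on with
  | zero => simp
  | add x y hx hy => simp [hx, hy]
  | tmul x y => simp [tensorAct_mul_right]

theorem twistMod_untwistMod (s : H ⊗[k] N) : Q.twistMod ρ (Q.untwistMod ρ s) = s := by
  induction s using TensorProduct.induction_on with
  | zero => simp
  | add x y hx hy => simp [hx, hy]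
  | tmul x y => rw [untwistMod_tmul, twistMod_tensorAct, comulMid_untwist]; simp

theorem untwistMod_twistMod [FiniteDimensional k H] [FiniteDimensional k N] (s : H ⊗[k] N) :
    Q.untwistMod ρ (Q.twistMod ρ s) = s := by
  have h : Function.LeftInverse (Q.twistMod ρ) (Q.untwistMod ρ) := Q.twistMod_untwistMod ρ
  exact h.rightInverse_of_surjective (LinearMap.injective_iff_surjective.mp h.injective) s

theorem conv_tensorAct (h : H) (s : H ⊗[k] H) (n : N) :
    Q.conv (onFst N (lSlot k H)) (onSnd H ρ) h (tensorAct ρ s n) =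
      tensorAct ρ (Q.comul h * s) n := by
  rw [conv_apply]
  generalize Q.comul h = d
  induction d using TensorProduct.induction_on with
  | zero => simp
  | add x y hx hy => simp [add_mul, hx, hy]
  | tmul a b =>
    induction s using TensorProduct.induction_on with
    | zero => simp
    | add x y hx hy => simp only [map_add, mul_add, hx, hy, LinearMap.add_apply]
    | tmul x y => simp

theorem twistMod_onFst (h : H) (s : H ⊗[k] N) :
    Q.twistMod ρ (onFst N (lSlot k H) h s) =
      Q.conv (onFst N (lSlot k H)) (onSnd H ρ) h (Q.twistMod ρ s) := by
  induction s using TensorProduct.induction_on with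
  | zero => simp
  | add x y hx hy => simp only [map_add, hx, hy]
  | tmul x y => simp [conv_tensorAct, mul_assoc]

/-- `twistMod` intertwines left multiplication on the first factor with the diagonal action, so its
inverse carries diagonal invariants to invariants of the left regular action. Slices of the latter
along the second factor are left integrals. -/
theorem onFst_untwistMod [FiniteDimensional k H] [FiniteDimensional k N] {C : H ⊗[k] N}
    (hC : ∀ h, Q.conv (onFst N (lSlot k H)) (onSnd H ρ) h C = Q.counit h • C) (h : H) :
    onFst N (lSlot k H) h (Q.untwistMod ρ C) = Q.counit h • Q.untwistMod ρ C := by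
  rw [← Q.untwistMod_twistMod ρ (onFst N (lSlot k H) h _), twistMod_onFst, twistMod_untwistMod, hC,
    map_smul]

end

theorem isLeftIntegral_of_onFst {N : Type*} [AddCommGroup N] [Module k N] {s : H ⊗[k] N}
    (hs : ∀ h, onFst N (lSlot k H) h s = Q.counit h • s) (ξ : N →ₗ[k] k) :
    Q.IsLeftIntegral (TensorProduct.rid k H (TensorProduct.map LinearMap.id ξ s)) := by
  intro h
  rw [← map_smul, ← map_smul, ← hs]
  clear hs
  induction s using TensorProduct.induction_on with
  | zero => simp
  | add x y hx hy => simp only [map_add, mul_add, hx, hy]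
  | tmul x y => simp

/-- The left dual of the regular module. -/
noncomputable def dualSlot : H →ₐ[k] Module.End k (Module.Dual k H) :=
  AlgHom.ofLinearMap (Module.Dual.transpose ∘ₗ LinearMap.mul k H ∘ₗ Q.antipode)
    (by ext ξ x; change ξ (Q.antipode 1 * x) = ξ x; simp)
    (fun a b => by
      ext ξ x
      change ξ (Q.antipode (a * b) * x) = ξ (Q.antipode b * (Q.antipode a * x))
      simp [mul_assoc])

@[simp]
theorem dualSlot_apply (a x : H) (ξ : Module.Dual k H) :
    Q.dualSlot a ξ x = ξ (Q.antipode a * x) := rfl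

/-- The endomorphism `y ↦ ξ(y) v` attached to `v ⊗ ξ`. -/
noncomputable def toEnd (k H : Type*) [Field k] [Ring H] [Algebra k H] :
    H ⊗[k] Module.Dual k H →ₗ[k] Module.End k H :=
  dualTensorHom k H H ∘ₗ (TensorProduct.comm k H (Module.Dual k H)).toLinearMap

@[simp]
theorem toEnd_tmul (v y : H) (ξ : Module.Dual k H) : toEnd k H (v ⊗ₜ ξ) y = ξ y • v := rfl

theorem toEnd_bijective [FiniteDimensional k H] : Function.Bijective (toEnd k H) :=
  dualTensorHom_bijective.comp (TensorProduct.comm k H (Module.Dual k H)).bijective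

theorem toEnd_conv (h y : H) (C : H ⊗[k] Module.Dual k H) :
    toEnd k H (Q.conv (onFst _ (lSlot k H)) (onSnd H Q.dualSlot) h C) y =
      LinearMap.mul' k H (TensorProduct.map LinearMap.id
        (toEnd k H C ∘ₗ LinearMap.mulRight k y ∘ₗ Q.antipode) (Q.comul h)) := by
  rw [conv_apply]
  generalize Q.comul h = d
  induction d using TensorProduct.induction_on with
  | zero => simp
  | add x y hx hy => simp [hx, hy]
  | tmul a b =>
    induction C using TensorProduct.induction_on with
    | zero => simp
    | add x y hx hy =>
      simp only [map_add, LinearMap.add_apply, hx, hy]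
      simp [mul_add]
    | tmul x y => simp

/-- In terms of endomorphisms the diagonal action is `F ↦ h₁ F(S(h₂) ·)`, and `h₁ β S(h₂) = ε(h) β`
says that left multiplication by `β` is invariant. -/
theorem conv_of_toEnd [FiniteDimensional k H] {C : H ⊗[k] Module.Dual k H}
    (hC : toEnd k H C = LinearMap.mulLeft k Q.β) (h : H) :
    Q.conv (onFst _ (lSlot k H)) (onSnd H Q.dualSlot) h C = Q.counit h • C := by
  apply toEnd_bijective.injective
  ext y
  rw [toEnd_conv, hC, map_smul, LinearMap.smul_apply, hC, LinearMap.mulLeft_apply,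
    ← smul_mul_assoc, ← coevMap_comul]
  generalize Q.comul h = d
  induction d using TensorProduct.induction_on with
  | zero => simp
  | add x y hx hy => simp [add_mul, hx, hy]
  | tmul a b => simp [mul_assoc]

theorem one_ne_zero_of_counit (Q : QuasiHopfAlgebra k H) : (1 : H) ≠ 0 := fun h => by
  simpa using congrArg Q.counit h

theorem β_ne_zero : Q.β ≠ 0 := fun h => by
  have e := Q.reassoc_antipode
  have e2 : mulMid k (0 : H) = 0 := by ext; simp
  rw [h, e2, LinearMap.zero_apply] at e
  exact Q.one_ne_zero_of_counit e.symm

/-- The invariant given by `β` is untwisted to a tensor all of whose slices are left integrals. If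
these all vanished, so would the tensor, and then `β`. -/
theorem exists_isLeftIntegral_ne_zero [FiniteDimensional k H] :
    ∃ t, Q.IsLeftIntegral t ∧ t ≠ 0 := by
  obtain ⟨C, hC⟩ := (toEnd_bijective (k := k) (H := H)).surjective (LinearMap.mulLeft k Q.β)
  have h1 := Q.onFst_untwistMod Q.dualSlot (Q.conv_of_toEnd hC)
  by_contra! h2
  have h3 : Q.untwistMod Q.dualSlot C = 0 := by
    apply toEnd_bijective.injective
    ext y
    rw [map_zero, LinearMap.zero_apply, ← h2 _ (Q.isLeftIntegral_of_onFst h1 (LinearMap.applyₗ y))]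
    generalize Q.untwistMod Q.dualSlot C = s
    induction s using TensorProduct.induction_on with
    | zero => simp
    | add x y hx hy => simp only [map_add, LinearMap.add_apply, hx, hy]
    | tmul x y => simp
  have h4 := Q.twistMod_untwistMod Q.dualSlot C
  rw [h3, map_zero] at h4
  rw [← h4, map_zero] at hC
  have := congrArg (fun F => F 1) hC
  simp at this
  exact Q.β_ne_zero this.symm

theorem unitSlot_evMap_Phi : TensorProduct.lid k H (TensorProduct.map Q.counit.toLinearMap
    LinearMap.id Q.qHat) = Q.α := by
  have e := congrArg (fun F : Module.End k (H ⊗[k] H) => mulMid k Q.α (F 1))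
    (Q.phiAt_unit_left (rPair1 Q) (lPair2 k H))
  have e2 : ∀ T, mulMid k Q.α (slotEval (Q.unitSlot (Module.End k (H ⊗[k] H)))
      (slotEval (rPair1 Q) (lPair2 k H)) T 1) =
      TensorProduct.lid k H (TensorProduct.map Q.counit.toLinearMap
        LinearMap.id (TensorProduct.map LinearMap.id Q.evMap T)) := by
    intro T
    induction T using TensorProduct.triple_induction with
    | zero => simp
    | add x y hx hy => simp [hx, hy]
    | tmul x y z => simp [Algebra.TensorProduct.one_def]
  rw [phiAt] at e
  rw [qHat, ← e2, e]
  simp [Algebra.TensorProduct.one_def]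

/-- It evaluates `ε` on the left integrals just constructed: the counit on the first leg reduces `Φ`
to `1` and `Δ(v)` to `v`. -/
theorem counit_untwist (v : H) : TensorProduct.lid k H (TensorProduct.map Q.counit.toLinearMap
    LinearMap.id (Q.untwist (v ⊗ₜ 1))) = Q.antipode v * Q.α := by
  have e : ∀ q d : H ⊗[k] H, TensorProduct.lid k H (TensorProduct.map Q.counit.toLinearMap
      LinearMap.id (sandwich k H q d)) =
      TensorProduct.lid k H (TensorProduct.map Q.counit.toLinearMap LinearMap.id d) *
      TensorProduct.lid k H (TensorProduct.map Q.counit.toLinearMap LinearMap.id q) := by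
    intro q d
    induction q using TensorProduct.induction_on with
    | zero => simp
    | add x y hx hy => simp [hx, hy, mul_add]
    | tmul a b =>
      induction d using TensorProduct.induction_on with
      | zero => simp
      | add x y hx hy => simp only [map_add, hx, hy, add_mul]
      | tmul c d => simp [smul_smul]
  rw [untwist_tmul, ← Algebra.TensorProduct.one_def, mul_one, e, unitSlot_evMap_Phi]
  congr 1
  have e2 : ∀ d : H ⊗[k] H, TensorProduct.lid k H (TensorProduct.map Q.counit.toLinearMap
      LinearMap.id (TensorProduct.map LinearMap.id Q.antipode d)) =
      Q.antipode (TensorProduct.lid k H (Algebra.TensorProduct.map Q.counit (AlgHom.id k H) d)) := by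
    intro d
    induction d using TensorProduct.induction_on with
    | zero => simp
    | add x y hx hy => simp [hx, hy]
    | tmul c d => simp
  rw [e2, Q.counit_id_comul]
  simp

/-- For each `c` there is a left integral `t` with `ε(t) = Tr(x ↦ S(α) S²(β x) c)`. -/
theorem exists_isLeftIntegral_counit [FiniteDimensional k H] (c : H) :
    ∃ t, Q.IsLeftIntegral t ∧ Q.counit t = LinearMap.trace k H
      (LinearMap.mulRight k c ∘ₗ LinearMap.mulLeft k (Q.antipode Q.α) ∘ₗ Q.antipode ∘ₗ Q.antipode
        ∘ₗ LinearMap.mulLeft k Q.β) := by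
  obtain ⟨C, hC⟩ := (toEnd_bijective (k := k) (H := H)).surjective (LinearMap.mulLeft k Q.β)
  have h1 := Q.onFst_untwistMod Q.dualSlot (Q.conv_of_toEnd hC)
  refine ⟨_, Q.isLeftIntegral_of_onFst h1 (LinearMap.applyₗ c), ?_⟩
  rw [← hC]
  clear h1 hC
  induction C using TensorProduct.induction_on with
  | zero => simp
  | add x y hx hy => simp only [map_add, hx, hy, LinearMap.comp_add]
  | tmul v ξ =>
    -- For a pure tensor `v ⊗ ξ` both sides come out as `ξ (S(α) S²(v) c)`: the trace because the
    -- endomorphism has rank at most one, the integral by `counit_untwist`.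
    have e : ∀ ψ : Module.End k H, LinearMap.trace k H (ψ ∘ₗ toEnd k H (v ⊗ₜ ξ)) = ξ (ψ v) := by
      intro ψ
      have : ψ ∘ₗ toEnd k H (v ⊗ₜ ξ) = dualTensorHom k H H (ξ ⊗ₜ ψ v) := by ext; simp
      rw [this, LinearMap.trace_eq_contract_apply, contractLeft_apply]
    have e2 := e (LinearMap.mulRight k c ∘ₗ LinearMap.mulLeft k (Q.antipode Q.α) ∘ₗ Q.antipode ∘ₗ
      Q.antipode)
    simp only [LinearMap.comp_assoc] at e2
    rw [e2, untwistMod_tmul]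
    have e3 : ∀ s : H ⊗[k] H, Q.counit (TensorProduct.rid k H (TensorProduct.map LinearMap.id
        (LinearMap.applyₗ c) (tensorAct Q.dualSlot s ξ))) =
        ξ (Q.antipode (TensorProduct.lid k H (TensorProduct.map Q.counit.toLinearMap
          LinearMap.id s)) * c) := by
      intro s
      induction s using TensorProduct.induction_on with
      | zero => simp
      | add x y hx hy => simp [hx, hy, add_mul]
      | tmul x y => simp [mul_comm]
    rw [e3, counit_untwist]
    simp

/-! ### Bijectivity of the antipode -/

variable {Q} in
theorem IsLeftIntegral.comul_mul {t : H} (ht : Q.IsLeftIntegral t) (h : H) :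
    Q.comul h * Q.comul t = Q.counit h • Q.comul t := by
  rw [← map_mul, ht, map_smul]

/-- `p̂ = X¹ β S(X²) ⊗ X³` has `(id ⊗ ε)(p̂) = β`. -/
theorem counit_pHat : TensorProduct.rid k H (TensorProduct.map LinearMap.id Q.counit.toLinearMap
    Q.pHat) = Q.β := by
  have e := congrArg (fun F : Module.End k H => F Q.β)
    (Q.phiAt_unit_right (lSlot k H) Q.rSlot)
  have e2 : ∀ T, slotEval (lSlot k H)
      (slotEval Q.rSlot (Q.unitSlot (Module.End k H))) T Q.β =
      TensorProduct.rid k H (TensorProduct.map LinearMap.id Q.counit.toLinearMap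
        (TensorProduct.map Q.coevMap LinearMap.id ((TensorProduct.assoc k H H H).symm T))) := by
    intro T
    induction T using TensorProduct.triple_induction with
    | zero => simp
    | add x y hx hy => simp [hx, hy]
    | tmul x y z => simp [mul_assoc]
  rw [phiAt] at e
  rw [pHat, ← e2, e]
  simp

section

variable {Q} {t : H}

/-- `(S(h) ⊗ 1) q_L Δ(t) = (1 ⊗ h) q_L Δ(t)`. -/
theorem IsLeftIntegral.antipode_tmul_one_mul (ht : Q.IsLeftIntegral t) (h : H) :
    (Q.antipode h ⊗ₜ 1) * (Q.qL * Q.comul t) = (1 ⊗ₜ h) * (Q.qL * Q.comul t) := by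
  rw [← mul_assoc (1 ⊗ₜ h), ← midComul_qL]
  have e : ∀ s : H ⊗[k] H, Q.midComul Q.qL (TensorProduct.map Q.antipode LinearMap.id s) *
      Q.comul t = (Q.antipode (TensorProduct.rid k H (Algebra.TensorProduct.map (AlgHom.id k H)
        Q.counit s)) ⊗ₜ 1) * (Q.qL * Q.comul t) := by
    intro s
    induction s using TensorProduct.induction_on with
    | zero => simp
    | add x y hx hy => simp [hx, hy, add_mul, TensorProduct.add_tmul]
    | tmul c d =>
      simp [mul_assoc, ht.comul_mul, ← TensorProduct.smul_tmul']
  rw [e, Q.id_counit_comul]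
  simp

/-- `Δ(t) = (β ⊗ 1) q_L Δ(t)`. -/
theorem IsLeftIntegral.β_tmul_one_mul (ht : Q.IsLeftIntegral t) :
    (Q.β ⊗ₜ 1) * (Q.qL * Q.comul t) = Q.comul t := by
  have e : ∀ s : H ⊗[k] H, Q.midComul Q.qL s * Q.comul t =
      (TensorProduct.rid k H (TensorProduct.map LinearMap.id Q.counit.toLinearMap s) ⊗ₜ 1) *
        (Q.qL * Q.comul t) := by
    intro s
    induction s using TensorProduct.induction_on with
    | zero => simp
    | add x y hx hy => simp [hx, hy, add_mul, TensorProduct.add_tmul]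
    | tmul c d => simp [mul_assoc, ht.comul_mul, ← TensorProduct.smul_tmul']
  have := e Q.pHat
  rw [midComul_qL_pHat, one_mul, counit_pHat] at this
  exact this.symm

end

/-- Let `S(h) = 0` and let `t ≠ 0` be a left integral. An element `h b` in the second leg of `q_L
Δ(t)` can be moved to the first leg as `S(h b) = S(b) S(h) = 0`, so `h b` annihilates the second leg
of `Δ(t)` for every `b`. Since `t ⊗ 1` is recovered from `Δ(t) p` by `untwist`, which only puts
further factors between `h` and that leg, `t ⊗ h = 0`. -/
theorem antipode_bijective [FiniteDimensional k H] : Function.Bijective Q.antipode := by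
  suffices h : Function.Injective Q.antipode from
    ⟨h, LinearMap.injective_iff_surjective.mp h⟩
  rw [injective_iff_map_eq_zero]
  intro h hh
  obtain ⟨t, ht, ht0⟩ := Q.exists_isLeftIntegral_ne_zero
  have h1 : ∀ b, (1 ⊗ₜ (h * b)) * Q.comul t = 0 := by
    intro b
    rw [← ht.β_tmul_one_mul, ← mul_assoc, Algebra.TensorProduct.tmul_mul_tmul, one_mul, mul_one]
    have : Q.β ⊗ₜ[k] (h * b) = (Q.β ⊗ₜ 1) * (1 ⊗ₜ (h * b)) := by simp
    rw [this, mul_assoc, ← ht.antipode_tmul_one_mul]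
    simp [hh]
  -- `untwist` applied to `Δ(t) p` is `t ⊗ 1`; multiplication by `1 ⊗ h` makes it `t ⊗ h`.
  have e := congrArg (fun s => (1 ⊗ₜ h) * s) (Q.untwist_comulMid (t ⊗ₜ 1))
  simp only [comulMid_tmul, ← Algebra.TensorProduct.one_def, mul_one] at e
  let 𝔅 := Module.finBasis k H
  obtain ⟨w, hw⟩ := TensorProduct.eq_repr_basis_left 𝔅 (Q.comul t)
  -- Expanding `Δ(t)` along a basis of the first leg lets the vanishing be read off each second-leg
  -- coefficient `w i` separately.
  have h2 : ∀ b i, h * b * w i = 0 := by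
    intro b i
    have e1 := h1 b
    rw [← hw, Finsupp.mul_sum] at e1
    simp only [Algebra.TensorProduct.tmul_mul_tmul, one_mul] at e1
    have e2 := TensorProduct.sum_tmul_basis_left_eq_zero 𝔅
      (w.mapRange (LinearMap.mulLeft k (h * b)) (map_zero _))
      (by rw [Finsupp.sum_mapRange_index (by simp)]; simpa [mul_assoc] using e1)
    simpa [mul_assoc] using DFunLike.congr_fun e2 i
  have h3 : ∀ (u y : H) (s : H ⊗[k] H), (∀ b, h * b * y = 0) →
      (1 ⊗ₜ h) * Q.untwist ((u ⊗ₜ y) * s) = 0 := by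
    intro u y s hy
    induction s using TensorProduct.induction_on with
    | zero => simp
    | add x y hx hy => simp only [mul_add, map_add, hx, hy, add_zero]
    | tmul a b =>
      rw [Algebra.TensorProduct.tmul_mul_tmul, untwist_tmul]
      generalize sandwich k H Q.qHat _ = r
      induction r using TensorProduct.induction_on with
      | zero => simp
      | add x y hx hy => simp only [mul_add, add_mul, hx, hy, add_zero]
      | tmul c d =>
        have := congrArg (· * b) (hy d)
        simp only [mul_assoc, zero_mul] at this
        simp [this]
  have h4 : (1 ⊗ₜ h) * Q.untwist (Q.comul t * Q.pR) = 0 := by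
    rw [← hw, Finsupp.sum_mul, Finsupp.sum, map_sum, Finset.mul_sum]
    exact Finset.sum_eq_zero fun i _ => h3 _ _ _ fun b => h2 b i
  rw [h4] at e
  simp only [Algebra.TensorProduct.tmul_mul_tmul, one_mul, mul_one] at e
  by_contra hne
  refine ht0 ((Module.forall_dual_apply_eq_zero_iff k t).mp fun ξ => ?_)
  have e2 := congrArg (TensorProduct.lid k H ∘ TensorProduct.map ξ LinearMap.id) e
  simpa [hne] using e2.symm

end QuasiHopfAlgebra

namespace QuasiHopfAlgebra

variable {k H : Type*} [Field k] [Ring H] [Algebra k H] (Q : QuasiHopfAlgebra k H)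

/-! ### The inverse of the antipode -/

section

variable [FiniteDimensional k H]

@[simp]
theorem antipode_antipodeInv (x : H) : Q.antipode (Q.antipodeInv x) = x := by
  have h : IsUnit (Q.antipode : Module.End k H) :=
    (Module.End.isUnit_iff _).mpr Q.antipode_bijective
  exact congrArg (fun F : Module.End k H => F x) (Ring.mul_inverse_cancel _ h)

@[simp]
theorem antipodeInv_antipode (x : H) : Q.antipodeInv (Q.antipode x) = x :=
  Q.antipode_bijective.injective (by simp)

@[simp]
theorem antipodeInv_mul (x y : H) :
    Q.antipodeInv (x * y) = Q.antipodeInv y * Q.antipodeInv x :=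
  Q.antipode_bijective.injective (by simp)

@[simp]
theorem antipodeInv_one : Q.antipodeInv 1 = 1 :=
  Q.antipode_bijective.injective (by simp)

end

/-- `ε(α)` divides the image under `ε` of `X¹ β S(X²) α X³ = 1`. -/
theorem counit_α_ne_zero : Q.counit Q.α ≠ 0 := by
  intro h
  have e := congrArg Q.counit Q.reassoc_antipode
  have e2 : ∀ T : H ⊗[k] (H ⊗[k] H), Q.counit (mulMid k Q.β (TensorProduct.map LinearMap.id
      (mulMid k Q.α ∘ₗ TensorProduct.map Q.antipode LinearMap.id) T)) = 0 := by
    intro T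
    induction T using TensorProduct.triple_induction with
    | zero => simp
    | add x y hx hy => simp [hx, hy]
    | tmul x y z => simp [h]
  rw [e2, map_one] at e
  exact zero_ne_one e

@[simp]
-- Apply `ε` to `S(h₁) α h₂ = ε(h) α` and cancel `ε(α)`.
theorem counit_antipode (h : H) : Q.counit (Q.antipode h) = Q.counit h := by
  have e := congrArg Q.counit (Q.evMap_comul h)
  have e2 : ∀ s : H ⊗[k] H, Q.counit (Q.evMap s) = Q.counit Q.α * Q.counit (Q.antipode
      (TensorProduct.rid k H (Algebra.TensorProduct.map (AlgHom.id k H) Q.counit s))) := by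
    intro s
    induction s using TensorProduct.induction_on with
    | zero => simp
    | add x y hx hy => simp [hx, hy, mul_add]
    | tmul x y => simp; ring
  rw [e2, Q.id_counit_comul] at e
  simp only [TensorProduct.rid_tmul, one_smul, map_smul, smul_eq_mul] at e
  rw [mul_comm] at e
  exact mul_right_cancel₀ Q.counit_α_ne_zero e

/-! ### The coproduct of the antipode -/

theorem opAction_apply (h : H) (t : H ⊗[k] H) :
    Q.conv (rPair2 Q) (rPair1 Q) h t = t * Q.antipodeComulOp h := by
  rw [conv_apply, antipodeComulOp]
  simp only [LinearMap.comp_apply, AlgHom.toLinearMap_apply, LinearEquiv.coe_coe]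
  generalize Q.comul h = s
  induction s using TensorProduct.induction_on with
  | zero => simp
  | add x y hx hy => simp [hx, hy, mul_add]
  | tmul a b =>
    induction t using TensorProduct.induction_on with
    | zero => simp
    | add x y hx hy => simp only [map_add, add_mul, hx, hy]
    | tmul x y => simp

@[simp]
theorem antipodeComulOp_one : Q.antipodeComulOp 1 = 1 := by
  have := Q.opAction_apply 1 1
  rw [one_mul] at this
  rw [← this, map_one (Q.conv (rPair2 Q) (rPair1 Q)), Module.End.one_apply]

@[simp]
theorem antipodeComulOp_mul (a b : H) :
    Q.antipodeComulOp (a * b) = Q.antipodeComulOp b * Q.antipodeComulOp a := by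
  have := Q.opAction_apply (a * b) 1
  rw [map_mul, Module.End.mul_apply, opAction_apply, opAction_apply, one_mul, one_mul] at this
  exact this.symm

/-- `a ⊗ b ↦ Δ(a) δ K(b)`, where `K(b) = S(b₂) ⊗ S(b₁)`. -/
noncomputable def deltaSandwich : H ⊗[k] H →ₗ[k] H ⊗[k] H :=
  mulMid k Q.deltaElt ∘ₗ TensorProduct.map Q.comul.toLinearMap Q.antipodeComulOp

@[simp]
theorem deltaSandwich_tmul (a b : H) :
    Q.deltaSandwich (a ⊗ₜ b) = Q.comul a * Q.deltaElt * Q.antipodeComulOp b := by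
  simp [deltaSandwich]

/-- `a ⊗ b ↦ K(a) γ Δ(b)`, where `K(a) = S(a₂) ⊗ S(a₁)`. -/
noncomputable def gammaSandwich : H ⊗[k] H →ₗ[k] H ⊗[k] H :=
  mulMid k Q.gammaElt ∘ₗ TensorProduct.map Q.antipodeComulOp Q.comul.toLinearMap

@[simp]
theorem gammaSandwich_tmul (a b : H) :
    Q.gammaSandwich (a ⊗ₜ b) = Q.antipodeComulOp a * Q.gammaElt * Q.comul b := by
  simp [gammaSandwich]

theorem deltaSandwich_qL : Q.deltaSandwich Q.qL = Q.twistInv := rfl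

theorem gammaSandwich_pR : Q.gammaSandwich Q.pR = Q.twist := rfl

theorem slotEval_βtmulβ (T : H ⊗[k] (H ⊗[k] (H ⊗[k] H))) :
    slotEval (lPair1 k H) (slotEval (lPair2 k H) (slotEval (rPair2 Q) (rPair1 Q))) T
      (Q.β ⊗ₜ Q.β) = Q.deltaMap T := by
  induction T using TensorProduct.induction_on with
  | zero => simp
  | add x y hx hy => simp [hx, hy]
  | tmul a T =>
    induction T using TensorProduct.triple_induction with
    | zero => simp
    | add x y hx hy => simp only [TensorProduct.tmul_add, map_add, LinearMap.add_apply, hx, hy]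
    | tmul b c d => simp [deltaMap, mul_assoc]

/-- The definition of `δ` read as an action on `β ⊗ β`, in which the second and third slots enclose
the second `β` and the first and fourth enclose the first. This makes `δ` accessible to the
pentagon. -/
theorem deltaElt_eq : Q.deltaElt =
    Q.phiAt (Q.conv (lPair1 k H) (lPair2 k H)) (rPair2 Q) (rPair1 Q)
      (Q.phiInvAt (lPair1 k H) (lPair2 k H) (rPair2 Q) (Q.β ⊗ₜ Q.β)) := by
  rw [deltaElt, ← slotEval_βtmulβ, map_mul, slotEval_comulFst, slotEval_tmulOne]
  rfl

theorem slotEval_deltaElt (s : H ⊗[k] H) :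
    slotEval (Q.conv (lPair1 k H) (lPair2 k H)) (Q.conv (rPair2 Q) (rPair1 Q)) s Q.deltaElt =
      Q.deltaSandwich s := by
  induction s using TensorProduct.induction_on with
  | zero => simp
  | add x y hx hy => simp [hx, hy]
  | tmul a b => simp [comulAction_apply, opAction_apply, mul_assoc]

/-- `Δ(h₁) δ K(h₂) = ε(h) δ`. -/
theorem deltaSandwich_comul (h : H) :
    Q.deltaSandwich (Q.comul h) = Q.counit h • Q.deltaElt := by
  have e1 := Q.phiAt_mul_conv (Q.conv (lPair1 k H) (lPair2 k H)) (rPair2 Q) (rPair1 Q) h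
  have e2 : Q.phiInvAt (lPair1 k H) (lPair2 k H) (rPair2 Q) *
      Q.conv (Q.conv (lPair1 k H) (Q.conv (lPair2 k H) (rPair2 Q))) (rPair1 Q) h =
      Q.conv (Q.conv (Q.conv (lPair1 k H) (lPair2 k H)) (rPair2 Q)) (rPair1 Q) h *
        Q.phiInvAt (lPair1 k H) (lPair2 k H) (rPair2 Q) :=
    mul_slotEval_left (fun x => Q.phiInvAt_mul_conv _ _ _ x) _
      fun y => Q.commute_phiInvAt_left _ y
  rw [← slotEval_deltaElt, ← conv_apply]
  conv_lhs => rw [deltaElt_eq, ← Module.End.mul_apply, ← e1, Module.End.mul_apply,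
    ← Module.End.mul_apply (Q.conv _ _ h), ← e2, Module.End.mul_apply]
  -- After rebracketing, the inner pair acts by `ε` on the second `β`; the remaining outer pair does
  -- the same on the first.
  have e3 : Q.conv (Q.conv (lPair1 k H) (Q.conv (lPair2 k H) (rPair2 Q))) (rPair1 Q) h
      (Q.β ⊗ₜ Q.β) = Q.counit h • (Q.β ⊗ₜ Q.β) := by
    have := ((Q.slotEqRight_matCoef (v := Q.β ⊗ₜ[k] Q.β) LinearMap.id
      (J := Q.conv (lPair2 k H) (rPair2 Q)) (fun h => by simp)).conv_right (Q := Q)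
        (lPair1 k H)).conv_left (Q := Q) (rPair1 Q) 1 h
    simpa [TensorProduct.smul_tmul'] using this
  rw [e3, map_smul, map_smul, ← deltaElt_eq]

theorem deltaSandwich_mul_comul (s : H ⊗[k] H) (h : H) :
    Q.deltaSandwich (s * Q.comul h) = Q.counit h • Q.deltaSandwich s := by
  rw [← slotEval_deltaElt, map_mul, Module.End.mul_apply, slotEval_deltaElt, deltaSandwich_comul,
    map_smul, slotEval_deltaElt]

/-- This transports identities for `q_L` to identities for `f⁻¹`: a coproduct on the right of `q_L`
is absorbed through `ε`, while a left factor comes out as its coproduct. -/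
theorem deltaSandwich_midComul (s : H ⊗[k] H) :
    Q.deltaSandwich (Q.midComul Q.qL s) = Q.comul (TensorProduct.rid k H (TensorProduct.map
      LinearMap.id Q.counit.toLinearMap s)) * Q.twistInv := by
  induction s using TensorProduct.induction_on with
  | zero => simp
  | add x y hx hy => simp [hx, hy, add_mul]
  | tmul a b =>
    rw [midComul_tmul, deltaSandwich_mul_comul, ← slotEval_deltaElt, map_mul, Module.End.mul_apply,
      slotEval_deltaElt, deltaSandwich_qL, slotEval_tmul, map_one, mul_one, comulAction_apply]
    simp

/-- `Δ(S(h)) g = g K(h)`. -/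
theorem comul_antipode_mul_twistInv (h : H) :
    Q.comul (Q.antipode h) * Q.twistInv = Q.twistInv * Q.antipodeComulOp h := by
  have e := congrArg Q.deltaSandwich (Q.midComul_qL h)
  rw [deltaSandwich_midComul, ← slotEval_deltaElt, map_mul, Module.End.mul_apply,
    slotEval_deltaElt, deltaSandwich_qL, slotEval_tmul, map_one, one_mul, opAction_apply] at e
  rw [← e]
  have e2 : ∀ s : H ⊗[k] H, TensorProduct.rid k H (TensorProduct.map LinearMap.id
      Q.counit.toLinearMap (TensorProduct.map Q.antipode LinearMap.id s)) = Q.antipode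
      (TensorProduct.rid k H (Algebra.TensorProduct.map (AlgHom.id k H) Q.counit s)) := by
    intro s
    induction s using TensorProduct.induction_on with
    | zero => simp
    | add x y hx hy => simp [hx, hy]
    | tmul x y => simp
  rw [e2, Q.id_counit_comul]
  simp

/-- `Δ(β) g = δ`. -/
theorem comul_β_mul_twistInv : Q.comul Q.β * Q.twistInv = Q.deltaElt := by
  have e := congrArg Q.deltaSandwich Q.midComul_qL_pHat
  rw [deltaSandwich_midComul, counit_pHat, Algebra.TensorProduct.one_def, deltaSandwich_tmul] at e
  simpa using e

end QuasiHopfAlgebra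

/-! ### The element `γ` and the twist `f` -/

namespace QuasiHopfAlgebra

variable {k H : Type*} [Field k] [Ring H] [Algebra k H] (Q : QuasiHopfAlgebra k H)

/-- A shortcut instance. -/
noncomputable instance fourfoldSemiring : Semiring (H ⊗[k] (H ⊗[k] (H ⊗[k] H))) :=
  Algebra.TensorProduct.instSemiring

/-- The inclusion of the first factor of `H ⊗ H ⊗ H ⊗ H`. -/
noncomputable def inc1 (k H : Type*) [Field k] [Ring H] [Algebra k H] :
    H →ₐ[k] H ⊗[k] (H ⊗[k] (H ⊗[k] H)) := Algebra.TensorProduct.includeLeft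

/-- The inclusion of the second factor of `H ⊗ H ⊗ H ⊗ H`. -/
noncomputable def inc2 (k H : Type*) [Field k] [Ring H] [Algebra k H] :
    H →ₐ[k] H ⊗[k] (H ⊗[k] (H ⊗[k] H)) :=
  Algebra.TensorProduct.includeRight.comp Algebra.TensorProduct.includeLeft

/-- The inclusion of the third factor of `H ⊗ H ⊗ H ⊗ H`. -/
noncomputable def inc3 (k H : Type*) [Field k] [Ring H] [Algebra k H] :
    H →ₐ[k] H ⊗[k] (H ⊗[k] (H ⊗[k] H)) :=
  Algebra.TensorProduct.includeRight.comp
    (Algebra.TensorProduct.includeRight.comp Algebra.TensorProduct.includeLeft)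

/-- The inclusion of the fourth factor of `H ⊗ H ⊗ H ⊗ H`. -/
noncomputable def inc4 (k H : Type*) [Field k] [Ring H] [Algebra k H] :
    H →ₐ[k] H ⊗[k] (H ⊗[k] (H ⊗[k] H)) :=
  Algebra.TensorProduct.includeRight.comp
    (Algebra.TensorProduct.includeRight.comp Algebra.TensorProduct.includeRight)

section

@[simp] theorem inc1_apply (a : H) : inc1 k H a = a ⊗ₜ 1 := rfl
@[simp] theorem inc2_apply (a : H) : inc2 k H a = 1 ⊗ₜ (a ⊗ₜ 1) := rfl
@[simp] theorem inc3_apply (a : H) : inc3 k H a = 1 ⊗ₜ (1 ⊗ₜ (a ⊗ₜ 1)) := rfl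
@[simp] theorem inc4_apply (a : H) : inc4 k H a = 1 ⊗ₜ (1 ⊗ₜ (1 ⊗ₜ a)) := rfl

instance : SlotsCommute (inc1 k H) (inc2 k H) where comm x y := by simp [Commute, SemiconjBy]
instance : SlotsCommute (inc1 k H) (inc3 k H) where comm x y := by simp [Commute, SemiconjBy]
instance : SlotsCommute (inc1 k H) (inc4 k H) where comm x y := by simp [Commute, SemiconjBy]
instance : SlotsCommute (inc2 k H) (inc3 k H) where comm x y := by simp [Commute, SemiconjBy]
instance : SlotsCommute (inc2 k H) (inc4 k H) where comm x y := by simp [Commute, SemiconjBy]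
instance : SlotsCommute (inc3 k H) (inc4 k H) where comm x y := by simp [Commute, SemiconjBy]

end

theorem slotEval_inc (T : H ⊗[k] (H ⊗[k] (H ⊗[k] H))) :
    slotEval (inc1 k H) (slotEval (inc2 k H) (slotEval (inc3 k H) (inc4 k H))) T = T := by
  induction T using TensorProduct.induction_on with
  | zero => simp
  | add x y hx hy => simp [hx, hy]
  | tmul a T =>
    induction T using TensorProduct.triple_induction with
    | zero => simp
    | add x y hx hy => simp only [TensorProduct.tmul_add, map_add, hx, hy]
    | tmul b c d => simp

@[simp]
theorem gammaMap_tmul (a b c d : H) : Q.gammaMap (a ⊗ₜ (b ⊗ₜ (c ⊗ₜ d))) =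
    (Q.antipode b * Q.α * c) ⊗ₜ (Q.antipode a * Q.α * d) := by simp [gammaMap]

theorem gammaElt_eq : Q.gammaElt = Q.gammaMap (Q.phiAt (inc1 k H) (inc2 k H) (inc3 k H) *
    Q.phiInvAt (Q.conv (inc1 k H) (inc2 k H)) (inc3 k H) (inc4 k H)) := by
  rw [gammaElt, ← slotEval_inc (_ * _), map_mul, slotEval_tmulOne, slotEval_comulFst]
  rfl

/-- Of the two copies of `α` in `γ`, one lies between legs two and three and the other between legs
one and four; each trivialises its pair of slots. The second case is `gammaMap_outer`. -/
theorem gammaMap_mid : SlotEqLeft Q.gammaMap (Q.conv (inc2 k H) (inc3 k H)) (Q.unitSlot _) := by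
  intro w h
  induction w using TensorProduct.induction_on with
  | zero => simp
  | add x y hx hy => simp only [mul_add, map_add, hx, hy]
  | tmul a T =>
    induction T using TensorProduct.triple_induction with
    | zero => simp
    | add x y hx hy => simp only [TensorProduct.tmul_add, mul_add, map_add, hx, hy]
    | tmul b c d =>
      have : ∀ s : H ⊗[k] H, Q.gammaMap (slotEval (inc2 k H) (inc3 k H) s *
          (a ⊗ₜ (b ⊗ₜ (c ⊗ₜ d)))) = (Q.antipode b * Q.evMap s * c) ⊗ₜ (Q.antipode a * Q.α * d) := by
        intro s
        induction s using TensorProduct.induction_on with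
        | zero => simp
        | add x y hx hy => simp only [map_add, add_mul, mul_add, TensorProduct.add_tmul, hx, hy]
        | tmul x y => simp [mul_assoc]
      rw [conv_apply, this, unitSlot_apply, ← Algebra.smul_def]
      simp [TensorProduct.smul_tmul']

theorem gammaMap_outer : SlotEqLeft Q.gammaMap (Q.conv (inc1 k H) (inc4 k H)) (Q.unitSlot _) := by
  intro w h
  induction w using TensorProduct.induction_on with
  | zero => simp
  | add x y hx hy => simp only [mul_add, map_add, hx, hy]
  | tmul a T =>
    induction T using TensorProduct.triple_induction with
    | zero => simp
    | add x y hx hy => simp only [TensorProduct.tmul_add, mul_add, map_add, hx, hy]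
    | tmul b c d =>
      have : ∀ s : H ⊗[k] H, Q.gammaMap (slotEval (inc1 k H) (inc4 k H) s *
          (a ⊗ₜ (b ⊗ₜ (c ⊗ₜ d)))) = (Q.antipode b * Q.α * c) ⊗ₜ (Q.antipode a * Q.evMap s * d) := by
        intro s
        induction s using TensorProduct.induction_on with
        | zero => simp
        | add x y hx hy => simp only [map_add, add_mul, mul_add, TensorProduct.tmul_add, hx, hy]
        | tmul x y => simp [mul_assoc]
      rw [conv_apply, this, unitSlot_apply, ← Algebra.smul_def]
      simp [TensorProduct.smul_tmul']

theorem gammaMap_mul_slotEval (w : H ⊗[k] (H ⊗[k] (H ⊗[k] H))) (s : H ⊗[k] H) :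
    Q.gammaMap (w * slotEval (Q.conv (inc1 k H) (inc2 k H)) (Q.conv (inc3 k H) (inc4 k H)) s) =
      mulMid k (Q.gammaMap w)
        (TensorProduct.map Q.antipodeComulOp Q.comul.toLinearMap s) := by
  induction s using TensorProduct.induction_on with
  | zero => simp
  | add x y hx hy => simp only [map_add, mul_add, hx, hy]
  | tmul x y =>
    simp only [slotEval_tmul, conv_apply, TensorProduct.map_tmul, mulMid_tmul, antipodeComulOp,
      LinearMap.comp_apply, AlgHom.toLinearMap_apply, LinearEquiv.coe_coe]
    generalize Q.comul x = s
    generalize Q.comul y = t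
    induction s using TensorProduct.induction_on with
    | zero => simp
    | add x y hx hy => simp only [map_add, mul_add, add_mul, hx, hy]
    | tmul x1 x2 =>
      induction t using TensorProduct.induction_on with
      | zero => simp
      | add x y hx hy => simp only [map_add, mul_add, hx, hy]
      | tmul y1 y2 =>
        induction w using TensorProduct.induction_on with
        | zero => simp
        | add x y hx hy => simp only [map_add, mul_add, add_mul, hx, hy]
        | tmul a T =>
          induction T using TensorProduct.triple_induction with
          | zero => simp
          | add x y hx hy =>
            simp only [TensorProduct.tmul_add, map_add, mul_add, add_mul, hx, hy]
          | tmul b c d => simp [mul_assoc]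

theorem gammaSandwich_eq (s : H ⊗[k] H) : Q.gammaSandwich s = Q.gammaMap
    (Q.phiAt (inc1 k H) (inc2 k H) (inc3 k H) *
    Q.phiInvAt (Q.conv (inc1 k H) (inc2 k H)) (inc3 k H) (inc4 k H) *
    slotEval (Q.conv (inc1 k H) (inc2 k H)) (Q.conv (inc3 k H) (inc4 k H)) s) := by
  rw [gammaMap_mul_slotEval, ← gammaElt_eq]; rfl

/-- `K(h₁) γ Δ(h₂) = ε(h) γ`. -/
theorem gammaSandwich_comul (h : H) :
    Q.gammaSandwich (Q.comul h) = Q.counit h • Q.gammaElt := by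
  rw [gammaSandwich_eq, ← conv_apply, mul_assoc, phiInvAt_mul_conv]
  have e2 : Q.phiAt (inc1 k H) (inc2 k H) (inc3 k H) *
      Q.conv (Q.conv (Q.conv (inc1 k H) (inc2 k H)) (inc3 k H)) (inc4 k H) h =
      Q.conv (Q.conv (inc1 k H) (Q.conv (inc2 k H) (inc3 k H))) (inc4 k H) h *
        Q.phiAt (inc1 k H) (inc2 k H) (inc3 k H) :=
    mul_slotEval_left (fun x => Q.phiAt_mul_conv _ _ _ x) _
      fun y => Q.commute_phiAt_left _ y
  rw [← mul_assoc, e2, mul_assoc,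
    (Q.gammaMap_mid.conv_right (Q := Q) (inc1 k H)).conv_left (Q := Q) (inc4 k H)]
  have e3 : Q.conv (Q.conv (inc1 k H) (Q.unitSlot _)) (inc4 k H) =
      Q.conv (inc1 k H) (inc4 k H) := by
    ext x
    have : ∀ f : H →ₐ[k] _, [SlotsCommute f (inc4 k H)] → f = inc1 k H →
        Q.conv f (inc4 k H) = Q.conv (inc1 k H) (inc4 k H) := by
      intro f _ hf; subst hf; rfl
    rw [this _ (Q.conv_unitSlot _)]
  rw [e3, Q.gammaMap_outer, unitSlot_apply, ← Algebra.smul_def, map_smul, ← gammaElt_eq]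

theorem gammaSandwich_comul_mul (s : H ⊗[k] H) (h : H) :
    Q.gammaSandwich (Q.comul h * s) = Q.counit h • Q.gammaSandwich s := by
  have e : ∀ s t : H ⊗[k] H, Q.gammaSandwich (t * s) =
      mulMid k (Q.gammaSandwich t) (TensorProduct.map Q.antipodeComulOp Q.comul.toLinearMap s) := by
    intro s t
    rw [gammaSandwich_eq, map_mul (slotEval _ _), ← mul_assoc, gammaMap_mul_slotEval, ← gammaSandwich_eq]
  rw [e, gammaSandwich_comul]
  induction s using TensorProduct.induction_on with
  | zero => simp
  | add x y hx hy => simp only [map_add, smul_add, hx, hy]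
  | tmul a b => simp

theorem gammaSandwich_mul_tmul (s : H ⊗[k] H) (a b : H) :
    Q.gammaSandwich (s * (a ⊗ₜ b)) = Q.antipodeComulOp a * Q.gammaSandwich s * Q.comul b := by
  induction s using TensorProduct.induction_on with
  | zero => simp
  | add x y hx hy => simp only [map_add, add_mul, mul_add, hx, hy]
  | tmul c d => simp [mul_assoc]

/-- The counterpart of `deltaSandwich_midComul`: identities for `p` become identities for `f`. -/
theorem gammaSandwich_comulMid (s : H ⊗[k] H) :
    Q.gammaSandwich (Q.comulMid Q.pR s) = Q.twist * Q.comul (TensorProduct.lid k H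
      (TensorProduct.map Q.counit.toLinearMap LinearMap.id s)) := by
  induction s using TensorProduct.induction_on with
  | zero => simp
  | add x y hx hy => simp only [map_add, mul_add, hx, hy]
  | tmul a b =>
    rw [comulMid_tmul, gammaSandwich_mul_tmul, gammaSandwich_comul_mul, gammaSandwich_pR]
    simp

/-- `f Δ(S(h)) = K(h) f`. -/
theorem twist_mul_comul_antipode (h : H) :
    Q.twist * Q.comul (Q.antipode h) = Q.antipodeComulOp h * Q.twist := by
  have e := congrArg Q.gammaSandwich (Q.comulMid_pR h)
  rw [gammaSandwich_comulMid, gammaSandwich_mul_tmul, gammaSandwich_pR, map_one, mul_one] at e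
  rw [← e]
  have e2 : ∀ d : H ⊗[k] H, TensorProduct.lid k H (TensorProduct.map Q.counit.toLinearMap
      LinearMap.id (TensorProduct.map LinearMap.id Q.antipode d)) =
      Q.antipode (TensorProduct.lid k H (Algebra.TensorProduct.map Q.counit (AlgHom.id k H) d)) := by
    intro d
    induction d using TensorProduct.induction_on with
    | zero => simp
    | add x y hx hy => simp [hx, hy]
    | tmul c d => simp
  rw [e2, Q.counit_id_comul]
  simp

/-- `f Δ(α) = γ`. -/
theorem twist_mul_comul_α : Q.twist * Q.comul Q.α = Q.gammaElt := by
  have e := congrArg Q.gammaSandwich Q.comulMid_pR_qHat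
  rw [gammaSandwich_comulMid, unitSlot_evMap_Phi, Algebra.TensorProduct.one_def,
    gammaSandwich_tmul] at e
  simpa using e

end QuasiHopfAlgebra

namespace QuasiHopfAlgebra

variable {k H : Type*} [Field k] [Ring H] [Algebra k H] (Q : QuasiHopfAlgebra k H)

/-! ### Actions on tensor powers -/

theorem lPair1_apply (a : H) (t : H ⊗[k] H) : lPair1 k H a t = (a ⊗ₜ 1) * t := by
  induction t using TensorProduct.induction_on with
  | zero => simp
  | add x y hx hy => simp only [map_add, mul_add, hx, hy]
  | tmul x y => simp

theorem lPair2_apply (a : H) (t : H ⊗[k] H) : lPair2 k H a t = (1 ⊗ₜ a) * t := by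
  induction t using TensorProduct.induction_on with
  | zero => simp
  | add x y hx hy => simp only [map_add, mul_add, hx, hy]
  | tmul x y => simp

theorem rPair1_apply (a : H) (t : H ⊗[k] H) : rPair1 Q a t = t * (Q.antipode a ⊗ₜ 1) := by
  induction t using TensorProduct.induction_on with
  | zero => simp
  | add x y hx hy => simp only [map_add, add_mul, hx, hy]
  | tmul x y => simp

theorem rPair2_apply (a : H) (t : H ⊗[k] H) : rPair2 Q a t = t * (1 ⊗ₜ Q.antipode a) := by
  induction t using TensorProduct.induction_on with
  | zero => simp
  | add x y hx hy => simp only [map_add, add_mul, hx, hy]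
  | tmul x y => simp

theorem slotEval_lTri (T m : H ⊗[k] (H ⊗[k] H)) :
    slotEval (lTri1 k H) (slotEval (lTri2 k H) (lTri3 k H)) T m = T * m := by
  induction T using TensorProduct.triple_induction with
  | zero => simp
  | add x y hx hy => simp [hx, hy, add_mul]
  | tmul x y z =>
    induction m using TensorProduct.triple_induction with
    | zero => simp
    | add x y hx hy => simp only [map_add, mul_add, hx, hy]
    | tmul a b c => simp

theorem slotEval_lTri12 (s t : H ⊗[k] H) (x : H) :
    slotEval (lTri1 k H) (lTri2 k H) s (TensorProduct.assoc k H H H (t ⊗ₜ x)) =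
      TensorProduct.assoc k H H H ((s * t) ⊗ₜ x) := by
  induction s using TensorProduct.induction_on with
  | zero => simp
  | add x y hx hy => simp [add_mul, TensorProduct.add_tmul, hx, hy]
  | tmul a b =>
    induction t using TensorProduct.induction_on with
    | zero => simp
    | add x y hx hy => simp only [map_add, mul_add, TensorProduct.add_tmul, hx, hy]
    | tmul c d => simp

section

variable {M N : Type*} [AddCommMonoid M] [Module k M] [AddCommMonoid N] [Module k N]

theorem conv_onSnd (f g : H →ₐ[k] Module.End k N) [SlotsCommute f g] :
    Q.conv (onSnd M f) (onSnd M g) = onSnd M (Q.conv f g) := by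
  ext; simp

theorem slotEval_slotEval_onSnd (f g h : H →ₐ[k] Module.End k N) [SlotsCommute f g]
    [SlotsCommute f h] [SlotsCommute g h] (T : H ⊗[k] (H ⊗[k] H)) (m : M) (n : N) :
    slotEval (onSnd M f) (slotEval (onSnd M g) (onSnd M h)) T (m ⊗ₜ n) =
      m ⊗ₜ slotEval f (slotEval g h) T n := by
  induction T using TensorProduct.triple_induction with
  | zero => simp
  | add x y hx hy => simp only [map_add, LinearMap.add_apply, TensorProduct.tmul_add, hx, hy]
  | tmul a b c => simp

end

theorem phiInvAt_beta_one :
    Q.phiInvAt (lPair1 k H) (lPair2 k H) (rPair2 Q) (1 ⊗ₜ Q.β) = Q.pR := by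
  rw [phiInvAt_beta, ← Algebra.TensorProduct.one_def, mul_one]

/-- `Φ (Δ ⊗ id)(p) = x¹ ⊗ Δ(x²) p (1 ⊗ S(x³))`. -/
theorem Phi_mul_comul_pR :
    Q.Phi * TensorProduct.assoc k H H H (TensorProduct.map Q.comul.toLinearMap LinearMap.id Q.pR) =
      TensorProduct.map LinearMap.id
        (Q.comulMid Q.pR ∘ₗ TensorProduct.map LinearMap.id Q.antipode) Q.PhiInv := by
  let v : H ⊗[k] (H ⊗[k] H) := 1 ⊗ₜ (1 ⊗ₜ Q.β)
  have hr : ∀ h, Q.conv (lTri3 k H) (rTri3 Q) h v = Q.counit h • v := fun h => by simp [v]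
  have key := Q.contract_gamma_right (f := lTri1 k H) (g := lTri2 k H) (h := lTri3 k H)
    (i := rTri3 Q) (Q.slotEqRight_matCoef LinearMap.id hr)
  rw [matCoef_apply, matCoef_apply, Module.End.mul_apply, Module.End.mul_apply] at key
  have e1 : ∀ T, slotEval (Q.conv (lTri1 k H) (lTri2 k H)) (slotEval (lTri3 k H) (rTri3 Q)) T v =
      TensorProduct.assoc k H H H (TensorProduct.map Q.comul.toLinearMap LinearMap.id
        (TensorProduct.map LinearMap.id Q.coevMap T)) := by
    intro T
    induction T using TensorProduct.triple_induction with
    | zero => simp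
    | add x y hx hy => simp only [map_add, LinearMap.add_apply, hx, hy]
    | tmul a b c =>
      rw [slotEval_tmul, slotEval_tmul, Module.End.mul_apply, Module.End.mul_apply]
      have := slotEval_lTri12 (Q.comul a) 1 (b * Q.β * Q.antipode c)
      rw [mul_one] at this
      simpa [v, conv_apply, Algebra.TensorProduct.one_def, mul_assoc] using this
  have e2 : Q.phiInvAt (lTri2 k H) (lTri3 k H) (rTri3 Q) v = 1 ⊗ₜ Q.pR := by
    rw [phiInvAt, slotEval_slotEval_onSnd, ← phiInvAt, phiInvAt_beta_one]
  have e3 : ∀ T, slotEval (lTri1 k H) (slotEval (Q.conv (lTri2 k H) (lTri3 k H)) (rTri3 Q)) T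
      (1 ⊗ₜ Q.pR) = TensorProduct.map LinearMap.id
        (Q.comulMid Q.pR ∘ₗ TensorProduct.map LinearMap.id Q.antipode) T := by
    intro T
    induction T using TensorProduct.triple_induction with
    | zero => simp
    | add x y hx hy => simp only [map_add, LinearMap.add_apply, hx, hy]
    | tmul a b c =>
      rw [slotEval_tmul, slotEval_tmul, Module.End.mul_apply, Module.End.mul_apply, onSnd_tmul,
        conv_onSnd_tmul, rPair2_apply, comulAction_apply]
      simp [mul_assoc]
  rw [e2, phiAt, slotEval_lTri, phiInvAt, phiInvAt, e1, e3] at key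
  exact key

/-! ### Contractions of the twist -/

theorem delta_onSnd : Q.phiAt (Q.conv (lTri2 k H) (lTri3 k H)) (rTri3 Q) (rTri2 Q)
    (Q.phiInvAt (lTri2 k H) (lTri3 k H) (rTri3 Q) (1 ⊗ₜ (Q.β ⊗ₜ Q.β))) = 1 ⊗ₜ Q.deltaElt := by
  rw [phiInvAt, slotEval_slotEval_onSnd, ← phiInvAt]
  have e : Q.phiAt (Q.conv (lTri2 k H) (lTri3 k H)) (rTri3 Q) (rTri2 Q) =
      Q.phiAt (onSnd H (Q.conv (lPair1 k H) (lPair2 k H))) (rTri3 Q) (rTri2 Q) :=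
    Q.phiAt_congr (Q.conv_onSnd _ _) rfl rfl
  rw [e, phiAt, slotEval_slotEval_onSnd, ← phiAt, ← deltaElt_eq]

/-- `Δ(S(b)) f⁻¹ = f⁻¹ K(b)` moves the antipode out on the right, and `Δ(β) f⁻¹ = δ` absorbs the
twist. Products of coproducts with `f⁻¹` thus turn into actions on `δ`. -/
theorem comul_mul_twistInv (a b : H) :
    Q.comul (a * Q.β * Q.antipode b) * Q.twistInv =
      Q.comul a * Q.deltaElt * Q.antipodeComulOp b := by
  rw [map_mul, map_mul, mul_assoc, comul_antipode_mul_twistInv, ← mul_assoc, mul_assoc (Q.comul a),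
    comul_β_mul_twistInv]

/-- `a ⊗ b ↦ (S(a) ⊗ 1) q_L Δ(b)`. -/
noncomputable def qLAct : H ⊗[k] H →ₗ[k] H ⊗[k] H :=
  Q.midComul Q.qL ∘ₗ TensorProduct.map Q.antipode LinearMap.id

@[simp]
theorem qLAct_tmul (a b : H) : Q.qLAct (a ⊗ₜ b) = (Q.antipode a ⊗ₜ 1) * Q.qL * Q.comul b := by
  simp [qLAct]

theorem qLAct_mul (w : H ⊗[k] H) (a b : H) :
    Q.qLAct (w * (a ⊗ₜ b)) = (Q.antipode a ⊗ₜ 1) * Q.qLAct w * Q.comul b := by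
  induction w using TensorProduct.induction_on with
  | zero => simp
  | add x y hx hy => simp only [map_add, add_mul, mul_add, hx, hy]
  | tmul c d =>
    have : Q.antipode (c * a) ⊗ₜ[k] (1 : H) = (Q.antipode a ⊗ₜ 1) * (Q.antipode c ⊗ₜ 1) := by simp
    rw [Algebra.TensorProduct.tmul_mul_tmul, qLAct_tmul, qLAct_tmul, this, map_mul]
    simp only [mul_assoc]

theorem qLAct_comul_mul (h : H) (w : H ⊗[k] H) :
    Q.qLAct (Q.comul h * w) = (1 ⊗ₜ h) * Q.qLAct w := by
  induction w using TensorProduct.induction_on with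
  | zero => simp
  | add x y hx hy => simp only [map_add, mul_add, hx, hy]
  | tmul c d =>
    rw [qLAct_mul, qLAct_tmul]
    have e := Q.midComul_qL h
    change Q.qLAct (Q.comul h) = _ at e
    have e2 : (1 ⊗ₜ h : H ⊗[k] H) * (Q.antipode c ⊗ₜ 1) = (Q.antipode c ⊗ₜ 1) * (1 ⊗ₜ h) := by simp
    rw [e, ← mul_assoc, ← mul_assoc, ← mul_assoc, e2]

/-- `S(x¹ p¹) α x² p²₁ g¹ ⊗ x³ p²₂ g² = S(X³) ⊗ X¹ β S(X²)`. -/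
theorem qLAct_pR_mul_twistInv : Q.qLAct Q.pR * Q.twistInv =
    TensorProduct.map Q.antipode LinearMap.id (TensorProduct.comm k H H Q.pHat) := by
  let v : H ⊗[k] (H ⊗[k] H) := 1 ⊗ₜ (Q.β ⊗ₜ Q.β)
  have hr : ∀ h, Q.conv (lTri3 k H) (rTri3 Q) h v = Q.counit h • v := fun h => by simp [v]
  -- Two copies of `β` sit in the last two factors, and `alphaLeft` puts `α` between the first two.
  -- The contracted side then contains `S(x¹) α x² β S(x³)`, which is `1`, beside the desired
  -- expression in `Φ`.
  have key := Q.contract_middle (f := rTri1 Q) (g := lTri2 k H) (h := lTri3 k H)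
    (i := rTri3 Q) (j := rTri2 Q) (Q.slotEqRight_matCoef Q.alphaLeft hr)
    (Q.slotEqLeft_matCoef v Q.alphaLeft_conv)
  rw [matCoef_apply, matCoef_apply, Module.End.mul_apply, Module.End.mul_apply,
    Module.End.mul_apply, Module.End.mul_apply, delta_onSnd] at key
  have e1 : ∀ T, Q.alphaLeft (Q.phiInvAt (rTri1 Q) (lTri2 k H) (lTri3 k H)
      (slotEval (rTri1 Q) (slotEval (Q.conv (lTri2 k H) (lTri3 k H))
        (Q.conv (rTri3 Q) (rTri2 Q))) T (1 ⊗ₜ Q.deltaElt))) =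
      Q.qLAct (TensorProduct.map LinearMap.id Q.coevMap T) * Q.twistInv := by
    intro T
    induction T using TensorProduct.triple_induction with
    | zero => simp
    | add x y hx hy => simp only [map_add, LinearMap.add_apply, add_mul, hx, hy]
    | tmul a b c =>
      rw [slotEval_tmul, slotEval_tmul, Module.End.mul_apply, Module.End.mul_apply,
        conv_onSnd_tmul, conv_onSnd_tmul, onFst_tmul, opAction_apply, comulAction_apply,
        phiInvAt, alphaLeft_slotEval, TensorProduct.map_tmul, qLAct_tmul, coevMap_tmul,
        mul_assoc _ _ Q.twistInv, comul_mul_twistInv]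
      simp [mul_assoc, qL]
  have e2 : ∀ T T', Q.alphaLeft (slotEval (lTri3 k H) (slotEval (rTri3 Q) (rTri2 Q)) T
      (slotEval (rTri1 Q) (slotEval (lTri2 k H) (rTri2 Q)) T' v)) =
      (mulMid k Q.α (TensorProduct.map Q.antipode (mulMid k Q.β ∘ₗ
        TensorProduct.map LinearMap.id Q.antipode) T') ⊗ₜ 1) *
      TensorProduct.map Q.antipode LinearMap.id (TensorProduct.comm k H H
        (TensorProduct.map Q.coevMap LinearMap.id ((TensorProduct.assoc k H H H).symm T))) := by
    intro T T'
    induction T' using TensorProduct.triple_induction with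
    | zero => simp
    | add x y hx hy =>
      simp only [map_add, LinearMap.add_apply, add_mul, TensorProduct.add_tmul, hx, hy]
    | tmul a b c =>
      induction T using TensorProduct.triple_induction with
      | zero => simp
      | add x y hx hy => simp only [map_add, LinearMap.add_apply, mul_add, hx, hy]
      | tmul x y z => simp [v, mul_assoc]
  rw [phiInvAt.eq_def (g := Q.conv _ _), e1, phiAt, phiInvAt, e2, PhiInv,
    Q.reassoc_inv_antipode] at key
  rw [← Algebra.TensorProduct.one_def, one_mul] at key
  exact key

/-- `S(x¹) α x² X¹ β S(x³₁ X²) ⊗ x³₂ X³ = 1 ⊗ 1`. -/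
theorem slotEval_qL_pHat :
    slotEval (lPair1 k H) (Q.conv (rPair1 Q) (lPair2 k H)) Q.qL Q.pHat = 1 := by
  let v : H ⊗[k] (H ⊗[k] H) := 1 ⊗ₜ (Q.β ⊗ₜ 1)
  have hr : ∀ h, Q.conv (lTri2 k H) (rTri2 Q) h v = Q.counit h • v := fun h => by
    simp [v, TensorProduct.smul_tmul]
  have key := Q.contract_left_inv (f := rTri1 Q) (g := lTri2 k H) (h := rTri2 Q) (i := lTri3 k H)
    (Q.slotEqRight_matCoef Q.alphaLeft hr)
    (Q.slotEqLeft_matCoef v Q.alphaLeft_conv)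
  rw [matCoef_apply, matCoef_apply, Module.End.mul_apply] at key
  have e1 : ∀ T, slotEval (lTri2 k H) (slotEval (rTri2 Q) (lTri3 k H)) T v = 1 ⊗ₜ
      TensorProduct.map Q.coevMap LinearMap.id ((TensorProduct.assoc k H H H).symm T) := by
    intro T
    induction T using TensorProduct.triple_induction with
    | zero => simp
    | add x y hx hy => simp only [map_add, LinearMap.add_apply, TensorProduct.tmul_add, hx, hy]
    | tmul a b c => simp [v, mul_assoc]
  have e2 : ∀ T s, Q.alphaLeft (slotEval (rTri1 Q) (slotEval (lTri2 k H)
      (Q.conv (rTri2 Q) (lTri3 k H))) T (1 ⊗ₜ s)) =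
      slotEval (lPair1 k H) (Q.conv (rPair1 Q) (lPair2 k H)) (TensorProduct.map Q.evMap
        LinearMap.id ((TensorProduct.assoc k H H H).symm T)) s := by
    intro T s
    induction T using TensorProduct.triple_induction with
    | zero => simp
    | add x y hx hy => simp only [map_add, LinearMap.add_apply, hx, hy]
    | tmul a b c =>
      rw [slotEval_tmul, slotEval_tmul, Module.End.mul_apply, Module.End.mul_apply,
        conv_onSnd_tmul]
      simp only [TensorProduct.assoc_symm_tmul, TensorProduct.map_tmul, slotEval_tmul,
        LinearMap.id_apply, Module.End.mul_apply]
      generalize Q.conv (rPair1 Q) (lPair2 k H) c s = s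
      induction s using TensorProduct.induction_on with
      | zero => simp
      | add x y hx hy => simp only [map_add, TensorProduct.tmul_add, hx, hy]
      | tmul x y => simp [mul_assoc]
  have e3 : ∀ T, Q.alphaLeft (slotEval (rTri1 Q) (slotEval (lTri2 k H) (rTri2 Q)) T v) =
      mulMid k Q.α (TensorProduct.map Q.antipode (mulMid k Q.β ∘ₗ
        TensorProduct.map LinearMap.id Q.antipode) T) ⊗ₜ 1 := by
    intro T
    induction T using TensorProduct.triple_induction with
    | zero => simp
    | add x y hx hy => simp only [map_add, LinearMap.add_apply, TensorProduct.add_tmul, hx, hy]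
    | tmul a b c => simp [v, mul_assoc]
  rw [phiAt, e1, phiInvAt, e2, phiInvAt, e3, PhiInv, Q.reassoc_inv_antipode] at key
  exact key

end QuasiHopfAlgebra

namespace QuasiHopfAlgebra

variable {k H : Type*} [Field k] [Ring H] [Algebra k H] (Q : QuasiHopfAlgebra k H)

/-! ### Invertibility of the twist -/

/-- `a ⊗ b ⊗ c ↦ (1 ⊗ S(a) α) (S(b) ⊗ 1) q_L Δ(c)`. -/
noncomputable def qLActAlpha : H ⊗[k] (H ⊗[k] H) →ₗ[k] H ⊗[k] H :=
  LinearMap.mul' k (H ⊗[k] H) ∘ₗ TensorProduct.map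
    (TensorProduct.mk k H H 1 ∘ₗ LinearMap.mulRight k Q.α ∘ₗ Q.antipode) Q.qLAct

@[simp]
theorem qLActAlpha_tmul (a : H) (w : H ⊗[k] H) :
    Q.qLActAlpha (a ⊗ₜ w) = (1 ⊗ₜ (Q.antipode a * Q.α)) * Q.qLAct w := by simp [qLActAlpha]

/-- The pentagon gives a second description of `γ`, beginning with `Φ⁻¹` in the last three slots;
contraction of legs two and three turns that `Φ⁻¹` into `q_L`. -/
theorem gammaElt_eq' : Q.gammaElt = Q.gammaMap (Q.phiInvAt (inc2 k H) (inc3 k H) (inc4 k H) *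
    Q.phiAt (inc1 k H) (inc2 k H) (Q.conv (inc3 k H) (inc4 k H))) := by
  rw [gammaElt_eq, contract_gamma_mid _ Q.gammaMap_mid]

theorem gammaMap_phiInvAt (W : H ⊗[k] (H ⊗[k] H)) :
    Q.gammaMap (Q.phiInvAt (inc2 k H) (inc3 k H) (inc4 k H) * slotEval (inc1 k H)
      (slotEval (inc2 k H) (Q.conv (inc3 k H) (inc4 k H))) W) = Q.qLActAlpha W := by
  induction W using TensorProduct.triple_induction with
  | zero => simp
  | add x y hx hy => simp only [map_add, mul_add, hx, hy]
  | tmul a b c =>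
    simp only [slotEval_tmul, qLActAlpha_tmul, qLAct_tmul, conv_apply, phiInvAt, qL]
    generalize Q.comul c = s
    generalize Q.PhiInv = T
    induction s using TensorProduct.induction_on with
    | zero => simp
    | add x y hx hy => simp only [map_add, mul_add, hx, hy]
    | tmul x y =>
      induction T using TensorProduct.triple_induction with
      | zero => simp
      | add x y hx hy => simp only [map_add, mul_add, add_mul, hx, hy]
      | tmul u v w => simp [mul_assoc]

theorem gammaSandwich_eq_qLActAlpha (s : H ⊗[k] H) : Q.gammaSandwich s = Q.qLActAlpha
    (Q.Phi * TensorProduct.assoc k H H H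
      (TensorProduct.map Q.comul.toLinearMap LinearMap.id s)) := by
  have e : Q.gammaSandwich s =
      mulMid k Q.gammaElt (TensorProduct.map Q.antipodeComulOp Q.comul.toLinearMap s) := rfl
  rw [e, gammaElt_eq', ← gammaMap_mul_slotEval, mul_assoc, ← gammaMap_phiInvAt,
    map_mul (slotEval _ _), ← phiAt]
  congr 3
  rw [slotEval_assoc, ← slotEval_conv_left]
  rfl

/-- Through the second form of `γ`, `f` depends on `p` only via `Φ (Δ ⊗ id)(p)`, which
`Phi_mul_comul_pR` rewrites in terms of `Φ⁻¹` and a single `p`. -/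
theorem twist_eq : Q.twist = Q.qLActAlpha (TensorProduct.map LinearMap.id
    (Q.comulMid Q.pR ∘ₗ TensorProduct.map LinearMap.id Q.antipode) Q.PhiInv) := by
  rw [← gammaSandwich_pR, gammaSandwich_eq_qLActAlpha, Phi_mul_comul_pR]

theorem antipode_comm_slotEval (a b : H) (s : H ⊗[k] H) :
    TensorProduct.map Q.antipode LinearMap.id (TensorProduct.comm k H H
      (slotEval (lPair1 k H) (Q.conv (rPair1 Q) (lPair2 k H)) (a ⊗ₜ b) s)) =
    (1 ⊗ₜ a) * TensorProduct.map Q.antipode LinearMap.id (TensorProduct.comm k H H s) *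
      Q.antipodeComulOp b := by
  rw [slotEval_tmul, Module.End.mul_apply, conv_apply, antipodeComulOp]
  simp only [LinearMap.comp_apply, AlgHom.toLinearMap_apply, LinearEquiv.coe_coe]
  generalize Q.comul b = t
  induction t using TensorProduct.induction_on with
  | zero => simp
  | add x y hx hy => simp only [map_add, LinearMap.add_apply, mul_add, hx, hy]
  | tmul c d =>
    induction s using TensorProduct.induction_on with
    | zero => simp
    | add x y hx hy => simp only [map_add, mul_add, add_mul, hx, hy]
    | tmul x y => simp [mul_assoc]

/-- In the form `twist_eq`, `f⁻¹` can be pulled through `Δ(S(x³))` until it meets the remaining `p`.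
The product there is `S(X³) ⊗ X¹ β S(X²)` by `qLAct_pR_mul_twistInv`, and what is left is the
contraction `slotEval_qL_pHat`. -/
theorem twist_mul_twistInv : Q.twist * Q.twistInv = 1 := by
  have e : ∀ T, Q.qLActAlpha (TensorProduct.map LinearMap.id
      (Q.comulMid Q.pR ∘ₗ TensorProduct.map LinearMap.id Q.antipode) T) * Q.twistInv =
      TensorProduct.map Q.antipode LinearMap.id (TensorProduct.comm k H H
      (slotEval (lPair1 k H) (Q.conv (rPair1 Q) (lPair2 k H)) (TensorProduct.map Q.evMap
        LinearMap.id ((TensorProduct.assoc k H H H).symm T)) Q.pHat)) := by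
    intro T
    induction T using TensorProduct.triple_induction with
    | zero => simp
    | add x y hx hy => simp only [map_add, LinearMap.add_apply, add_mul, hx, hy]
    | tmul a b c =>
      simp only [TensorProduct.assoc_symm_tmul, TensorProduct.map_tmul, LinearMap.id_apply,
        antipode_comm_slotEval, LinearMap.comp_apply, qLActAlpha_tmul, comulMid_tmul, qLAct_mul,
        qLAct_comul_mul, evMap_tmul]
      simp only [mul_assoc, comul_antipode_mul_twistInv]
      rw [← mul_assoc (Q.qLAct Q.pR), qLAct_pR_mul_twistInv]
      have h1 : (1 : H) ⊗ₜ[k] (Q.antipode a * (Q.α * b)) =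
        (1 ⊗ₜ (Q.antipode a * Q.α)) * (1 ⊗ₜ b) := by simp [mul_assoc]
      rw [h1, antipode_one, ← Algebra.TensorProduct.one_def, one_mul]
      simp only [mul_assoc]
  rw [twist_eq, e, ← qL, slotEval_qL_pHat]
  simp [Algebra.TensorProduct.one_def]

/-- A right inverse is two-sided among the endomorphisms of the finite-dimensional space `H ⊗ H`, to
which left multiplication embeds the question. -/
theorem twistInv_mul_twist [FiniteDimensional k H] : Q.twistInv * Q.twist = 1 := by
  have h : Algebra.lmul k (H ⊗[k] H) Q.twist * Algebra.lmul k (H ⊗[k] H) Q.twistInv = 1 := by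
    rw [← map_mul, twist_mul_twistInv, map_one]
  have h2 := mul_eq_one_comm.mp h
  rw [← map_mul] at h2
  simpa using congrArg (fun F => F 1) h2

/-! ### The elements `U` and `V` -/

/-- `a ⊗ b ↦ S(b) ⊗ S(a)`. -/
noncomputable def antipodeOp : H ⊗[k] H →ₗ[k] H ⊗[k] H :=
  TensorProduct.map Q.antipode Q.antipode ∘ₗ (TensorProduct.comm k H H).toLinearMap

@[simp]
theorem antipodeOp_tmul (a b : H) :
    Q.antipodeOp (a ⊗ₜ b) = Q.antipode b ⊗ₜ Q.antipode a := by simp [antipodeOp]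

theorem antipodeOp_comul (h : H) : Q.antipodeOp (Q.comul h) = Q.antipodeComulOp h := rfl

/-- `a ⊗ b ↦ S⁻¹(b) ⊗ S⁻¹(a)`. -/
noncomputable def antipodeInvOp : H ⊗[k] H →ₗ[k] H ⊗[k] H :=
  TensorProduct.map Q.antipodeInv Q.antipodeInv ∘ₗ (TensorProduct.comm k H H).toLinearMap

@[simp]
theorem antipodeInvOp_tmul (a b : H) :
    Q.antipodeInvOp (a ⊗ₜ b) = Q.antipodeInv b ⊗ₜ Q.antipodeInv a := by simp [antipodeInvOp]

@[simp]
theorem antipodeOp_mul (s t : H ⊗[k] H) :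
    Q.antipodeOp (s * t) = Q.antipodeOp t * Q.antipodeOp s := by
  induction s using TensorProduct.induction_on with
  | zero => simp
  | add x y hx hy => simp only [map_add, mul_add, add_mul, hx, hy]
  | tmul a b =>
    induction t using TensorProduct.induction_on with
    | zero => simp
    | add x y hx hy => simp only [map_add, mul_add, add_mul, hx, hy]
    | tmul c d => simp

@[simp]
theorem antipodeInvOp_antipodeOp [FiniteDimensional k H] (s : H ⊗[k] H) :
    Q.antipodeInvOp (Q.antipodeOp s) = s := by
  induction s using TensorProduct.induction_on with
  | zero => simp
  | add x y hx hy => simp only [map_add, hx, hy]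
  | tmul a b => simp

@[simp]
theorem antipodeOp_antipodeInvOp [FiniteDimensional k H] (s : H ⊗[k] H) :
    Q.antipodeOp (Q.antipodeInvOp s) = s := by
  induction s using TensorProduct.induction_on with
  | zero => simp
  | add x y hx hy => simp only [map_add, hx, hy]
  | tmul a b => simp

@[simp]
theorem antipodeInvOp_mul [FiniteDimensional k H] (s t : H ⊗[k] H) :
    Q.antipodeInvOp (s * t) = Q.antipodeInvOp t * Q.antipodeInvOp s := by
  rw [← Q.antipodeInvOp_antipodeOp (Q.antipodeInvOp t * _)]
  simp

theorem U_eq_mul_antipodeOp : Q.U = Q.twistInv * Q.antipodeOp Q.qR := by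
  rw [U, antipodeOp]
  congr 1
  generalize Q.qR = s
  induction s using TensorProduct.induction_on with
  | zero => simp
  | add x y hx hy => simp only [map_add, hx, hy]
  | tmul a b => simp

theorem V_eq_antipodeInvOp : Q.V = Q.antipodeInvOp (Q.twist * Q.pR) := by
  rw [V, antipodeInvOp]
  generalize Q.twist * Q.pR = s
  induction s using TensorProduct.induction_on with
  | zero => simp
  | add x y hx hy => simp only [map_add, hx, hy]
  | tmul a b => simp

/-- `S(q²) ⊗ S(q¹) = S(X²) α X³ ⊗ S(X¹)`. -/
theorem antipodeOp_qR [FiniteDimensional k H] : Q.antipodeOp Q.qR =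
    TensorProduct.comm k H H (TensorProduct.map Q.antipode Q.evMap Q.Phi) := by
  rw [qR]
  generalize Q.Phi = T
  induction T using TensorProduct.triple_induction with
  | zero => simp
  | add x y hx hy => simp only [map_add, hx, hy]
  | tmul a b c => simp [mul_assoc]

/-- `a ⊗ b ⊗ d ↦ b α a ⊗ d`. -/
noncomputable def alphaSwap : H ⊗[k] (H ⊗[k] H) →ₗ[k] H ⊗[k] H :=
  Q.alphaLeft ∘ₗ (TensorProduct.leftComm k H H H).toLinearMap

@[simp]
theorem alphaSwap_tmul (a b d : H) : Q.alphaSwap (a ⊗ₜ (b ⊗ₜ d)) = (b * Q.α * a) ⊗ₜ d := by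
  simp [alphaSwap]

theorem alphaSwap_conv (h : H) (m : H ⊗[k] (H ⊗[k] H)) :
    Q.alphaSwap (Q.conv (rTri2 Q) (lTri1 k H) h m) = Q.counit h • Q.alphaSwap m := by
  induction m using TensorProduct.triple_induction with
  | zero => simp
  | add x y hx hy => simp [hx, hy]
  | tmul x y z =>
    have : ∀ t : H ⊗[k] H, Q.alphaSwap (slotEval (rTri2 Q) (lTri1 k H) t (x ⊗ₜ (y ⊗ₜ z))) =
        (y * Q.evMap t * x) ⊗ₜ z := by
      intro t
      induction t using TensorProduct.induction_on with
      | zero => simp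
      | add a b ha hb => simp [ha, hb, mul_add, add_mul, TensorProduct.add_tmul]
      | tmul a b => simp [mul_assoc]
    rw [conv_apply, this]
    simp [TensorProduct.smul_tmul']

/-- `a ⊗ b ↦ Δ(a) t (b ⊗ 1)`. -/
noncomputable def comulMidLeft (t : H ⊗[k] H) : H ⊗[k] H →ₗ[k] H ⊗[k] H :=
  mulMid k t ∘ₗ TensorProduct.map Q.comul.toLinearMap ((TensorProduct.mk k H H).flip 1)

@[simp]
theorem comulMidLeft_tmul (t : H ⊗[k] H) (x y : H) :
    Q.comulMidLeft t (x ⊗ₜ y) = Q.comul x * t * (y ⊗ₜ 1) := by simp [comulMidLeft]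

/-- `Δ(X¹ β S(X²)) U (X³ ⊗ 1) = p`. -/
theorem comulMidLeft_U_pHat [FiniteDimensional k H] : Q.comulMidLeft Q.U Q.pHat = Q.pR := by
  let v : H ⊗[k] (H ⊗[k] H) := 1 ⊗ₜ (Q.β ⊗ₜ Q.β)
  have hr : ∀ h, Q.conv (lTri3 k H) (rTri3 Q) h v = Q.counit h • v := fun h => by simp [v]
  -- Slots two and three of `δ` enclose the `β` in the third factor, while `alphaSwap` joins the
  -- second factor to the first. One side assembles `Δ(X¹ β S(X²)) U (X³ ⊗ 1)`; the other is `p`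
  -- times `X¹ β S(X²) α X³ = 1`.
  have key := Q.contract_twist (f := lTri2 k H) (g := lTri3 k H) (h := rTri3 Q)
    (i := rTri2 Q) (j := lTri1 k H) (Q.slotEqRight_matCoef Q.alphaSwap hr)
    (Q.slotEqLeft_matCoef v Q.alphaSwap_conv)
  rw [matCoef_apply, matCoef_apply, Module.End.mul_apply, Module.End.mul_apply,
    Module.End.mul_apply, Module.End.mul_apply, delta_onSnd] at key
  have e1 : ∀ T d t, Q.alphaSwap (slotEval (rTri3 Q) (slotEval (rTri2 Q) (lTri1 k H)) T (d ⊗ₜ t)) =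
      t * TensorProduct.comm k H H (TensorProduct.map Q.antipode Q.evMap T) * (d ⊗ₜ 1) := by
    intro T d t
    induction T using TensorProduct.triple_induction with
    | zero => simp
    | add x y hx hy => simp only [map_add, LinearMap.add_apply, mul_add, add_mul, hx, hy]
    | tmul a b c =>
      induction t using TensorProduct.induction_on with
      | zero => simp
      | add x y hx hy => simp only [map_add, TensorProduct.tmul_add, add_mul, hx, hy]
      | tmul x y => simp [mul_assoc]
  have e2 : ∀ T, Q.alphaSwap (Q.phiAt (rTri3 Q) (rTri2 Q) (lTri1 k H)
      (slotEval (Q.conv (lTri2 k H) (lTri3 k H)) (slotEval (Q.conv (rTri3 Q) (rTri2 Q))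
        (lTri1 k H)) T (1 ⊗ₜ Q.deltaElt))) = Q.comulMidLeft Q.U
        (TensorProduct.map Q.coevMap LinearMap.id ((TensorProduct.assoc k H H H).symm T)) := by
    intro T
    induction T using TensorProduct.triple_induction with
    | zero => simp
    | add x y hx hy => simp only [map_add, LinearMap.add_apply, hx, hy]
    | tmul a b c =>
      rw [slotEval_tmul, slotEval_tmul, Module.End.mul_apply, Module.End.mul_apply, onFst_tmul,
        conv_onSnd_tmul, conv_onSnd_tmul, opAction_apply, comulAction_apply, phiAt, e1,
        TensorProduct.assoc_symm_tmul, TensorProduct.map_tmul, comulMidLeft_tmul,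
        U_eq_mul_antipodeOp, antipodeOp_qR, coevMap_tmul, ← mul_assoc _ Q.twistInv,
        comul_mul_twistInv]
      simp [mul_assoc]
  have e3 : ∀ T T', Q.alphaSwap (slotEval (lTri2 k H) (slotEval (lTri3 k H) (rTri3 Q)) T'
      (slotEval (lTri2 k H) (slotEval (rTri2 Q) (lTri1 k H)) T v)) =
      TensorProduct.map LinearMap.id Q.coevMap T' * (mulMid k Q.β (TensorProduct.map LinearMap.id
        (mulMid k Q.α ∘ₗ TensorProduct.map Q.antipode LinearMap.id) T) ⊗ₜ 1) := by
    intro T T'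
    induction T using TensorProduct.triple_induction with
    | zero => simp
    | add x y hx hy =>
      simp only [map_add, LinearMap.add_apply, TensorProduct.add_tmul, mul_add, hx, hy]
    | tmul a b c =>
      induction T' using TensorProduct.triple_induction with
      | zero => simp
      | add x y hx hy => simp only [map_add, LinearMap.add_apply, add_mul, hx, hy]
      | tmul x y z => simp [v, mul_assoc]
  rw [phiAt.eq_def (f := Q.conv _ _), e2, phiAt, phiInvAt, e3, Phi, Q.reassoc_antipode,
    ← Algebra.TensorProduct.one_def, mul_one] at key
  exact key

/-- `a ⊗ b ⊗ c ↦ S(b) α c ⊗ S(a)`. -/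
noncomputable def evOp : H ⊗[k] (H ⊗[k] H) →ₗ[k] H ⊗[k] H :=
  (TensorProduct.comm k H H).toLinearMap ∘ₗ TensorProduct.map Q.antipode Q.evMap

@[simp]
theorem evOp_tmul (a : H) (s : H ⊗[k] H) :
    Q.evOp (a ⊗ₜ s) = Q.evMap s ⊗ₜ Q.antipode a := by simp [evOp]

theorem U_eq_mul_evOp [FiniteDimensional k H] : Q.U = Q.twistInv * Q.evOp Q.Phi := by
  rw [U_eq_mul_antipodeOp, antipodeOp_qR]; rfl

/-- `Δ(S(h₁)) U (h₂ ⊗ 1) = U (1 ⊗ S(h))`. -/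
theorem comulMidLeft_U_comul [FiniteDimensional k H] (h : H) :
    Q.comulMidLeft Q.U (TensorProduct.map Q.antipode LinearMap.id (Q.comul h)) =
      Q.U * (1 ⊗ₜ Q.antipode h) := by
  have e1 : ∀ s : H ⊗[k] H, Q.comulMidLeft Q.U (TensorProduct.map Q.antipode LinearMap.id s) =
      Q.twistInv * Q.evOp (Q.Phi * TensorProduct.assoc k H H H
        (TensorProduct.map Q.comul.toLinearMap LinearMap.id s)) := by
    intro s
    induction s using TensorProduct.induction_on with
    | zero => simp
    | add x y hx hy => simp only [map_add, mul_add, hx, hy]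
    | tmul a b =>
      rw [TensorProduct.map_tmul, comulMidLeft_tmul, U_eq_mul_evOp, ← mul_assoc (Q.comul _),
        comul_antipode_mul_twistInv, mul_assoc, mul_assoc]
      congr 1
      rw [← antipodeOp_comul, TensorProduct.map_tmul]
      simp only [AlgHom.toLinearMap_apply, LinearMap.id_apply]
      generalize Q.comul a = t
      generalize Q.Phi = T
      induction t using TensorProduct.induction_on with
      | zero => simp
      | add x y hx hy => simp only [map_add, mul_add, add_mul, TensorProduct.add_tmul, hx, hy]
      | tmul c d =>
        induction T using TensorProduct.triple_induction with
        | zero => simp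
        | add x y hx hy => simp only [map_add, mul_add, add_mul, hx, hy]
        | tmul x y z => simp [mul_assoc]
  have e2 : ∀ (s : H ⊗[k] H) T, Q.evOp (Algebra.TensorProduct.map (AlgHom.id k H) Q.comul s * T) =
      Q.evOp T * (1 ⊗ₜ Q.antipode (TensorProduct.rid k H
        (Algebra.TensorProduct.map (AlgHom.id k H) Q.counit s))) := by
    intro s T
    induction s using TensorProduct.induction_on with
    | zero => simp
    | add x y hx hy => simp only [map_add, mul_add, add_mul, TensorProduct.tmul_add, hx, hy]
    | tmul a b =>
      induction T using TensorProduct.triple_induction with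
      | zero => simp
      | add x y hx hy => simp only [map_add, mul_add, add_mul, hx, hy]
      | tmul x y z =>
        have e3 : ∀ t : H ⊗[k] H, Q.evMap (t * (y ⊗ₜ z)) = Q.antipode y * Q.evMap t * z := by
          intro t
          induction t using TensorProduct.induction_on with
          | zero => simp
          | add x y hx hy => simp only [map_add, mul_add, add_mul, hx, hy]
          | tmul c d => simp [mul_assoc]
        rw [Algebra.TensorProduct.map_tmul, Algebra.TensorProduct.tmul_mul_tmul, evOp_tmul, e3]
        simp [TensorProduct.smul_tmul']
  have e4 : Q.Phi * TensorProduct.assoc k H H H (TensorProduct.map Q.comul.toLinearMap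
      LinearMap.id (Q.comul h)) =
      Algebra.TensorProduct.map (AlgHom.id k H) Q.comul (Q.comul h) * Q.Phi := by
    rw [Q.quasi_coassoc, mul_assoc _ _ Q.Phi]
    have : ((Q.reassoc⁻¹ : (H ⊗[k] (H ⊗[k] H))ˣ) : H ⊗[k] (H ⊗[k] H)) * Q.Phi = 1 :=
      Q.PhiInv_mul_Phi
    rw [this, mul_one]
    rfl
  rw [e1, e4, e2, Q.id_counit_comul, U_eq_mul_evOp, mul_assoc]
  simp

/-- `U = Δ(q_L¹) p (1 ⊗ S(q_L²))`. -/
theorem U_eq_comulMid [FiniteDimensional k H] :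
    Q.U = Q.comulMid Q.pR (TensorProduct.map LinearMap.id Q.antipode Q.qL) := by
  have e : ∀ s w : H ⊗[k] H, Q.comulMid (Q.comulMidLeft Q.U w)
      (TensorProduct.map LinearMap.id Q.antipode s) =
      Q.comulMidLeft Q.U (slotEval (lPair1 k H) (Q.conv (rPair1 Q) (lPair2 k H)) s w) := by
    intro s w
    induction s using TensorProduct.induction_on with
    | zero => simp
    | add x y hx hy => simp only [map_add, LinearMap.add_apply, hx, hy]
    | tmul a b =>
      induction w using TensorProduct.induction_on with
      | zero => simp [comulMid]
      | add x y hx hy =>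
        simp only [map_add, ← hx, ← hy]
        simp [mul_add, add_mul]
      | tmul c d =>
        have e1 : ∀ t : H ⊗[k] H, Q.comulMidLeft Q.U (lPair1 k H a (slotEval (rPair1 Q)
            (lPair2 k H) t (c ⊗ₜ d))) = Q.comul (a * c) * Q.comulMidLeft Q.U
              (TensorProduct.map Q.antipode LinearMap.id t) * (d ⊗ₜ 1) := by
          intro t
          induction t using TensorProduct.induction_on with
          | zero => simp
          | add x y hx hy => simp only [map_add, LinearMap.add_apply, mul_add, add_mul, hx, hy]
          | tmul x y => simp [mul_assoc]
        rw [slotEval_tmul, Module.End.mul_apply, conv_apply, e1, comulMidLeft_U_comul]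
        simp [mul_assoc]
  -- Substitute `p = Δ(X¹ β S(X²)) U (X³ ⊗ 1)`. By `comulMidLeft_U_comul` the factor in `q_L` moves
  -- inside this expression, where it and `pHat` contract to `1 ⊗ 1`.
  rw [← comulMidLeft_U_pHat, e, slotEval_qL_pHat, Algebra.TensorProduct.one_def,
    comulMidLeft_tmul]
  simp [← Algebra.TensorProduct.one_def]

/-- `a ⊗ b ↦ (1 ⊗ S⁻¹(b)) t Δ(S⁻¹(a))`. -/
noncomputable def antipodeInvMid (t : H ⊗[k] H) : H ⊗[k] H →ₗ[k] H ⊗[k] H :=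
  mulMid k t ∘ₗ TensorProduct.map (TensorProduct.mk k H H 1 ∘ₗ Q.antipodeInv)
    (Q.comul.toLinearMap ∘ₗ Q.antipodeInv) ∘ₗ (TensorProduct.comm k H H).toLinearMap

@[simp]
theorem antipodeInvMid_tmul (t : H ⊗[k] H) (a b : H) : Q.antipodeInvMid t (a ⊗ₜ b) =
    (1 ⊗ₜ Q.antipodeInv b) * t * Q.comul (Q.antipodeInv a) := by simp [antipodeInvMid]

theorem twist_mul_comul_mul_twistInv [FiniteDimensional k H] (h : H) :
    Q.twist * (Q.comul h * Q.twistInv) = Q.antipodeComulOp (Q.antipodeInv h) := by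
  have := Q.twist_mul_comul_antipode (Q.antipodeInv h)
  rw [antipode_antipodeInv] at this
  rw [← mul_assoc, this, mul_assoc, twist_mul_twistInv, mul_one]

/-- `V = (1 ⊗ S⁻¹(X³)) q Δ(S⁻¹(X¹ β S(X²)))`. -/
theorem V_eq_antipodeInvMid [FiniteDimensional k H] : Q.V = Q.antipodeInvMid Q.qR Q.pHat := by
  rw [V_eq_antipodeInvOp, ← comulMidLeft_U_pHat]
  generalize Q.pHat = s
  induction s using TensorProduct.induction_on with
  | zero => simp
  | add x y hx hy => simp only [map_add, mul_add, hx, hy]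
  | tmul a b =>
    rw [comulMidLeft_tmul, U_eq_mul_antipodeOp, antipodeInvMid_tmul, ← mul_assoc Q.twist,
      ← mul_assoc (Q.comul a), ← mul_assoc Q.twist, twist_mul_comul_mul_twistInv,
      ← antipodeOp_comul, antipodeInvOp_mul, antipodeInvOp_mul]
    simp [mul_assoc]

end QuasiHopfAlgebra

namespace QuasiHopfAlgebra

variable {k H : Type*} [Field k] [Ring H] [Algebra k H] (Q : QuasiHopfAlgebra k H)

/-! ### Contractions of the twist with `α` and `β` -/

instance slotsCommute_of_comm {A B C : Type*} [CommSemiring A] [Algebra k A] [Semiring B]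
    [Algebra k B] [Semiring C] [Algebra k C] (f : B →ₐ[k] A) (g : C →ₐ[k] A) :
    SlotsCommute f g where
  comm _ _ := Commute.all _ _

theorem counit_counit_PhiInv : slotEval Q.counit (slotEval Q.counit Q.counit) Q.PhiInv = 1 := by
  have h : Q.unitSlot k = Q.counit := by ext; rfl
  have := Q.phiInvAt_unit_left (Q.unitSlot k) (Q.unitSlot k)
  simp only [phiInvAt, h] at this
  exact this

theorem counit_counit_qL : slotEval Q.counit Q.counit Q.qL = Q.counit Q.α := by
  rw [← mul_one (Q.counit Q.α), ← Q.counit_counit_PhiInv, qL]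
  generalize Q.PhiInv = T
  induction T using TensorProduct.triple_induction with
  | zero => simp
  | add x y hx hy => simp only [map_add, mul_add, hx, hy]
  | tmul a b c => simp; ring

theorem counit_counit_pR : slotEval Q.counit Q.counit Q.pR = Q.counit Q.β := by
  rw [← mul_one (Q.counit Q.β), ← Q.counit_counit_PhiInv, pR]
  generalize Q.PhiInv = T
  induction T using TensorProduct.triple_induction with
  | zero => simp
  | add x y hx hy => simp only [map_add, mul_add, hx, hy]
  | tmul a b c => simp; ring

theorem counit_α_mul_counit_β : Q.counit Q.α * Q.counit Q.β = 1 := by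
  have e : ∀ T : H ⊗[k] (H ⊗[k] H), Q.counit (mulMid k Q.α (TensorProduct.map Q.antipode
      (mulMid k Q.β ∘ₗ TensorProduct.map LinearMap.id Q.antipode) T)) =
      Q.counit Q.α * Q.counit Q.β * slotEval Q.counit (slotEval Q.counit Q.counit) T := by
    intro T
    induction T using TensorProduct.triple_induction with
    | zero => simp
    | add x y hx hy => simp only [map_add, mul_add, hx, hy]
    | tmul a b c => simp; ring
  have e2 := e Q.PhiInv
  rw [PhiInv, Q.reassoc_inv_antipode, map_one] at e2
  rw [← PhiInv, Q.counit_counit_PhiInv, mul_one] at e2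
  exact e2.symm

/-- `a ⊗ b ↦ a S(α) S(b)`. -/
noncomputable def coevα : H ⊗[k] H →ₗ[k] H :=
  mulMid k (Q.antipode Q.α) ∘ₗ TensorProduct.map LinearMap.id Q.antipode

@[simp]
theorem coevα_tmul (a b : H) : Q.coevα (a ⊗ₜ b) = a * Q.antipode Q.α * Q.antipode b := by
  simp [coevα]

/-- `a ⊗ b ↦ S(a) S(β) b`. -/
noncomputable def evβ : H ⊗[k] H →ₗ[k] H :=
  mulMid k (Q.antipode Q.β) ∘ₗ TensorProduct.map Q.antipode LinearMap.id

@[simp]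
theorem evβ_tmul (a b : H) : Q.evβ (a ⊗ₜ b) = Q.antipode a * Q.antipode Q.β * b := by
  simp [evβ]

/-- With `δ` unfolded, the contraction is `coevMap` of `Δ(X¹) p (1 ⊗ S(X²) α X³) = 1 ⊗ 1`. -/
theorem coevα_deltaElt : Q.coevα Q.deltaElt = Q.β := by
  have e : ∀ T T', Q.coevα (Q.deltaMap (Q.comulFst T * tmulOne k H T')) =
      Q.coevMap (Q.comulMid (TensorProduct.map LinearMap.id Q.coevMap T')
        (TensorProduct.map LinearMap.id Q.evMap T)) := by
    intro T T'
    induction T using TensorProduct.triple_induction with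
    | zero => simp
    | add x y hx hy => simp only [map_add, add_mul, hx, hy]
    | tmul a b c =>
      simp only [comulFst, AlgHom.comp_apply, Algebra.TensorProduct.map_tmul,
        TensorProduct.map_tmul, comulMid_tmul, LinearMap.id_apply, AlgHom.id_apply, evMap_tmul]
      generalize Q.comul a = s
      induction s using TensorProduct.induction_on with
      | zero => simp
      | add x y hx hy => simp only [map_add, add_mul, TensorProduct.add_tmul, hx, hy]
      | tmul x y =>
        induction T' using TensorProduct.triple_induction with
        | zero => simp [tmulOne]
        | add x y hx hy =>
          have : tmulOne k H (x + y) = tmulOne k H x + tmulOne k H y := by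
            simp [tmulOne, TensorProduct.add_tmul]
          simp only [this, map_add, mul_add, add_mul, hx, hy]
        | tmul u v w => simp [tmulOne, deltaMap, mul_assoc]
  rw [deltaElt, e, ← qHat, ← pR, comulMid_pR_qHat]
  simp [Algebra.TensorProduct.one_def]

theorem mulMid_add {A : Type*} [Ring A] [Algebra k A] (a b : A) :
    mulMid k (a + b) = mulMid k a + mulMid k b := by ext; simp [mul_add, add_mul]

theorem mulMid_zero {A : Type*} [Ring A] [Algebra k A] : mulMid k (0 : A) = 0 := by ext; simp

theorem mulMid_smul {A : Type*} [Ring A] [Algebra k A] (c : k) (a : A) :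
    mulMid k (c • a) = c • mulMid k a := by ext; simp

theorem coevα_mul (s d : H ⊗[k] H) :
    Q.coevα (s * d) = mulMid k (Q.coevα d) (TensorProduct.map LinearMap.id Q.antipode s) := by
  induction s using TensorProduct.induction_on with
  | zero => simp
  | add x y hx hy => simp only [map_add, add_mul, hx, hy]
  | tmul a b =>
    induction d using TensorProduct.induction_on with
    | zero => simp
    | add x y hx hy => simp only [map_add, mul_add, mulMid_add, LinearMap.add_apply, hx, hy]
    | tmul c d => simp [mul_assoc]

theorem coevα_mul_antipodeOp (d t : H ⊗[k] H) : Q.coevα (d * Q.antipodeOp t) =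
    mulMid k (Q.antipode (Q.evMap t)) (TensorProduct.map LinearMap.id Q.antipode d) := by
  induction t using TensorProduct.induction_on with
  | zero => simp [mulMid_zero]
  | add x y hx hy => simp only [map_add, mul_add, mulMid_add, LinearMap.add_apply, hx, hy]
  | tmul a b =>
    induction d using TensorProduct.induction_on with
    | zero => simp
    | add x y hx hy => simp only [map_add, add_mul, hx, hy]
    | tmul c d => simp [mul_assoc]

theorem evβ_mul (d t : H ⊗[k] H) :
    Q.evβ (d * t) = mulMid k (Q.evβ d) (TensorProduct.map Q.antipode LinearMap.id t) := by
  induction t using TensorProduct.induction_on with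
  | zero => simp
  | add x y hx hy => simp only [map_add, mul_add, hx, hy]
  | tmul a b =>
    induction d using TensorProduct.induction_on with
    | zero => simp
    | add x y hx hy => simp only [map_add, add_mul, mulMid_add, LinearMap.add_apply, hx, hy]
    | tmul c d => simp [mul_assoc]

theorem evβ_antipodeOp_mul (s d : H ⊗[k] H) : Q.evβ (Q.antipodeOp s * d) =
    mulMid k (Q.antipode (Q.coevMap s)) (TensorProduct.map Q.antipode LinearMap.id d) := by
  induction s using TensorProduct.induction_on with
  | zero => simp [mulMid_zero]
  | add x y hx hy => simp only [map_add, add_mul, mulMid_add, LinearMap.add_apply, hx, hy]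
  | tmul a b =>
    induction d using TensorProduct.induction_on with
    | zero => simp
    | add x y hx hy => simp only [map_add, mul_add, hx, hy]
    | tmul c d => simp [mul_assoc]

/-- `g¹ S(g² α) = ε(α) β`. -/
theorem coevα_twistInv : Q.coevα Q.twistInv = Q.counit Q.α • Q.β := by
  rw [← deltaSandwich_qL, ← counit_counit_qL]
  generalize Q.qL = s
  induction s using TensorProduct.induction_on with
  | zero => simp
  | add x y hx hy => simp only [map_add, add_smul, hx, hy]
  | tmul a b =>
    have e : mulMid k (Q.antipode Q.α) (TensorProduct.map LinearMap.id Q.antipode Q.deltaElt) =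
        Q.β := Q.coevα_deltaElt
    rw [deltaSandwich_tmul, ← antipodeOp_comul, mul_assoc, coevα_mul, coevα_mul_antipodeOp,
      evMap_comul, map_smul, mulMid_smul, LinearMap.smul_apply, e, mulMid_smul,
      LinearMap.smul_apply, Q.antipode_right]
    simp [smul_smul, mul_comm]

/-- Written through `q_L`, the contraction of `γ` is `evMap` of `(X¹ β S(X²) ⊗ 1) q_L Δ(X³) = 1 ⊗
1`. -/
theorem evβ_gammaElt : Q.evβ Q.gammaElt = Q.α := by
  have e0 : Q.gammaElt = Q.qLActAlpha Q.Phi := by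
    have := Q.gammaSandwich_eq_qLActAlpha 1
    rwa [Algebra.TensorProduct.one_def, gammaSandwich_tmul, antipodeComulOp_one, map_one, one_mul,
      mul_one, TensorProduct.map_tmul, LinearMap.id_apply, AlgHom.toLinearMap_apply, map_one,
      Algebra.TensorProduct.one_def, TensorProduct.assoc_tmul, ← Algebra.TensorProduct.one_def,
      ← Algebra.TensorProduct.one_def, mul_one] at this
  have e : ∀ T, Q.evβ (Q.qLActAlpha T) = Q.evMap (Q.midComul Q.qL (TensorProduct.map Q.coevMap
      LinearMap.id ((TensorProduct.assoc k H H H).symm T))) := by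
    intro T
    induction T using TensorProduct.triple_induction with
    | zero => simp
    | add x y hx hy => simp only [map_add, hx, hy]
    | tmul a b c =>
      simp only [qLActAlpha_tmul, qLAct_tmul, mul_assoc, TensorProduct.assoc_symm_tmul,
        TensorProduct.map_tmul, midComul_tmul]
      generalize Q.qL * Q.comul c = s
      induction s using TensorProduct.induction_on with
      | zero => simp
      | add x y hx hy => simp only [map_add, mul_add, hx, hy]
      | tmul x y => simp [mul_assoc]
  rw [e0, e, ← pHat, midComul_qL_pHat]
  simp [Algebra.TensorProduct.one_def]

/-- `S(β f¹) f² = ε(β) α`. -/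
theorem evβ_twist : Q.evβ Q.twist = Q.counit Q.β • Q.α := by
  rw [← gammaSandwich_pR, ← counit_counit_pR]
  generalize Q.pR = s
  induction s using TensorProduct.induction_on with
  | zero => simp
  | add x y hx hy => simp only [map_add, add_smul, hx, hy]
  | tmul a b =>
    have e : mulMid k (Q.antipode Q.β) (TensorProduct.map Q.antipode LinearMap.id Q.gammaElt) =
        Q.α := Q.evβ_gammaElt
    rw [gammaSandwich_tmul, ← antipodeOp_comul, evβ_mul, evβ_antipodeOp_mul,
      coevMap_comul, map_smul, mulMid_smul, LinearMap.smul_apply, e, mulMid_smul,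
      LinearMap.smul_apply, Q.antipode_left]
    simp [smul_smul]

end QuasiHopfAlgebra

namespace QuasiHopfAlgebra

variable {k H : Type*} [Field k] [Ring H] [Algebra k H] (Q : QuasiHopfAlgebra k H)

/-! ### The trace formulas -/

/-- `a ⊗ b ⊗ c ⊗ d ↦ a ⊗ b ⊗ S⁻¹(α d) c`. -/
noncomputable def evInvRight : H ⊗[k] (H ⊗[k] (H ⊗[k] H)) →ₗ[k] H ⊗[k] (H ⊗[k] H) :=
  TensorProduct.map LinearMap.id (TensorProduct.map LinearMap.id (Q.antipodeInv ∘ₗ Q.evMap))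

theorem evInvRight_conv :
    SlotEqLeft Q.evInvRight (Q.conv (inc3 k H) (inc4 k H)) (Q.unitSlot _) := by
  intro w h
  induction w using TensorProduct.induction_on with
  | zero => simp
  | add x y hx hy => simp only [mul_add, map_add, hx, hy]
  | tmul a T =>
    induction T using TensorProduct.triple_induction with
    | zero => simp
    | add x y hx hy => simp only [TensorProduct.tmul_add, mul_add, map_add, hx, hy]
    | tmul b c d =>
      have : ∀ s : H ⊗[k] H, Q.evInvRight (slotEval (inc3 k H) (inc4 k H) s *
          (a ⊗ₜ (b ⊗ₜ (c ⊗ₜ d)))) = a ⊗ₜ (b ⊗ₜ Q.antipodeInv (Q.antipode c * Q.evMap s * d)) := by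
        intro s
        induction s using TensorProduct.induction_on with
        | zero => simp
        | add x y hx hy =>
          simp only [map_add, add_mul, mul_add, TensorProduct.tmul_add, hx, hy]
        | tmul x y => simp [evInvRight, mul_assoc]
      rw [conv_apply, this, unitSlot_apply, ← Algebra.smul_def]
      simp [evInvRight]

section

variable [FiniteDimensional k H]

/-- `(Δ ⊗ id)(q) Φ⁻¹ = X¹ ⊗ (1 ⊗ S⁻¹(X³)) q Δ(X²)`. -/
theorem comul_qR_mul_PhiInv :
    TensorProduct.assoc k H H H (TensorProduct.map Q.comul.toLinearMap LinearMap.id Q.qR) *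
      Q.PhiInv = TensorProduct.map LinearMap.id
        (Q.antipodeInvMid Q.qR ∘ₗ TensorProduct.map Q.antipode LinearMap.id) Q.Phi := by
  have key := Q.contract_delta_left (f := inc1 k H) (g := inc2 k H) (h := inc3 k H)
    (i := inc4 k H) Q.evInvRight_conv
  have e1 : ∀ T T', Q.evInvRight (slotEval (Q.conv (inc1 k H) (inc2 k H))
      (slotEval (inc3 k H) (inc4 k H)) T * slotEval (inc1 k H) (slotEval (inc2 k H) (inc3 k H)) T') =
      TensorProduct.assoc k H H H (TensorProduct.map Q.comul.toLinearMap LinearMap.id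
        (TensorProduct.map LinearMap.id (LinearMap.mul' k H ∘ₗ TensorProduct.map
          (Q.antipodeInv ∘ₗ LinearMap.mulLeft k Q.α) LinearMap.id ∘ₗ
          (TensorProduct.comm k H H).toLinearMap) T)) * T' := by
    intro T T'
    induction T using TensorProduct.triple_induction with
    | zero => simp
    | add x y hx hy => simp only [map_add, add_mul, hx, hy]
    | tmul a b c =>
      simp only [slotEval_tmul, conv_apply, TensorProduct.map_tmul, AlgHom.toLinearMap_apply]
      generalize Q.comul a = s
      induction s using TensorProduct.induction_on with
      | zero => simp
      | add x y hx hy => simp only [map_add, add_mul, TensorProduct.add_tmul, hx, hy]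
      | tmul x y =>
        induction T' using TensorProduct.triple_induction with
        | zero => simp
        | add x y hx hy => simp only [map_add, mul_add, hx, hy]
        | tmul u v w => simp [evInvRight, mul_assoc]
  have e2 : ∀ T T', Q.evInvRight (slotEval (inc2 k H) (slotEval (inc3 k H) (inc4 k H)) T *
      slotEval (inc1 k H) (slotEval (Q.conv (inc2 k H) (inc3 k H)) (inc4 k H)) T') =
      TensorProduct.map LinearMap.id (Q.antipodeInvMid
        (TensorProduct.map LinearMap.id (LinearMap.mul' k H ∘ₗ TensorProduct.map
          (Q.antipodeInv ∘ₗ LinearMap.mulLeft k Q.α) LinearMap.id ∘ₗ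
          (TensorProduct.comm k H H).toLinearMap) T) ∘ₗ
            TensorProduct.map Q.antipode LinearMap.id) T' := by
    intro T T'
    induction T' using TensorProduct.triple_induction with
    | zero => simp
    | add x y hx hy => simp only [map_add, mul_add, hx, hy]
    | tmul u v w =>
      simp only [slotEval_tmul, conv_apply, TensorProduct.map_tmul, LinearMap.comp_apply,
        antipodeInvMid_tmul, LinearMap.id_apply, antipodeInv_antipode]
      generalize Q.comul v = s
      induction s using TensorProduct.induction_on with
      | zero => simp
      | add x y hx hy => simp only [map_add, mul_add, add_mul, TensorProduct.tmul_add, hx, hy]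
      | tmul x y =>
        induction T using TensorProduct.triple_induction with
        | zero => simp
        | add x y hx hy =>
          simp only [map_add, mul_add, add_mul, TensorProduct.tmul_add, hx, hy]
        | tmul a b c => simp [evInvRight, mul_assoc]
  rw [phiAt, phiInvAt, e1, phiAt, phiAt, e2] at key
  exact key

theorem coevMap_qR : Q.coevMap Q.qR = 1 := by
  rw [← Q.reassoc_antipode, qR, Phi]
  generalize (Q.reassoc : H ⊗[k] (H ⊗[k] H)) = T
  induction T using TensorProduct.triple_induction with
  | zero => simp
  | add x y hx hy => simp only [map_add, hx, hy]
  | tmul a b c => simp [mul_assoc]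

end

theorem evMap_pR : Q.evMap Q.pR = 1 := by
  rw [← Q.reassoc_inv_antipode, pR, PhiInv]
  generalize ((Q.reassoc⁻¹ : (H ⊗[k] (H ⊗[k] H))ˣ) : H ⊗[k] (H ⊗[k] H)) = T
  induction T using TensorProduct.triple_induction with
  | zero => simp
  | add x y hx hy => simp only [map_add, hx, hy]
  | tmul a b c => simp [mul_assoc]

/-- `a ⊗ b` acts as `h ↦ lam(h S(a)) b`. -/
noncomputable def pairing (lam : Module.Dual k H) : H ⊗[k] H →ₗ[k] Module.End k H :=
  dualTensorHom k H H ∘ₗ TensorProduct.map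
    (LinearMap.compRight k lam ∘ₗ (LinearMap.mul k H).flip ∘ₗ Q.antipode) LinearMap.id

@[simp]
theorem pairing_tmul (lam : Module.Dual k H) (a b h : H) :
    Q.pairing lam (a ⊗ₜ b) h = lam (h * Q.antipode a) • b := rfl

/-- Each pure tensor gives an endomorphism of rank at most one, whose trace with `χ` is an
evaluation of `λ`. When `E` pairs to a multiple of the identity, this computes that multiple of the
trace of `χ`. -/
theorem trace_pairing_comp [FiniteDimensional k H] (lam : Module.Dual k H) (E : H ⊗[k] H)
    (χ : Module.End k H) : LinearMap.trace k H (Q.pairing lam E ∘ₗ χ) =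
      lam (LinearMap.mul' k H (TensorProduct.map χ Q.antipode (TensorProduct.comm k H H E))) := by
  induction E using TensorProduct.induction_on with
  | zero => simp
  | add x y hx hy => simp only [map_add, LinearMap.add_comp, hx, hy]
  | tmul a b =>
    have : Q.pairing lam (a ⊗ₜ b) ∘ₗ χ =
        dualTensorHom k H H ((lam ∘ₗ LinearMap.mulRight k (Q.antipode a) ∘ₗ χ) ⊗ₜ b) := by
      ext; simp
    rw [this, LinearMap.trace_eq_contract_apply, contractLeft_apply]
    simp

theorem pairing_one_tmul_mul (lam : Module.Dual k H) (E : H ⊗[k] H) (v h : H) :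
    Q.pairing lam ((1 ⊗ₜ v) * E) h = v * Q.pairing lam E h := by
  induction E using TensorProduct.induction_on with
  | zero => simp
  | add x y hx hy => simp only [map_add, mul_add, LinearMap.add_apply, hx, hy]
  | tmul a b => simp

/-- The composition of a character with the antipode. -/
noncomputable def antipodeChar (Q : QuasiHopfAlgebra k H) (m : H →ₐ[k] k) : H →ₐ[k] k :=
  AlgHom.ofLinearMap (m.toLinearMap ∘ₗ Q.antipode) (by simp) (by intro x y; simp [mul_comm])

section

variable {Q} {r : H}

theorem IsRightIntegral.comul_mul (hr : Q.IsRightIntegral r) (h : H) :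
    Q.comul r * Q.comul h = Q.counit h • Q.comul r := by rw [← map_mul, hr, map_smul]

theorem IsRightIntegral.comul_mul_comulMid (hr : Q.IsRightIntegral r) (s : H ⊗[k] H) :
    Q.comul r * Q.comulMid Q.pR s = Q.comul r * Q.pR * (1 ⊗ₜ TensorProduct.lid k H
      (Algebra.TensorProduct.map Q.counit (AlgHom.id k H) s)) := by
  induction s using TensorProduct.induction_on with
  | zero => simp
  | add x y hx hy => simp only [map_add, mul_add, TensorProduct.tmul_add, hx, hy]
  | tmul a b => simp [← mul_assoc, hr.comul_mul]

/-- `Δ(r) p (h ⊗ 1) = Δ(r) p (1 ⊗ S(h))`. -/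
theorem IsRightIntegral.comul_mul_pR_mul (hr : Q.IsRightIntegral r) (h : H) :
    Q.comul r * Q.pR * (h ⊗ₜ 1) = Q.comul r * Q.pR * (1 ⊗ₜ Q.antipode h) := by
  rw [mul_assoc, ← comulMid_pR, hr.comul_mul_comulMid]
  congr 2
  have e2 : ∀ d : H ⊗[k] H, TensorProduct.lid k H (Algebra.TensorProduct.map Q.counit
      (AlgHom.id k H) (TensorProduct.map LinearMap.id Q.antipode d)) =
      Q.antipode (TensorProduct.lid k H (Algebra.TensorProduct.map Q.counit (AlgHom.id k H) d)) := by
    intro d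
    induction d using TensorProduct.induction_on with
    | zero => simp
    | add x y hx hy => simp only [map_add, hx, hy]
    | tmul c d => simp
  rw [e2, Q.counit_id_comul]
  simp

/-- `Δ(r) p (1 ⊗ α) = Δ(r)`. -/
theorem IsRightIntegral.comul_mul_pR_mul_α (hr : Q.IsRightIntegral r) :
    Q.comul r * Q.pR * (1 ⊗ₜ Q.α) = Q.comul r := by
  have := hr.comul_mul_comulMid Q.qHat
  rw [comulMid_pR_qHat, mul_one] at this
  rw [← unitSlot_evMap_Phi]
  exact this.symm

theorem IsRightIntegral.antipode [FiniteDimensional k H] (hr : Q.IsRightIntegral r) :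
    Q.IsLeftIntegral (Q.antipode r) := by
  intro h
  obtain ⟨x, rfl⟩ := Q.antipode_bijective.surjective h
  rw [← antipode_mul, hr, map_smul, counit_antipode]

theorem IsLeftIntegral.antipode [FiniteDimensional k H] {t : H} (ht : Q.IsLeftIntegral t) :
    Q.IsRightIntegral (Q.antipode t) := by
  intro h
  obtain ⟨x, rfl⟩ := Q.antipode_bijective.surjective h
  rw [← antipode_mul, ht, map_smul, counit_antipode]

variable [FiniteDimensional k H]

/-- Right multiplication acts on a nonzero left integral by the scalar `μ`, which forces `μ` to be
unital and multiplicative. -/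
theorem IsDistinguished.exists_algHom {μ : Module.Dual k H} (hμ : Q.IsDistinguished μ) :
    ∃ m : H →ₐ[k] k, m.toLinearMap = μ := by
  obtain ⟨t, ht, ht0⟩ := Q.exists_isLeftIntegral_ne_zero
  refine ⟨AlgHom.ofLinearMap μ ?_ ?_, rfl⟩
  · apply smul_left_injective k ht0
    simp [← hμ t ht]
  · intro a b
    apply smul_left_injective k ht0
    simp only [← hμ t ht, ← mul_assoc, mul_smul]
    rw [hμ t ht a, smul_mul_assoc, hμ t ht b, smul_comm]

/-- `S` carries `r` to a left integral and `h r` to `S(r) S(h)`, where `μ` gives the scalar;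
injectivity of `S` transfers it back. -/
theorem IsRightIntegral.mul_left (hr : Q.IsRightIntegral r) {m : H →ₐ[k] k}
    (hm : Q.IsDistinguished m.toLinearMap) (h : H) : h * r = Q.antipodeChar m h • r := by
  apply Q.antipode_bijective.injective
  rw [antipode_mul, hm _ hr.antipode, map_smul]
  rfl

end

/-- A character, as a homomorphism to any algebra. -/
noncomputable def charSlot (A : Type*) [Semiring A] [Algebra k A] (m : H →ₐ[k] k) : H →ₐ[k] A :=
  (Algebra.ofId k A).comp m

theorem charSlot_apply {A : Type*} [Semiring A] [Algebra k A] (m : H →ₐ[k] k) (x : H) :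
    charSlot A m x = algebraMap k A (m x) := rfl

instance charSlot_left {A : Type*} [Semiring A] [Algebra k A] (m : H →ₐ[k] k) (f : H →ₐ[k] A) :
    SlotsCommute (charSlot A m) f where
  comm x y := Algebra.commutes (m x) (f y)

variable {Q} {r : H} {m : H →ₐ[k] k} {lam : Module.Dual k H}

/-- `(m ⊗ m S ⊗ id)(Φ)`. -/
noncomputable def charPhi (Q : QuasiHopfAlgebra k H) (m : H →ₐ[k] k) : H :=
  Q.phiAt (charSlot H m) (charSlot H (Q.antipodeChar m)) (AlgHom.id k H)

/-- `(m ⊗ m S ⊗ id)(Φ⁻¹)`. -/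
noncomputable def charPhiInv (Q : QuasiHopfAlgebra k H) (m : H →ₐ[k] k) : H :=
  Q.phiInvAt (charSlot H m) (charSlot H (Q.antipodeChar m)) (AlgHom.id k H)

theorem charPhiInv_mul_charPhi : Q.charPhiInv m * Q.charPhi m = 1 := Q.phiInvAt_mul_phiAt _ _ _

variable [FiniteDimensional k H]

/-- `comul_qR_mul_PhiInv` rewrites `(Δ ⊗ id)(q) Φ⁻¹` so that `X²` stands as a coproduct directly in
front of `Δ(r)`. There it acts by the scalar `μ(S(X²))`, and the scalars and `X³` collect into
`charPhi`. -/
theorem IsRightIntegral.traceElt_char (hr : Q.IsRightIntegral r)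
    (hm : Q.IsDistinguished m.toLinearMap) :
    TensorProduct.lid k _ (TensorProduct.map m.toLinearMap LinearMap.id (Q.traceElt r)) =
      (1 ⊗ₜ Q.antipodeInv (Q.charPhi m)) * (Q.qR * (Q.comul r * Q.pR)) := by
  rw [traceElt, comul_qR_mul_PhiInv, charPhi, phiAt]
  generalize Q.Phi = T
  induction T using TensorProduct.triple_induction with
  | zero => simp
  | add x y hx hy => simp only [map_add, add_mul, TensorProduct.tmul_add, hx, hy]
  | tmul a b c =>
    simp only [TensorProduct.map_tmul, LinearMap.comp_apply, antipodeInvMid_tmul,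
      antipodeInv_antipode, LinearMap.id_apply, Algebra.TensorProduct.tmul_mul_tmul, mul_one,
      slotEval_tmul, charSlot_apply, AlgHom.id_apply, mul_assoc]
    rw [← mul_assoc (Q.comul b), ← map_mul, hr.mul_left hm]
    simp [← Algebra.smul_def, smul_smul]

/-- Writing `h = S(x)`, the argument becomes a factor `x ⊗ 1` on the right of the tensor, which
`Δ(r) p` exchanges for `1 ⊗ S(x)`. -/
theorem IsRightIntegral.pairing_mul (hr : Q.IsRightIntegral r) (h : H) :
    Q.pairing lam (Q.qR * (Q.comul r * Q.pR)) h =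
      Q.pairing lam (Q.qR * (Q.comul r * Q.pR)) 1 * h := by
  obtain ⟨x, rfl⟩ := Q.antipode_bijective.surjective h
  have e1 : ∀ E : H ⊗[k] H, Q.pairing lam (E * (x ⊗ₜ 1)) 1 =
      Q.pairing lam E (Q.antipode x) := by
    intro E
    induction E using TensorProduct.induction_on with
    | zero => simp
    | add x y hx hy => simp only [map_add, add_mul, LinearMap.add_apply, hx, hy]
    | tmul a b => simp
  have e2 : ∀ E : H ⊗[k] H, Q.pairing lam (E * (1 ⊗ₜ Q.antipode x)) 1 =
      Q.pairing lam E 1 * Q.antipode x := by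
    intro E
    induction E using TensorProduct.induction_on with
    | zero => simp
    | add x y hx hy => simp only [map_add, add_mul, LinearMap.add_apply, hx, hy]
    | tmul a b => simp
  rw [← e1, ← e2, mul_assoc, hr.comul_mul_pR_mul, ← mul_assoc]

/-- The contraction of `f⁻¹` leaves `ε(α) β` between the legs of `V`; the contraction of `f` inside
`V` then gives `ε(β) α`, and `S(p¹) α p² = 1` leaves `ε(α) ε(β) = 1`. -/
theorem coevα_V_twistInv : Q.coevα (Q.V * Q.twistInv) = 1 := by
  rw [coevα_mul, coevα_twistInv, V_eq_antipodeInvOp]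
  have e : ∀ s, mulMid k Q.β (TensorProduct.map LinearMap.id Q.antipode (Q.antipodeInvOp s)) =
      Q.antipodeInv (Q.evβ s) := by
    intro s
    induction s using TensorProduct.induction_on with
    | zero => simp
    | add x y hx hy => simp only [map_add, hx, hy]
    | tmul a b => simp [mul_assoc]
  have e2 : mulMid k Q.α (TensorProduct.map Q.antipode LinearMap.id Q.pR) = 1 := Q.evMap_pR
  rw [mulMid_smul, LinearMap.smul_apply, e, evβ_mul, evβ_twist, mulMid_smul, LinearMap.smul_apply,
    e2, map_smul, smul_smul, counit_α_mul_counit_β, antipodeInv_one, one_smul]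

/-- The cointegral equation at `S(r)`. On its left, right linearity of the pairing extracts the
value at `1` and leaves a contraction of `V f⁻¹`, which is `1`. On its right, `S(r) S(x²)` is the
multiple `μ(S(x²))` of `S(r)`, so `charPhiInv` appears. -/
theorem IsRightIntegral.antipode_pairing_one (hr : Q.IsRightIntegral r)
    (hm : Q.IsDistinguished m.toLinearMap) (hlam : Q.IsLeftCointegral m.toLinearMap lam) :
    Q.antipode (Q.pairing lam (Q.qR * (Q.comul r * Q.pR)) 1) =
      lam (Q.antipode r) • Q.charPhiInv m := by
  have e := hlam (Q.antipode r)
  -- The missing `p` is inserted by `Δ(r) = Δ(r) p (1 ⊗ α)`; under the reversed antipode the extra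
  -- `α` becomes the factor `S(α) ⊗ 1`.
  have e1 : Q.V * Q.comul (Q.antipode r) * Q.U = Q.V * Q.twistInv *
      (Q.antipode Q.α ⊗ₜ 1) * Q.antipodeOp (Q.qR * (Q.comul r * Q.pR)) := by
    have h1 : (Q.antipode Q.α ⊗ₜ[k] (1 : H)) = Q.antipodeOp (1 ⊗ₜ Q.α) := by simp
    rw [mul_assoc _ (Q.antipode Q.α ⊗ₜ[k] (1 : H)), h1, ← antipodeOp_mul, mul_assoc Q.qR,
      hr.comul_mul_pR_mul_α, antipodeOp_mul, antipodeOp_comul, U_eq_mul_antipodeOp]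
    simp only [mul_assoc]
    rw [← mul_assoc _ Q.twistInv, comul_antipode_mul_twistInv]
    simp only [mul_assoc]
  have e2 : ∀ X E : H ⊗[k] H, TensorProduct.rid k H (TensorProduct.map LinearMap.id lam
      (X * (Q.antipode Q.α ⊗ₜ 1) * Q.antipodeOp E)) = mulMid k (Q.antipode Q.α)
        (TensorProduct.map LinearMap.id (Q.antipode ∘ₗ Q.pairing lam E) X) := by
    intro X E
    induction X using TensorProduct.induction_on with
    | zero => simp
    | add x y hx hy => simp only [map_add, add_mul, hx, hy]
    | tmul x y =>
      induction E using TensorProduct.induction_on with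
      | zero => simp
      | add x y hx hy =>
        simp only [map_add, mul_add, hx, hy]
        simp [mul_add]
      | tmul a b => simp [mul_assoc]
  have e3 : ∀ (X : H ⊗[k] H), mulMid k (Q.antipode Q.α) (TensorProduct.map LinearMap.id
      (Q.antipode ∘ₗ Q.pairing lam (Q.qR * (Q.comul r * Q.pR))) X) = Q.coevα X *
        Q.antipode (Q.pairing lam (Q.qR * (Q.comul r * Q.pR)) 1) := by
    intro X
    induction X using TensorProduct.induction_on with
    | zero => simp
    | add x y hx hy => simp only [map_add, add_mul, hx, hy]
    | tmul x y =>
      rw [TensorProduct.map_tmul, LinearMap.comp_apply, hr.pairing_mul]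
      simp [mul_assoc]
  rw [e1, e2, e3, coevα_V_twistInv, one_mul] at e
  rw [e, charPhiInv, phiInvAt]
  generalize Q.PhiInv = T
  induction T using TensorProduct.triple_induction with
  | zero => simp
  | add x y hx hy => simp only [map_add, smul_add, hx, hy]
  | tmul a b c =>
    have h1 : Q.antipode r * Q.antipode b = Q.antipodeChar m b • Q.antipode r := by
      rw [← antipode_mul, hr.mul_left hm, map_smul]
    simp [h1, charSlot_apply, smul_smul, ← Algebra.smul_def, mul_assoc, mul_comm]

theorem IsRightIntegral.pairing_eq (hr : Q.IsRightIntegral r)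
    (hm : Q.IsDistinguished m.toLinearMap) (hlam : Q.IsLeftCointegral m.toLinearMap lam) :
    Q.pairing lam ((1 ⊗ₜ Q.antipodeInv (Q.charPhi m)) * (Q.qR * (Q.comul r * Q.pR))) =
      lam (Q.antipode r) • LinearMap.id := by
  ext h
  have e := congrArg Q.antipodeInv (hr.antipode_pairing_one hm hlam)
  rw [antipodeInv_antipode, map_smul] at e
  rw [pairing_one_tmul_mul, hr.pairing_mul, e, smul_mul_assoc, mul_smul_comm, ← mul_assoc,
    ← antipodeInv_mul, charPhiInv_mul_charPhi]
  simp

theorem trace_eq_traceForm (hr : Q.IsRightIntegral r)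
    (hm : Q.IsDistinguished m.toLinearMap) (hlam : Q.IsLeftCointegral m.toLinearMap lam)
    (χ : Module.End k H) : lam (Q.antipode r) * LinearMap.trace k H χ =
      Q.traceForm m.toLinearMap lam r χ := by
  have e := Q.trace_pairing_comp lam
    ((1 ⊗ₜ Q.antipodeInv (Q.charPhi m)) * (Q.qR * (Q.comul r * Q.pR))) χ
  rw [hr.pairing_eq hm hlam, LinearMap.smul_comp, LinearMap.id_comp, map_smul, smul_eq_mul,
    ← hr.traceElt_char hm] at e
  rw [e, traceForm]
  generalize Q.traceElt r = T
  induction T using TensorProduct.induction_on with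
  | zero => simp
  | add x y hx hy => simp only [map_add, hx, hy]
  | tmul a b => simp

/-- The two endomorphisms are conjugate by `S`. -/
theorem trace_sqAntipodeEnd_eq_trace (Q : QuasiHopfAlgebra k H) :
    LinearMap.trace k H Q.sqAntipodeEnd = LinearMap.trace k H
      (LinearMap.mulLeft k (Q.antipodeInv Q.α * Q.β) ∘ₗ
        LinearMap.mulRight k (Q.α * Q.antipodeInv Q.β) ∘ₗ Q.antipode ∘ₗ Q.antipode) := by
  set χ : Module.End k H := LinearMap.mulLeft k (Q.antipodeInv Q.α * Q.β) ∘ₗ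
    LinearMap.mulRight k (Q.α * Q.antipodeInv Q.β) ∘ₗ Q.antipode ∘ₗ Q.antipode with hχ
  have h1 : Q.sqAntipodeEnd = Q.antipode ∘ₗ (χ ∘ₗ Q.antipodeInv) := by
    ext x; simp [χ, sqAntipodeEnd, mul_assoc]
  have h2 : (χ ∘ₗ Q.antipodeInv) ∘ₗ Q.antipode = χ := by ext; simp
  rw [h1, LinearMap.trace_comp_comm', h2]

/-- The trailing `α S⁻¹(β)` is moved through `S` to the first leg and then across `Δ(r) p`, where
`α` removes `p`. What remains contains `r₁ β S(r₂) = ε(r) β` and then `q¹ β S(q²) = 1`. -/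
theorem trace_sqAntipodeEnd (hr : Q.IsRightIntegral r)
    (hm : Q.IsDistinguished m.toLinearMap) (hlam : Q.IsLeftCointegral m.toLinearMap lam) :
    lam (Q.antipode r) * LinearMap.trace k H Q.sqAntipodeEnd =
      Q.counit r * lam (Q.antipodeInv Q.α * Q.β) := by
  rw [trace_sqAntipodeEnd_eq_trace]
  set χ : Module.End k H := LinearMap.mulLeft k (Q.antipodeInv Q.α * Q.β) ∘ₗ
    LinearMap.mulRight k (Q.α * Q.antipodeInv Q.β) ∘ₗ Q.antipode ∘ₗ Q.antipode
  have e := Q.trace_pairing_comp lam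
    ((1 ⊗ₜ Q.antipodeInv (Q.charPhi m)) * (Q.qR * (Q.comul r * Q.pR))) χ
  rw [hr.pairing_eq hm hlam, LinearMap.smul_comp, LinearMap.id_comp, map_smul, smul_eq_mul] at e
  rw [e]
  have e1 : ∀ E : H ⊗[k] H, LinearMap.mul' k H (TensorProduct.map χ Q.antipode
      (TensorProduct.comm k H H E)) = Q.antipodeInv Q.α * Q.β * LinearMap.mul' k H
        (TensorProduct.map (Q.antipode ∘ₗ Q.antipode) Q.antipode (TensorProduct.comm k H H
          (E * (Q.antipodeInv (Q.α * Q.antipodeInv Q.β) ⊗ₜ 1)))) := by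
    intro E
    induction E using TensorProduct.induction_on with
    | zero => simp
    | add x y hx hy => simp only [map_add, add_mul, mul_add, hx, hy]
    | tmul a b =>
      rw [Algebra.TensorProduct.tmul_mul_tmul]
      simp only [TensorProduct.comm_tmul, TensorProduct.map_tmul, LinearMap.mul'_apply,
        LinearMap.comp_apply, antipode_mul, antipode_antipodeInv]
      simp [χ, mul_assoc]
  have e2 : ∀ (v : H) (s t : H ⊗[k] H), LinearMap.mul' k H
        (TensorProduct.map (Q.antipode ∘ₗ Q.antipode) Q.antipode (TensorProduct.comm k H H
          ((1 ⊗ₜ Q.antipodeInv v) * (s * (t * (1 ⊗ₜ Q.antipodeInv Q.β)))))) =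
      Q.antipode v * LinearMap.mul' k H (TensorProduct.map
        (LinearMap.mulRight k (Q.antipode (Q.coevMap t)) ∘ₗ Q.antipode ∘ₗ Q.antipode) Q.antipode
          (TensorProduct.comm k H H s)) := by
    intro v s t
    induction s using TensorProduct.induction_on with
    | zero => simp
    | add x y hx hy => simp only [map_add, add_mul, mul_add, hx, hy]
    | tmul a b =>
      induction t using TensorProduct.induction_on with
      | zero => simp
      | add x y hx hy =>
        simp only [map_add, add_mul, mul_add, hx, hy]
        simp [mul_add, add_mul]
      | tmul c d => simp [mul_assoc]
  have e3 : ∀ s : H ⊗[k] H, LinearMap.mul' k H (TensorProduct.map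
        (LinearMap.mulRight k (Q.antipode (Q.counit r • Q.β)) ∘ₗ Q.antipode ∘ₗ Q.antipode)
          Q.antipode (TensorProduct.comm k H H s)) = Q.counit r • Q.antipode (Q.coevMap s) := by
    intro s
    induction s using TensorProduct.induction_on with
    | zero => simp
    | add x y hx hy => simp only [map_add, smul_add, hx, hy]
    | tmul a b => simp [mul_assoc]
  have e4 : ((1 ⊗ₜ Q.antipodeInv (Q.charPhi m)) * (Q.qR * (Q.comul r * Q.pR))) *
      (Q.antipodeInv (Q.α * Q.antipodeInv Q.β) ⊗ₜ 1) = (1 ⊗ₜ Q.antipodeInv (Q.charPhi m)) *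
        (Q.qR * (Q.comul r * (1 ⊗ₜ Q.antipodeInv Q.β))) := by
    have h1 : (1 ⊗ₜ (Q.α * Q.antipodeInv Q.β) : H ⊗[k] H) =
      (1 ⊗ₜ Q.α) * (1 ⊗ₜ Q.antipodeInv Q.β) := by simp
    rw [mul_assoc, mul_assoc, hr.comul_mul_pR_mul, antipode_antipodeInv, h1, ← mul_assoc _ (1 ⊗ₜ Q.α),
      hr.comul_mul_pR_mul_α]
  rw [e1, e4, e2, coevMap_comul, e3, coevMap_qR, antipode_one]
  -- The leftover factor `S(charPhi)` matters only when `ε(r) ≠ 0`. In that case `ε` applied to `h r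
  -- = μ(S(h)) r` gives `μ ∘ S = ε`, so `charPhi = 1` by the normalisation of `Φ`.
  by_cases h0 : Q.counit r = 0
  · simp [h0]
  · have h1 : Q.antipodeChar m = Q.counit := by
      ext h
      have := congrArg Q.counit (hr.mul_left hm h)
      rw [map_mul, map_smul, smul_eq_mul] at this
      exact (mul_right_cancel₀ h0 this).symm
    have h2 : Q.charPhi m = 1 := by
      have : charSlot H (Q.antipodeChar m) = Q.unitSlot H := by rw [h1]; rfl
      rw [charPhi, Q.phiAt_congr rfl this rfl, phiAt_unit_mid]
    rw [h2]
    simp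

end QuasiHopfAlgebra

namespace QuasiHopfAlgebra

variable {k H : Type*} [Field k] [Ring H] [Algebra k H] (Q : QuasiHopfAlgebra k H)

/-! ### Contractions of `U` and `V` -/

/-- `a ⊗ b ⊗ c ↦ Δ(S⁻¹(α c)) (a ⊗ b)`. -/
noncomputable def comulEvInv : H ⊗[k] (H ⊗[k] H) →ₗ[k] H ⊗[k] H :=
  LinearMap.mul' k (H ⊗[k] H) ∘ₗ
    TensorProduct.map (Q.comul.toLinearMap ∘ₗ Q.antipodeInv ∘ₗ LinearMap.mulLeft k Q.α)
      LinearMap.id ∘ₗ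
    (TensorProduct.comm k (H ⊗[k] H) H).toLinearMap ∘ₗ (TensorProduct.assoc k H H H).symm.toLinearMap

@[simp]
theorem comulEvInv_tmul (a b c : H) : Q.comulEvInv (a ⊗ₜ (b ⊗ₜ c)) =
    Q.comul (Q.antipodeInv (Q.α * c)) * (a ⊗ₜ b) := by simp [comulEvInv]

/-- `a ⊗ b ⊗ c ↦ (a ⊗ b) Δ(β S(c))`. -/
noncomputable def comulCoev : H ⊗[k] (H ⊗[k] H) →ₗ[k] H ⊗[k] H :=
  LinearMap.mul' k (H ⊗[k] H) ∘ₗ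
    TensorProduct.map LinearMap.id (Q.comul.toLinearMap ∘ₗ LinearMap.mulLeft k Q.β ∘ₗ Q.antipode) ∘ₗ
    (TensorProduct.assoc k H H H).symm.toLinearMap

@[simp]
theorem comulCoev_tmul (a b c : H) : Q.comulCoev (a ⊗ₜ (b ⊗ₜ c)) =
    (a ⊗ₜ b) * Q.comul (Q.β * Q.antipode c) := by simp [comulCoev]

theorem gammaMap_mul_slotEval_three (w : H ⊗[k] (H ⊗[k] (H ⊗[k] H))) (a b c : H) :
    Q.gammaMap (w * slotEval (inc1 k H) (slotEval (inc2 k H) (Q.conv (inc3 k H) (inc4 k H)))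
      (a ⊗ₜ (b ⊗ₜ c))) = Q.antipodeOp (a ⊗ₜ b) * Q.gammaMap w * Q.comul c := by
  rw [slotEval_tmul, slotEval_tmul, conv_apply]
  generalize Q.comul c = s
  induction s using TensorProduct.induction_on with
  | zero => simp
  | add x y hx hy => simp only [map_add, mul_add, hx, hy]
  | tmul x y =>
    induction w using TensorProduct.induction_on with
    | zero => simp
    | add x y hx hy => simp only [map_add, mul_add, add_mul, hx, hy]
    | tmul a T =>
      induction T using TensorProduct.triple_induction with
      | zero => simp
      | add x y hx hy =>
        simp only [TensorProduct.tmul_add, map_add, mul_add, add_mul, hx, hy]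
      | tmul b c d => simp [mul_assoc]

/-- With `U` expressed through `p` and `q_L`, the computation is that of `twist_mul_twistInv`: `f⁻¹`
travels to `p`, and `q_L` and `pHat` contract to `1 ⊗ 1`. -/
theorem qLAct_U_mul_twistInv [FiniteDimensional k H] : Q.qLAct Q.U * Q.twistInv = 1 := by
  have e : ∀ s, Q.qLAct (Q.comulMid Q.pR (TensorProduct.map LinearMap.id Q.antipode s)) *
      Q.twistInv = TensorProduct.map Q.antipode LinearMap.id (TensorProduct.comm k H H
      (slotEval (lPair1 k H) (Q.conv (rPair1 Q) (lPair2 k H)) s Q.pHat)) := by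
    intro s
    induction s using TensorProduct.induction_on with
    | zero => simp
    | add x y hx hy => simp only [map_add, LinearMap.add_apply, add_mul, hx, hy]
    | tmul a b =>
      rw [antipode_comm_slotEval, TensorProduct.map_tmul, comulMid_tmul, qLAct_mul,
        qLAct_comul_mul, antipode_one, ← Algebra.TensorProduct.one_def, one_mul, mul_assoc,
        comul_antipode_mul_twistInv, mul_assoc, ← mul_assoc (Q.qLAct Q.pR),
        qLAct_pR_mul_twistInv, ← mul_assoc]
      rfl
  rw [U_eq_comulMid, e, slotEval_qL_pHat]
  simp [Algebra.TensorProduct.one_def]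

theorem qLActAlpha_comul_mul (s w : H ⊗[k] H) :
    Q.qLActAlpha (Algebra.TensorProduct.map (AlgHom.id k H) Q.comul s * (1 ⊗ₜ w)) =
      (1 ⊗ₜ Q.evMap s) * Q.qLAct w := by
  induction s using TensorProduct.induction_on with
  | zero => simp
  | add x y hx hy => simp only [map_add, TensorProduct.tmul_add, add_mul, hx, hy]
  | tmul a b =>
    rw [Algebra.TensorProduct.map_tmul, Algebra.TensorProduct.tmul_mul_tmul, qLActAlpha_tmul,
      qLAct_comul_mul, ← mul_assoc]
    simp

/-- `Δ(S⁻¹(α w³)) (w¹ ⊗ w²) = 1 ⊗ 1` for `w = Φ⁻¹ (id ⊗ Δ)(p) (1 ⊗ U)`. -/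
theorem comulEvInv_eq_one [FiniteDimensional k H] : Q.comulEvInv (Q.PhiInv *
    (Algebra.TensorProduct.map (AlgHom.id k H) Q.comul Q.pR * (1 ⊗ₜ Q.U))) = 1 := by
  -- After the reversed antipode, `Δ(S⁻¹(α c))` becomes `f Δ(α c) f⁻¹ = γ Δ(c) f⁻¹`, so the pentagon
  -- for `γ` applies.
  have e1 : ∀ T, Q.antipodeOp (Q.comulEvInv T) = Q.gammaMap
      (Q.phiAt (inc1 k H) (inc2 k H) (inc3 k H) *
        Q.phiInvAt (Q.conv (inc1 k H) (inc2 k H)) (inc3 k H) (inc4 k H) *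
      slotEval (inc1 k H) (slotEval (inc2 k H) (Q.conv (inc3 k H) (inc4 k H))) T) *
        Q.twistInv := by
    intro T
    induction T using TensorProduct.triple_induction with
    | zero => simp
    | add x y hx hy => simp only [map_add, mul_add, add_mul, hx, hy]
    | tmul a b c =>
      rw [gammaMap_mul_slotEval_three, ← gammaElt_eq, comulEvInv_tmul, antipodeOp_mul,
        antipodeOp_comul, ← twist_mul_comul_mul_twistInv, map_mul, ← mul_assoc Q.twist,
        ← mul_assoc Q.twist, twist_mul_comul_α]
      simp only [mul_assoc]
  rw [← Q.antipodeInvOp_antipodeOp (Q.comulEvInv _), e1, map_mul (slotEval _ _), ← phiInvAt]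
  generalize hE : slotEval (inc1 k H) (slotEval (inc2 k H) (Q.conv (inc3 k H) (inc4 k H)))
    (Algebra.TensorProduct.map (AlgHom.id k H) Q.comul Q.pR * (1 ⊗ₜ Q.U)) = E
  have hl : SlotEqLeft (Q.gammaMap ∘ₗ LinearMap.mulRight k E) (Q.conv (inc2 k H) (inc3 k H))
      (Q.unitSlot _) := by
    intro w x
    have := Q.gammaMap_mid (w * E) x
    simpa only [LinearMap.comp_apply, LinearMap.mulRight_apply, mul_assoc] using this
  -- The contraction leaves `q_L` acting on `U`, while the legs of `p` meet as `S(p¹) α p² = 1`.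
  have key := Q.contract_gamma_inv (f := inc1 k H) (g := inc2 k H) (h := inc3 k H)
    (i := inc4 k H) hl
  simp only [LinearMap.comp_apply, LinearMap.mulRight_apply, mul_assoc] at key ⊢
  rw [key, ← hE, gammaMap_phiInvAt, qLActAlpha_comul_mul, evMap_pR,
    ← Algebra.TensorProduct.one_def, one_mul, qLAct_U_mul_twistInv,
    Algebra.TensorProduct.one_def, antipodeInvOp_tmul, antipodeInv_one]

/-- Since `δ = Δ(β) f⁻¹` and `f⁻¹ K(c) = Δ(S(c)) f⁻¹`, the final `f` cancels and only coproducts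
remain. -/
theorem slotEval_deltaElt_mul_twist [FiniteDimensional k H] (T : H ⊗[k] (H ⊗[k] H)) :
    slotEval (lPair1 k H) (slotEval (lPair2 k H) (Q.conv (rPair2 Q) (rPair1 Q))) T Q.deltaElt *
      Q.twist = Q.comulCoev T := by
  induction T using TensorProduct.triple_induction with
  | zero => simp
  | add x y hx hy => simp only [map_add, LinearMap.add_apply, add_mul, hx, hy]
  | tmul a b c =>
    have e : (a ⊗ₜ[k] b) = (a ⊗ₜ 1) * (1 ⊗ₜ b) := by simp
    rw [slotEval_tmul, slotEval_tmul, Module.End.mul_apply, Module.End.mul_apply, opAction_apply,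
      lPair2_apply, lPair1_apply, comulCoev_tmul, map_mul, ← comul_β_mul_twistInv, mul_assoc _ _
      (Q.antipodeComulOp c), ← comul_antipode_mul_twistInv, e]
    simp only [mul_assoc, twistInv_mul_twist, mul_one]

/-- `S(X³) ⊗ X¹ β S(X²)`. -/
noncomputable def pHatOp : H ⊗[k] H :=
  TensorProduct.map Q.antipode LinearMap.id (TensorProduct.comm k H H Q.pHat)

theorem phiAt_pHatOp (x : H) : Q.phiAt (lPair2 k H) (rPair2 Q) (rPair1 Q) (x ⊗ₜ Q.β) =
    (x ⊗ₜ 1) * Q.pHatOp := by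
  rw [pHatOp, pHat, phiAt]
  generalize Q.Phi = T
  induction T using TensorProduct.triple_induction with
  | zero => simp
  | add x y hx hy => simp only [map_add, LinearMap.add_apply, mul_add, hx, hy]
  | tmul a b c => simp [mul_assoc]

/-- `pHatOp` is `Φ` acting on `1 ⊗ β`. Moving the coproduct past `Φ` brings its first two slots
together around `β`, where they act by `ε`. -/
theorem slotEval_pHatOp_comul (h : H) :
    slotEval (lPair2 k H) (Q.conv (rPair2 Q) (rPair1 Q)) (Q.comul h) Q.pHatOp =
      (Q.antipode h ⊗ₜ 1) * Q.pHatOp := by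
  have e := Q.phiAt_pHatOp 1
  rw [← Algebra.TensorProduct.one_def, one_mul] at e
  conv_lhs => rw [← e]
  rw [← conv_apply, ← Module.End.mul_apply, ← phiAt_mul_conv, Module.End.mul_apply,
    Q.conv_left_apply _ (fun h => by simp)]
  rw [onFst_tmul, rSlot_apply, one_mul, phiAt_pHatOp]

theorem slotEval_pHatOp_tmul (a b : H) (m : H ⊗[k] H) :
    slotEval (lPair2 k H) (Q.conv (rPair2 Q) (rPair1 Q)) (a ⊗ₜ b) m =
      (1 ⊗ₜ a) * m * Q.antipodeComulOp b := by
  rw [slotEval_tmul, Module.End.mul_apply, opAction_apply, lPair2_apply, mul_assoc]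

/-- `a ⊗ b ⊗ c ⊗ d ↦ a α b ⊗ c α d`, with the brackets `(H ⊗ H) ⊗ (H ⊗ H)`. -/
noncomputable def alphaBoth : (H ⊗[k] H) ⊗[k] (H ⊗[k] H) →ₗ[k] H ⊗[k] H :=
  TensorProduct.map (mulMid k Q.α) (mulMid k Q.α)

theorem alphaBoth_conv (h : H) (m : (H ⊗[k] H) ⊗[k] (H ⊗[k] H)) :
    Q.alphaBoth (Q.conv (onFst (H ⊗[k] H) (rPair1 Q)) (onFst (H ⊗[k] H) (lPair2 k H)) h m) =
      Q.counit h • Q.alphaBoth m := by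
  induction m using TensorProduct.induction_on with
  | zero => simp
  | add x y hx hy => simp only [map_add, smul_add, hx, hy]
  | tmul s t =>
    rw [conv_onFst_tmul, conv_apply, alphaBoth, TensorProduct.map_tmul, TensorProduct.map_tmul,
      TensorProduct.smul_tmul']
    congr 1
    induction s using TensorProduct.induction_on with
    | zero => simp
    | add x y hx hy => simp only [map_add, smul_add, hx, hy]
    | tmul a b =>
      have : ∀ s, mulMid k Q.α (slotEval (rPair1 Q) (lPair2 k H) s (a ⊗ₜ b)) =
          a * Q.evMap s * b := by
        intro s
        induction s using TensorProduct.induction_on with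
        | zero => simp
        | add x y hx hy => simp only [map_add, LinearMap.add_apply, mul_add, add_mul, hx, hy]
        | tmul x y => simp [mul_assoc]
      rw [this]
      simp

/-- `x ⊗ y ↦ (x ⊗ 1) ⊗ (y ⊗ 1)`. -/
noncomputable def oneBoth (k H : Type*) [Field k] [Ring H] [Algebra k H] :
    H ⊗[k] H →ₗ[k] (H ⊗[k] H) ⊗[k] (H ⊗[k] H) :=
  TensorProduct.map ((TensorProduct.mk k H H).flip 1) ((TensorProduct.mk k H H).flip 1)

theorem alphaBoth_slotEval (W : H ⊗[k] (H ⊗[k] (H ⊗[k] H))) (a : H) (s t m : H ⊗[k] H) :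
    Q.alphaBoth (slotEval (onSnd (H ⊗[k] H) (rPair1 Q)) (slotEval (onFst (H ⊗[k] H) (rPair1 Q))
      (slotEval (onFst (H ⊗[k] H) (lPair2 k H)) (onSnd (H ⊗[k] H) (lPair2 k H)))) W
      (onSnd (H ⊗[k] H) (lPair1 k H) a
        (slotEval (onSnd (H ⊗[k] H) (rPair1 Q)) (onFst (H ⊗[k] H) (rPair1 Q)) s
          (slotEval (onFst (H ⊗[k] H) (lPair2 k H)) (onSnd (H ⊗[k] H) (lPair2 k H)) t
            (oneBoth k H m))))) = (1 ⊗ₜ a) * m * Q.antipodeOp s * Q.gammaMap W * t := by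
  induction m using TensorProduct.induction_on with
  | zero => simp
  | add x y hx hy => simp only [map_add, mul_add, add_mul, hx, hy]
  | tmul m1 m2 =>
    induction s using TensorProduct.induction_on with
    | zero => simp
    | add x y hx hy => simp only [map_add, LinearMap.add_apply, mul_add, add_mul, hx, hy]
    | tmul s1 s2 =>
      induction t using TensorProduct.induction_on with
      | zero => simp
      | add x y hx hy => simp only [map_add, LinearMap.add_apply, mul_add, hx, hy]
      | tmul t1 t2 =>
        induction W using TensorProduct.induction_on with
        | zero => simp
        | add x y hx hy => simp only [map_add, LinearMap.add_apply, mul_add, add_mul, hx, hy]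
        | tmul w W =>
          induction W using TensorProduct.triple_induction with
          | zero => simp
          | add x y hx hy =>
            simp only [TensorProduct.tmul_add, map_add, LinearMap.add_apply, mul_add, add_mul,
              hx, hy]
          | tmul x y z => simp [oneBoth, alphaBoth, mul_assoc]

/-- `(1 ⊗ q¹) (S(X³) ⊗ X¹ β S(X²)) K(q²) f = q_L`. -/
theorem slotEval_qR_pHatOp_mul_twist [FiniteDimensional k H] :
    slotEval (lPair2 k H) (Q.conv (rPair2 Q) (rPair1 Q)) Q.qR Q.pHatOp * Q.twist = Q.qL := by
  let v : (H ⊗[k] H) ⊗[k] (H ⊗[k] H) := (1 ⊗ₜ 1) ⊗ₜ (Q.β ⊗ₜ 1)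
  have hr : ∀ h, Q.conv (onSnd (H ⊗[k] H) (lPair1 k H)) (onSnd (H ⊗[k] H) (rPair1 Q)) h v =
      Q.counit h • v := fun h => by simp [v, ← TensorProduct.smul_tmul']
  -- Five slots on four factors: `β` is placed in the third, and one `α` inside each pair of
  -- factors. One side contains `γ = f Δ(α)` and hence the twist; the other is `q_L` times `X¹ β
  -- S(X²) α X³ = 1`.
  have key := Q.contract_nested (f := onSnd (H ⊗[k] H) (lPair1 k H))
    (g := onSnd (H ⊗[k] H) (rPair1 Q)) (h := onFst (H ⊗[k] H) (rPair1 Q))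
    (i := onFst (H ⊗[k] H) (lPair2 k H)) (j := onSnd (H ⊗[k] H) (lPair2 k H))
    (Q.slotEqRight_matCoef Q.alphaBoth hr) (Q.slotEqLeft_matCoef v Q.alphaBoth_conv)
  rw [matCoef_apply, matCoef_apply, ← mul_assoc, Module.End.mul_apply, Module.End.mul_apply,
    Module.End.mul_apply] at key
  have e1 : Q.phiAt (onSnd (H ⊗[k] H) (lPair1 k H)) (onSnd (H ⊗[k] H) (rPair1 Q))
      (onFst (H ⊗[k] H) (rPair1 Q)) v = oneBoth k H Q.pHatOp := by
    rw [pHatOp, pHat, phiAt]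
    generalize Q.Phi = T
    induction T using TensorProduct.triple_induction with
    | zero => simp
    | add x y hx hy => simp only [map_add, LinearMap.add_apply, hx, hy]
    | tmul a b c => simp [oneBoth, v, mul_assoc]
  have e2 : ∀ T, slotEval (lPair2 k H) (Q.conv (rPair2 Q) (rPair1 Q)) (TensorProduct.map
      LinearMap.id (LinearMap.mul' k H ∘ₗ TensorProduct.map (Q.antipodeInv ∘ₗ
        LinearMap.mulLeft k Q.α) LinearMap.id ∘ₗ (TensorProduct.comm k H H).toLinearMap) T)
        Q.pHatOp * Q.twist = Q.alphaBoth ((Q.phiAt (onSnd (H ⊗[k] H) (rPair1 Q))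
          (onFst (H ⊗[k] H) (rPair1 Q)) (onFst (H ⊗[k] H) (lPair2 k H)) * Q.phiInvAt
          (Q.conv (onSnd (H ⊗[k] H) (rPair1 Q)) (onFst (H ⊗[k] H) (rPair1 Q)))
          (onFst (H ⊗[k] H) (lPair2 k H)) (onSnd (H ⊗[k] H) (lPair2 k H)))
          (slotEval (onSnd (H ⊗[k] H) (lPair1 k H)) (slotEval
            (Q.conv (onSnd (H ⊗[k] H) (rPair1 Q)) (onFst (H ⊗[k] H) (rPair1 Q)))
            (Q.conv (onFst (H ⊗[k] H) (lPair2 k H)) (onSnd (H ⊗[k] H) (lPair2 k H)))) T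
            (oneBoth k H Q.pHatOp))) := by
    intro T
    induction T using TensorProduct.triple_induction with
    | zero => simp
    | add x y hx hy => simp only [map_add, LinearMap.add_apply, add_mul, hx, hy]
    | tmul a b c =>
      have e3 : Q.phiAt (onSnd (H ⊗[k] H) (rPair1 Q))
          (onFst (H ⊗[k] H) (rPair1 Q)) (onFst (H ⊗[k] H) (lPair2 k H)) * Q.phiInvAt
          (Q.conv (onSnd (H ⊗[k] H) (rPair1 Q)) (onFst (H ⊗[k] H) (rPair1 Q)))
          (onFst (H ⊗[k] H) (lPair2 k H)) (onSnd (H ⊗[k] H) (lPair2 k H)) =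
          slotEval (onSnd (H ⊗[k] H) (rPair1 Q)) (slotEval (onFst (H ⊗[k] H) (rPair1 Q))
            (slotEval (onFst (H ⊗[k] H) (lPair2 k H)) (onSnd (H ⊗[k] H) (lPair2 k H))))
            (tmulOne k H Q.Phi * Q.comulFst Q.PhiInv) := by
        rw [map_mul, slotEval_tmulOne, slotEval_comulFst]
        rfl
      rw [e3, slotEval_tmul, slotEval_tmul, Module.End.mul_apply, Module.End.mul_apply,
        conv_apply, conv_apply, alphaBoth_slotEval, ← gammaElt, ← twist_mul_comul_α,
        antipodeOp_comul]
      simp only [TensorProduct.map_tmul, LinearMap.id_apply, LinearMap.comp_apply,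
        LinearEquiv.coe_coe, TensorProduct.comm_tmul, LinearMap.mul'_apply,
        LinearMap.mulLeft_apply, slotEval_pHatOp_tmul, antipodeComulOp_mul, mul_assoc]
      have := Q.twist_mul_comul_antipode (Q.antipodeInv (Q.α * c))
      rw [antipode_antipodeInv] at this
      rw [← this, map_mul]
  have e4 : ∀ T T', Q.alphaBoth (slotEval (onSnd (H ⊗[k] H) (lPair1 k H)) (slotEval
      (onSnd (H ⊗[k] H) (rPair1 Q)) (onSnd (H ⊗[k] H) (lPair2 k H))) T
      (slotEval (onFst (H ⊗[k] H) (rPair1 Q)) (slotEval (onFst (H ⊗[k] H) (lPair2 k H))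
        (onSnd (H ⊗[k] H) (lPair2 k H))) T' v)) =
      (1 ⊗ₜ mulMid k Q.β (TensorProduct.map LinearMap.id (mulMid k Q.α ∘ₗ
        TensorProduct.map Q.antipode LinearMap.id) T)) *
      TensorProduct.map Q.evMap LinearMap.id ((TensorProduct.assoc k H H H).symm T') := by
    intro T T'
    induction T' using TensorProduct.triple_induction with
    | zero => simp
    | add x y hx hy => simp only [map_add, LinearMap.add_apply, mul_add, hx, hy]
    | tmul a b c =>
      induction T using TensorProduct.triple_induction with
      | zero => simp
      | add x y hx hy =>
        simp only [map_add, LinearMap.add_apply, TensorProduct.tmul_add, add_mul, hx, hy]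
      | tmul x y z => simp [v, alphaBoth, mul_assoc]
  rw [e1, phiAt.eq_def (f := onSnd (H ⊗[k] H) (lPair1 k H))] at key
  rw [qR, e2, Module.End.mul_apply, key, Module.End.mul_apply, phiAt, phiInvAt, e4, Phi, Q.reassoc_antipode,
    ← Algebra.TensorProduct.one_def, one_mul, qL]

/-- `(w¹ ⊗ w²) Δ(β S(w³)) = 1 ⊗ 1` for `w = (1 ⊗ V) (id ⊗ Δ)(q) Φ`. -/
theorem comulCoev_eq_one [FiniteDimensional k H] : Q.comulCoev ((1 ⊗ₜ Q.V) *
    (Algebra.TensorProduct.map (AlgHom.id k H) Q.comul Q.qR * Q.Phi)) = 1 := by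
  have hr : ∀ h, Q.conv (lPair2 k H) (rPair2 Q) h (Q.β ⊗ₜ Q.β) =
      Q.counit h • (Q.β ⊗ₜ[k] Q.β) := fun h => by simp
  -- The extra `Φ` cancels the `Φ⁻¹` that the pentagon puts in front of `δ`, and the inner pair
  -- around the second `β` is trivial, so one reassociator survives.
  have e1 : Q.phiAt (lPair1 k H) (lPair2 k H) (Q.conv (rPair2 Q) (rPair1 Q)) Q.deltaElt =
      Q.phiAt (lPair2 k H) (rPair2 Q) (rPair1 Q) (Q.β ⊗ₜ Q.β) := by
    rw [deltaElt_eq]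
    exact Q.contract_delta_mid (f := lPair1 k H) (g := lPair2 k H) (h := rPair2 Q)
      (i := rPair1 Q) (Q.slotEqRight_matCoef LinearMap.id hr)
  have e2 : ∀ s, slotEval (lPair1 k H) (slotEval (lPair2 k H) (Q.conv (rPair2 Q) (rPair1 Q)))
      (Algebra.TensorProduct.map (AlgHom.id k H) Q.comul s)
      (Q.phiAt (lPair2 k H) (rPair2 Q) (rPair1 Q) (Q.β ⊗ₜ Q.β)) =
      (Q.coevMap s ⊗ₜ 1) * Q.pHatOp := by
    intro s
    induction s using TensorProduct.induction_on with
    | zero => simp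
    | add x y hx hy =>
      simp only [map_add, LinearMap.add_apply, TensorProduct.add_tmul, add_mul, hx, hy]
    | tmul a b =>
      rw [Algebra.TensorProduct.map_tmul, slotEval_tmul, ← conv_apply, Module.End.mul_apply,
        ← Module.End.mul_apply (Q.conv _ _ b), ← phiAt_mul_conv, Module.End.mul_apply,
        Q.conv_left_apply _ (fun h => by simp), rPair1_apply]
      rw [Algebra.TensorProduct.tmul_mul_tmul, mul_one, phiAt_pHatOp, lPair1_apply, ← mul_assoc]
      simp [mul_assoc]
  rw [← slotEval_deltaElt_mul_twist, map_mul, map_mul, Module.End.mul_apply, Module.End.mul_apply,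
    ← phiAt, e1, e2, coevMap_qR, ← Algebra.TensorProduct.one_def, one_mul, slotEval_tmul,
    map_one, one_mul, V_eq_antipodeInvMid, ← midComul_qL_pHat]
  generalize Q.pHat = s
  induction s using TensorProduct.induction_on with
  | zero => simp
  | add x y hx hy => simp only [map_add, LinearMap.add_apply, add_mul, hx, hy]
  | tmul a b =>
    have e3 : ∀ s m : H ⊗[k] H, slotEval (lPair2 k H) (Q.conv (rPair2 Q) (rPair1 Q))
        ((1 ⊗ₜ Q.antipodeInv b) * s) m * Q.twist = slotEval (lPair2 k H)
        (Q.conv (rPair2 Q) (rPair1 Q)) s m * Q.twist * Q.comul b := by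
      intro s m
      induction s using TensorProduct.induction_on with
      | zero => simp
      | add x y hx hy => simp only [map_add, LinearMap.add_apply, mul_add, add_mul, hx, hy]
      | tmul x y =>
        have := Q.twist_mul_comul_antipode (Q.antipodeInv b)
        rw [antipode_antipodeInv] at this
        rw [Algebra.TensorProduct.tmul_mul_tmul, one_mul, slotEval_pHatOp_tmul,
          slotEval_pHatOp_tmul, antipodeComulOp_mul]
        simp only [mul_assoc, this]
    have e4 : ∀ s m : H ⊗[k] H, slotEval (lPair2 k H) (Q.conv (rPair2 Q) (rPair1 Q)) s
        ((a ⊗ₜ 1) * m) = (a ⊗ₜ 1) * slotEval (lPair2 k H) (Q.conv (rPair2 Q) (rPair1 Q)) s m := by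
      intro s m
      induction s using TensorProduct.induction_on with
      | zero => simp
      | add x y hx hy => simp only [map_add, LinearMap.add_apply, mul_add, hx, hy]
      | tmul x y =>
        have : (1 ⊗ₜ x : H ⊗[k] H) * (a ⊗ₜ 1) = (a ⊗ₜ 1) * (1 ⊗ₜ x) := by simp
        rw [slotEval_pHatOp_tmul, slotEval_pHatOp_tmul, ← mul_assoc (1 ⊗ₜ x : H ⊗[k] H), this]
        simp only [mul_assoc]
    rw [antipodeInvMid_tmul, mul_assoc, e3, map_mul, Module.End.mul_apply, slotEval_pHatOp_comul,
      antipode_antipodeInv, e4, mul_assoc _ _ Q.twist, slotEval_qR_pHatOp_mul_twist, midComul_tmul]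

end QuasiHopfAlgebra

/-! ### Maschke's theorem -/

/-- A ring with an element `e ∈ H ⊗ H` such that `h e = e h` and `e¹ e² = 1` is semisimple. -/
theorem isSemisimpleRing_of_casimir {k H : Type*} [Field k] [Ring H] [Algebra k H]
    (e : H ⊗[k] H) (he : ∀ h : H, (h ⊗ₜ 1) * e = e * (1 ⊗ₜ h))
    (hm : LinearMap.mul' k H e = 1) : IsSemisimpleRing H := by
  suffices h : ComplementedLattice (Submodule H H) from (isSemisimpleModule_iff H H).mpr h
  refine ⟨fun N => ?_⟩
  obtain ⟨g, hg⟩ := LinearMap.exists_leftInverse_of_injective (N.restrictScalars k).subtype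
    (Submodule.ker_subtype _)
  let π : Module.End k H := (N.restrictScalars k).subtype ∘ₗ g
  have hπ : ∀ x, π x ∈ N := fun x => (g x).2
  have hπ2 : ∀ x ∈ N, π x = x := fun x hx =>
    congrArg Subtype.val (LinearMap.congr_fun hg ⟨x, hx⟩)
  -- The averaging `x ↦ e¹ π(e² x)` of a linear projection `π` onto the left ideal `N`; invariance
  -- of `e` makes it left linear, and `e¹ e² = 1` keeps it the identity on `N`.
  let avg : H ⊗[k] H →ₗ[k] Module.End k H := LinearMap.mul' k (Module.End k H) ∘ₗ
    TensorProduct.map (Algebra.lmul k H).toLinearMap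
      (LinearMap.mulLeft k π ∘ₗ (Algebra.lmul k H).toLinearMap)
  have avg_tmul : ∀ a b x, avg (a ⊗ₜ b) x = a * π (b * x) := fun a b x => rfl
  have h1 : ∀ s x, avg s x ∈ N := by
    intro s x
    induction s using TensorProduct.induction_on with
    | zero => simp
    | add s t hs ht => rw [map_add]; exact N.add_mem hs ht
    | tmul a b => rw [avg_tmul]; exact N.smul_mem a (hπ _)
  have h2 : ∀ s, ∀ x ∈ N, avg s x = LinearMap.mul' k H s * x := by
    intro s x hx
    induction s using TensorProduct.induction_on with
    | zero => simp
    | add s t hs ht => simp only [map_add, LinearMap.add_apply, add_mul, hs, ht]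
    | tmul a b =>
      rw [avg_tmul, hπ2 (b * x) (N.smul_mem b hx), LinearMap.mul'_apply, mul_assoc]
  have h3 : ∀ s h x, h * avg s x = avg ((h ⊗ₜ 1) * s) x := by
    intro s h x
    induction s using TensorProduct.induction_on with
    | zero => simp
    | add s t hs ht => simp only [map_add, LinearMap.add_apply, mul_add, hs, ht]
    | tmul a b => simp [avg_tmul, mul_assoc]
  have h4 : ∀ s h x, avg (s * (1 ⊗ₜ h)) x = avg s (h * x) := by
    intro s h x
    induction s using TensorProduct.induction_on with
    | zero => simp
    | add s t hs ht => simp only [map_add, LinearMap.add_apply, add_mul, hs, ht]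
    | tmul a b => simp [avg_tmul, mul_assoc]
  let p : H →ₗ[H] N :=
    { toFun := fun x => ⟨avg e x, h1 e x⟩
      map_add' := fun x y => Subtype.ext (map_add (avg e) x y)
      map_smul' := fun h x => Subtype.ext <| by
        change avg e (h * x) = h * avg e x
        rw [h3, he, h4] }
  exact ⟨_, LinearMap.isCompl_of_proj (f := p) fun x => Subtype.ext <| by
    change avg e x = x
    rw [h2 e x x.2, hm, one_mul]⟩

/-! ### Integrals with counit one and the trace functional -/

namespace QuasiHopfAlgebra

variable {k H : Type*} [Field k] [Ring H] [Algebra k H] (Q : QuasiHopfAlgebra k H)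

/-- Take a left ideal complementary to `ker ε` and let `t` be the component of `1` in it; `h t -
ε(h) t` lies in both summands. -/
theorem exists_isLeftIntegral_of_isSemisimpleRing [IsSemisimpleRing H] :
    ∃ t, Q.IsLeftIntegral t ∧ Q.counit t = 1 := by
  let N : Submodule H H := RingHom.ker Q.counit.toRingHom
  have hN : ∀ x, x ∈ N ↔ Q.counit x = 0 := fun x => RingHom.mem_ker
  obtain ⟨M, hM⟩ := exists_isCompl N
  obtain ⟨n, hn, t, ht, hnt⟩ := Submodule.mem_sup.mp
    (hM.sup_eq_top.symm ▸ Submodule.mem_top : (1 : H) ∈ N ⊔ M)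
  have ht1 : Q.counit t = 1 := by
    have := congrArg Q.counit hnt
    rwa [map_add, (hN n).mp hn, zero_add, map_one] at this
  refine ⟨t, fun h => ?_, ht1⟩
  rw [← sub_eq_zero, ← Submodule.mem_bot H, ← hM.inf_eq_bot]
  refine ⟨(hN _).mpr (by simp [ht1]), M.sub_mem (M.smul_mem h ht) ?_⟩
  rw [Algebra.smul_def]
  exact M.smul_mem _ ht

theorem coevMap_mul_comul (s : H ⊗[k] H) (h : H) :
    Q.coevMap (s * Q.comul h) = Q.counit h • Q.coevMap s := by
  induction s using TensorProduct.induction_on with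
  | zero => simp
  | add x y hx hy => simp only [map_add, add_mul, smul_add, hx, hy]
  | tmul a b =>
    have e : ∀ d : H ⊗[k] H, Q.coevMap ((a ⊗ₜ b) * d) = a * Q.coevMap d * Q.antipode b := by
      intro d
      induction d using TensorProduct.induction_on with
      | zero => simp
      | add x y hx hy => simp only [map_add, mul_add, add_mul, hx, hy]
      | tmul c d => simp [mul_assoc]
    simp [e]

theorem evMap_comul_mul (h : H) (s : H ⊗[k] H) :
    Q.evMap (Q.comul h * s) = Q.counit h • Q.evMap s := by
  induction s using TensorProduct.induction_on with
  | zero => simp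
  | add x y hx hy => simp only [map_add, mul_add, smul_add, hx, hy]
  | tmul a b =>
    have e : ∀ d : H ⊗[k] H, Q.evMap (d * (a ⊗ₜ b)) = Q.antipode a * Q.evMap d * b := by
      intro d
      induction d using TensorProduct.induction_on with
      | zero => simp
      | add x y hx hy => simp only [map_add, mul_add, add_mul, hx, hy]
      | tmul c d => simp [mul_assoc]
    simp [e]

theorem coevMap_qL : Q.coevMap Q.qL = 1 := by
  refine Eq.trans ?_ Q.reassoc_inv_antipode
  rw [qL, ← PhiInv]
  generalize Q.PhiInv = T
  induction T using TensorProduct.triple_induction with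
  | zero => simp
  | add x y hx hy => simp only [map_add, hx, hy]
  | tmul a b c => simp [mul_assoc]

/-- `ε(p¹) p² = β`. -/
theorem counit_pR : TensorProduct.lid k H (TensorProduct.map Q.counit.toLinearMap
    LinearMap.id Q.pR) = Q.β := by
  have e := congrArg (fun F : Module.End k H => F Q.β)
    (Q.phiInvAt_unit_left (lSlot k H) Q.rSlot)
  simp only [phiInvAt, Module.End.one_apply] at e
  conv_rhs => rw [← e]
  rw [pR]
  generalize Q.PhiInv = T
  induction T using TensorProduct.triple_induction with
  | zero => simp
  | add x y hx hy => simp only [map_add, LinearMap.add_apply, hx, hy]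
  | tmul a b c => simp [mul_assoc]

variable {Q} in
theorem IsLeftIntegral.mul_tmul_one {t : H} (ht : Q.IsLeftIntegral t) (s : H ⊗[k] H) :
    s * (t ⊗ₜ 1) = t ⊗ₜ TensorProduct.lid k H (TensorProduct.map Q.counit.toLinearMap
      LinearMap.id s) := by
  induction s using TensorProduct.induction_on with
  | zero => simp
  | add x y hx hy => simp only [map_add, add_mul, TensorProduct.tmul_add, hx, hy]
  | tmul a b => simp [ht a, TensorProduct.smul_tmul]

theorem trace_eq_sum_repr {ι : Type*} [Fintype ι] (b : Module.Basis ι k H) (F : Module.End k H) :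
    LinearMap.trace k H F = ∑ i, b.repr (F (b i)) i := by
  classical
  rw [LinearMap.trace_eq_matrix_trace k b, Matrix.trace]
  simp [LinearMap.toMatrix_apply]

/-- The functional `z ↦ Tr(x ↦ z S²(x) α S⁻¹(β))`. -/
noncomputable def traceFunctional (Q : QuasiHopfAlgebra k H) : Module.Dual k H :=
  LinearMap.trace k H ∘ₗ LinearMap.mulRight k (A := Module.End k H)
    (LinearMap.mulRight k (Q.α * Q.antipodeInv Q.β) ∘ₗ Q.antipode ∘ₗ Q.antipode) ∘ₗ
      (Algebra.lmul k H).toLinearMap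

theorem traceFunctional_apply (z : H) : Q.traceFunctional z = LinearMap.trace k H
    (LinearMap.mulLeft k z ∘ₗ LinearMap.mulRight k (Q.α * Q.antipodeInv Q.β) ∘ₗ Q.antipode ∘ₗ
      Q.antipode) := rfl

variable [FiniteDimensional k H]

/-- The Casimir element is obtained from `q_L Δ(t)` by a flip, `S⁻¹` on one leg and a factor
`S⁻¹(β)` on the other. Its invariance is `(S(h) ⊗ 1) q_L Δ(t) = (1 ⊗ h) q_L Δ(t)`, and its product
is `ε(t) = 1` because `coevMap` sends `q_L` to `1`. -/
theorem isSemisimpleRing_of_isLeftIntegral {t : H} (ht : Q.IsLeftIntegral t)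
    (h1 : Q.counit t = 1) : IsSemisimpleRing H := by
  let c : H ⊗[k] H →ₗ[k] H ⊗[k] H := TensorProduct.map
    (LinearMap.mulRight k (Q.antipodeInv Q.β)) Q.antipodeInv ∘ₗ
      (TensorProduct.comm k H H).toLinearMap
  have c_tmul : ∀ a b, c (a ⊗ₜ b) = (b * Q.antipodeInv Q.β) ⊗ₜ Q.antipodeInv a := fun a b => rfl
  refine isSemisimpleRing_of_casimir (k := k) (c (Q.qL * Q.comul t)) (fun h => ?_) ?_
  · have e1 : ∀ s : H ⊗[k] H, (h ⊗ₜ 1) * c s = c ((1 ⊗ₜ h) * s) := by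
      intro s
      induction s using TensorProduct.induction_on with
      | zero => simp
      | add x y hx hy => simp only [map_add, mul_add, hx, hy]
      | tmul a b => simp [c_tmul, mul_assoc]
    have e2 : ∀ s : H ⊗[k] H, c s * (1 ⊗ₜ h) = c ((Q.antipode h ⊗ₜ 1) * s) := by
      intro s
      induction s using TensorProduct.induction_on with
      | zero => simp
      | add x y hx hy => simp only [map_add, mul_add, add_mul, hx, hy]
      | tmul a b => simp [c_tmul]
    rw [e1, e2, ht.antipode_tmul_one_mul]
  · have e : ∀ s : H ⊗[k] H, LinearMap.mul' k H (c s) = Q.antipodeInv (Q.coevMap s) := by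
      intro s
      induction s using TensorProduct.induction_on with
      | zero => simp
      | add x y hx hy => simp only [map_add, hx, hy]
      | tmul a b => simp [c_tmul, mul_assoc]
    rw [e, coevMap_mul_comul, h1, coevMap_qL, one_smul, antipodeInv_one]

/-- The left integral attached to the trace of `h ↦ β S(α) S²(h) S(β) α`. -/
theorem exists_isLeftIntegral_counit_eq_trace :
    ∃ t, Q.IsLeftIntegral t ∧ Q.counit t = LinearMap.trace k H Q.sqAntipodeEnd := by
  -- The element `c = S²(α) S(β)` is chosen so that `x ↦ S(α) S²(β x) c` is the conjugate of
  -- `sqAntipodeEnd` by `S`.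
  obtain ⟨t, ht, h⟩ := Q.exists_isLeftIntegral_counit
    (Q.antipode (Q.antipode Q.α) * Q.antipode Q.β)
  have e1 : (Q.sqAntipodeEnd ∘ₗ Q.antipodeInv) ∘ₗ Q.antipode = Q.sqAntipodeEnd := by ext; simp
  refine ⟨t, ht, h.trans ?_⟩
  rw [← e1, LinearMap.trace_comp_comm' Q.antipode (Q.sqAntipodeEnd ∘ₗ Q.antipodeInv)]
  congr 1
  ext x
  simp [sqAntipodeEnd, mul_assoc]

variable {Q} {t : H}

/-- The product `S(t) t` of a right and a left integral, both of counit `1`, equals each of them, so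
`t = S(t)`. -/
theorem IsLeftIntegral.isRightIntegral (ht : Q.IsLeftIntegral t) (h1 : Q.counit t = 1) :
    Q.IsRightIntegral t := by
  have e1 := ht.antipode t
  have e2 := ht (Q.antipode t)
  rw [h1, one_smul] at e1
  rw [counit_antipode, h1, one_smul, e1] at e2
  rw [← e2]
  exact ht.antipode

/-- For a left integral `s`, `t s` equals both `s` and `ε(s) t`, so every left integral is a
multiple of the two-sided integral `t`. -/
theorem IsLeftIntegral.isDistinguished_counit (ht : Q.IsLeftIntegral t) (h1 : Q.counit t = 1) :
    Q.IsDistinguished Q.counit.toLinearMap := by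
  intro s hs h
  have e := hs t
  rw [h1, one_smul, ht.isRightIntegral h1] at e
  rw [← e, smul_mul_assoc, ht.isRightIntegral h1, smul_comm]
  rfl

theorem untwist_comul_mul (h : H) (w : H ⊗[k] H) :
    Q.untwist (Q.comul h * w) = (h ⊗ₜ 1) * Q.untwist w := by
  have e : ∀ s, Q.comulMid Q.pR ((h ⊗ₜ 1) * s) = Q.comul h * Q.comulMid Q.pR s := by
    intro s
    induction s using TensorProduct.induction_on with
    | zero => simp
    | add x y hx hy => simp only [map_add, mul_add, hx, hy]
    | tmul a b => simp [mul_assoc]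
  rw [← Q.untwist_comulMid ((h ⊗ₜ 1) * _), e, comulMid_untwist]

/-- This links `untwist` with `q`, so that the invariance of `t` can be transported through
`untwist` to `q Δ(t)`. -/
theorem map_antipodeInv_untwist_tmul (v x : H) :
    TensorProduct.map LinearMap.id Q.antipodeInv (Q.untwist (v ⊗ₜ x)) =
      (1 ⊗ₜ Q.antipodeInv x) * (Q.qR * Q.comul v) := by
  rw [untwist_tmul, qHat, qR]
  generalize Q.Phi = T
  generalize Q.comul v = s
  induction T using TensorProduct.triple_induction with
  | zero => simp
  | add x y hx hy => simp only [map_add, LinearMap.add_apply, mul_add, add_mul, hx, hy]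
  | tmul a b c =>
    induction s using TensorProduct.induction_on with
    | zero => simp
    | add x y hx hy => simp only [map_add, mul_add, add_mul, hx, hy]
    | tmul u w => simp [mul_assoc]

theorem map_antipodeInv_untwist_mul (w : H ⊗[k] H) (v : H) :
    TensorProduct.map LinearMap.id Q.antipodeInv (Q.untwist (w * (v ⊗ₜ 1))) =
      TensorProduct.map LinearMap.id Q.antipodeInv (Q.untwist w) * Q.comul v := by
  induction w using TensorProduct.induction_on with
  | zero => simp
  | add x y hx hy => simp only [map_add, add_mul, hx, hy]
  | tmul a b =>
    rw [Algebra.TensorProduct.tmul_mul_tmul, mul_one, map_antipodeInv_untwist_tmul,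
      map_antipodeInv_untwist_tmul, map_mul]
    simp only [mul_assoc]

/-- `(S(h) ⊗ 1) q Δ(t) = (1 ⊗ h) q Δ(t)`. -/
theorem IsLeftIntegral.antipode_tmul_one_mul_qR (ht : Q.IsLeftIntegral t) (h : H) :
    (Q.antipode h ⊗ₜ 1) * (Q.qR * Q.comul t) = (1 ⊗ₜ h) * (Q.qR * Q.comul t) := by
  have e0 : Q.comul (Q.antipode h) * (t ⊗ₜ 1) = t ⊗ₜ Q.antipode h := by
    rw [ht.mul_tmul_one]
    congr 1
    have := Q.counit_id_comul (Q.antipode h)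
    have e := congrArg (TensorProduct.lid k H) this
    rw [TensorProduct.lid_tmul, one_smul] at e
    exact e
  have e1 := map_antipodeInv_untwist_tmul (Q := Q) t (Q.antipode h)
  have e2 := map_antipodeInv_untwist_tmul (Q := Q) t 1
  rw [← e0, untwist_comul_mul, antipodeInv_antipode] at e1
  rw [antipodeInv_one, ← Algebra.TensorProduct.one_def, one_mul] at e2
  rw [← e1, ← e2]
  generalize Q.untwist (t ⊗ₜ 1) = s
  induction s using TensorProduct.induction_on with
  | zero => simp
  | add x y hx hy => simp only [map_add, mul_add, hx, hy]
  | tmul a b => simp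

/-- `(1 ⊗ S⁻¹(β)) q Δ(t) = Δ(t)`. -/
theorem IsLeftIntegral.antipodeInv_β_mul (ht : Q.IsLeftIntegral t) :
    (1 ⊗ₜ Q.antipodeInv Q.β) * (Q.qR * Q.comul t) = Q.comul t := by
  have e := map_antipodeInv_untwist_mul (Q := Q) Q.pR t
  rw [ht.mul_tmul_one, counit_pR, map_antipodeInv_untwist_tmul, untwist_pR] at e
  rwa [Algebra.TensorProduct.one_def, TensorProduct.map_tmul, antipodeInv_one, LinearMap.id_apply,
    ← Algebra.TensorProduct.one_def, one_mul] at e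

/-! ### The cointegral of a semisimple algebra -/

/-- Expand the trace over a basis: the term of `b i` involves `S(b i)` in front of `E¹`, which `hE`
exchanges for `b i` in front of `E²`. Summing coordinates against basis vectors then reassembles an
element of `H`. -/
theorem pairing_traceFunctional {E : H ⊗[k] H}
    (hE : ∀ h, (Q.antipode h ⊗ₜ 1) * E = (1 ⊗ₜ h) * E) (h : H) :
    Q.pairing Q.traceFunctional E h = h * Q.evMap ((1 ⊗ₜ Q.antipodeInv Q.β) * E) := by
  let b := Module.finBasis k H
  let ψ : Fin (Module.finrank k H) → H ⊗[k] H →ₗ[k] H := fun i =>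
    (TensorProduct.lid k H).toLinearMap ∘ₗ TensorProduct.map (b.coord i ∘ₗ
      LinearMap.mulRight k (Q.α * Q.antipodeInv Q.β) ∘ₗ LinearMap.mulLeft k h ∘ₗ Q.antipode)
      LinearMap.id
  have e1 : ∀ E : H ⊗[k] H, Q.pairing Q.traceFunctional E h =
      ∑ i, ψ i ((Q.antipode (b i) ⊗ₜ 1) * E) := by
    intro E
    induction E using TensorProduct.induction_on with
    | zero => simp
    | add x y hx hy =>
      simp only [map_add, LinearMap.add_apply, mul_add, Finset.sum_add_distrib, hx, hy]
    | tmul x y =>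
      rw [pairing_tmul, traceFunctional_apply, trace_eq_sum_repr b, Finset.sum_smul]
      simp [ψ, mul_assoc]
  have e2 : ∀ E : H ⊗[k] H, ∑ i, ψ i ((1 ⊗ₜ b i) * E) =
      h * Q.evMap ((1 ⊗ₜ Q.antipodeInv Q.β) * E) := by
    intro E
    induction E using TensorProduct.induction_on with
    | zero => simp
    | add x y hx hy => simp only [map_add, mul_add, Finset.sum_add_distrib, hx, hy]
    | tmul x y =>
      have := congrArg (· * y) (b.sum_repr (h * Q.antipode x * (Q.α * Q.antipodeInv Q.β)))
      simp only [Finset.sum_mul, smul_mul_assoc] at this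
      simpa [ψ, mul_assoc] using this
  rw [e1, ← e2]
  simp only [hE]

/-- The hypothesis says that slicing `D` by a functional `ξ` gives a preimage of `ξ` under `φ : a ↦
λ(· S(a))`. By equality of dimensions `φ` is injective, and `φ(S⁻¹(h)) = λ(· h)`. -/
theorem tmul_apply_eq_of_pairing {lam : Module.Dual k H} {D : H ⊗[k] H}
    (hD : ∀ h, Q.pairing lam D h = h) (h : H) :
    TensorProduct.rid k H (TensorProduct.map LinearMap.id (lam ∘ₗ LinearMap.mulRight k h) D) =
      Q.antipodeInv h := by
  let φ : H →ₗ[k] Module.Dual k H := LinearMap.mk₂ k (fun a x => lam (x * Q.antipode a))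
    (by intros; simp [mul_add]) (by intros; simp) (by intros; simp [add_mul]) (by intros; simp)
  have hφ : ∀ ξ : Module.Dual k H,
      φ (TensorProduct.rid k H (TensorProduct.map LinearMap.id ξ D)) = ξ := by
    intro ξ
    ext x
    conv_rhs => rw [← hD x]
    generalize D = D
    induction D using TensorProduct.induction_on with
    | zero => simp
    | add y z hy hz => simp only [map_add, LinearMap.add_apply, hy, hz]
    | tmul y z => simp [φ, mul_comm]
  have hinj : Function.Injective φ :=
    (LinearMap.injective_iff_surjective_of_finrank_eq_finrank
      (Subspace.dual_finrank_eq (K := k) (V := H)).symm).mpr fun ξ => ⟨_, hφ ξ⟩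
  apply hinj
  rw [hφ]
  ext x
  simp [φ]

end QuasiHopfAlgebra

/-! ### The trace functional as a left cointegral -/

namespace QuasiHopfAlgebra

variable {k H : Type*} [Field k] [Ring H] [Algebra k H] {Q : QuasiHopfAlgebra k H}

/-- The map `h ↦ λ(V² h₂ U²) V¹ h₁ U¹`. -/
noncomputable def cointegralMap (Q : QuasiHopfAlgebra k H) (lam : Module.Dual k H) : H →ₗ[k] H :=
  (TensorProduct.rid k H).toLinearMap ∘ₗ TensorProduct.map LinearMap.id lam ∘ₗ
    LinearMap.mulRight k Q.U ∘ₗ LinearMap.mulLeft k Q.V ∘ₗ Q.comul.toLinearMap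

theorem cointegralMap_apply (lam : Module.Dual k H) (h : H) : Q.cointegralMap lam h =
    TensorProduct.rid k H (TensorProduct.map LinearMap.id lam (Q.V * Q.comul h * Q.U)) := rfl

/-- For `μ = ε` the right side of the cointegral equation degenerates, since `ε` in the first leg
makes `Φ⁻¹` trivial. -/
theorem counit_slice_PhiInv (lam : Module.Dual k H) (h : H) :
    TensorProduct.lid k H (TensorProduct.map Q.counit.toLinearMap
      ((TensorProduct.lid k H).toLinearMap ∘ₗ
        TensorProduct.map (lam ∘ₗ LinearMap.mulLeft k h ∘ₗ Q.antipode) LinearMap.id) Q.PhiInv) =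
      lam h • 1 := by
  let inl : H →ₐ[k] H ⊗[k] H := Algebra.TensorProduct.includeLeft
  let inr : H →ₐ[k] H ⊗[k] H := Algebra.TensorProduct.includeRight
  have : SlotsCommute inl inr := ⟨fun x y => by simp [inl, inr, Commute, SemiconjBy]⟩
  let F : H ⊗[k] H →ₗ[k] H := (TensorProduct.lid k H).toLinearMap ∘ₗ
    TensorProduct.map (lam ∘ₗ LinearMap.mulLeft k h ∘ₗ Q.antipode) LinearMap.id
  have e1 : lam h • 1 = F 1 := by simp [F, Algebra.TensorProduct.one_def]
  rw [e1, ← Q.phiInvAt_unit_left inl inr, phiInvAt]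
  change TensorProduct.lid k H (TensorProduct.map Q.counit.toLinearMap F Q.PhiInv) = _
  generalize Q.PhiInv = T
  induction T using TensorProduct.triple_induction with
  | zero => simp
  | add x y hx hy => simp only [map_add, hx, hy]
  | tmul a b c =>
    rw [slotEval_tmul, slotEval_tmul, unitSlot_apply, ← Algebra.smul_def, map_smul]
    simp [inl, inr]

theorem map_cointegralMap_mul (lam : Module.Dual k H) (q s p : H ⊗[k] H) :
    TensorProduct.map LinearMap.id (Q.cointegralMap lam) (q * (s * p)) =
      TensorProduct.map LinearMap.id ((TensorProduct.rid k H).toLinearMap ∘ₗ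
        TensorProduct.map LinearMap.id lam)
        (((1 ⊗ₜ Q.V) * Algebra.TensorProduct.map (AlgHom.id k H) Q.comul q) *
          Algebra.TensorProduct.map (AlgHom.id k H) Q.comul s *
          (Algebra.TensorProduct.map (AlgHom.id k H) Q.comul p * (1 ⊗ₜ Q.U))) := by
  have e : ∀ x : H ⊗[k] H, TensorProduct.map LinearMap.id (Q.cointegralMap lam) x =
      TensorProduct.map LinearMap.id ((TensorProduct.rid k H).toLinearMap ∘ₗ
        TensorProduct.map LinearMap.id lam) ((1 ⊗ₜ Q.V) *
          Algebra.TensorProduct.map (AlgHom.id k H) Q.comul x * (1 ⊗ₜ Q.U)) := by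
    intro x
    induction x using TensorProduct.induction_on with
    | zero => simp
    | add x y hx hy => simp only [map_add, mul_add, add_mul, hx, hy]
    | tmul a b => simp [cointegralMap_apply]
  rw [e, map_mul (Algebra.TensorProduct.map _ _), map_mul (Algebra.TensorProduct.map _ _)]
  simp only [mul_assoc]

/-- Every `h` is `λ(h S(D¹)) D²`, so the cointegral map is known on all of `H` once it is known on
the second leg of `D`; `hC` then gives the value `λ(h) 1`. -/
theorem isLeftCointegral_of_map_cointegralMap {lam : Module.Dual k H} {D : H ⊗[k] H}
    (hD : ∀ h, Q.pairing lam D h = h)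
    (hC : TensorProduct.map LinearMap.id (Q.cointegralMap lam) D = 1) :
    Q.IsLeftCointegral Q.counit.toLinearMap lam := by
  intro h
  rw [counit_slice_PhiInv, ← cointegralMap_apply]
  have e : ∀ D : H ⊗[k] H, Q.cointegralMap lam (Q.pairing lam D h) =
      TensorProduct.lid k H (TensorProduct.map (lam ∘ₗ LinearMap.mulLeft k h ∘ₗ Q.antipode)
        LinearMap.id (TensorProduct.map LinearMap.id (Q.cointegralMap lam) D)) := by
    intro D
    induction D using TensorProduct.induction_on with
    | zero => simp
    | add x y hx hy => simp only [map_add, LinearMap.add_apply, hx, hy]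
    | tmul a b => simp
  conv_lhs => rw [← hD h, e, hC, Algebra.TensorProduct.one_def]
  simp

theorem IsLeftCointegral.smul {μ lam : Module.Dual k H} (h : Q.IsLeftCointegral μ lam) (c : k) :
    Q.IsLeftCointegral μ (c • lam) := by
  intro x
  have e1 : ∀ s : H ⊗[k] H, TensorProduct.rid k H (TensorProduct.map LinearMap.id (c • lam) s) =
      c • TensorProduct.rid k H (TensorProduct.map LinearMap.id lam s) := by
    intro s
    rw [TensorProduct.map_smul_right, LinearMap.smul_apply, map_smul]
  rw [e1, h x]
  have e2 : (TensorProduct.lid k H).toLinearMap ∘ₗ TensorProduct.map ((c • lam) ∘ₗ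
      LinearMap.mulLeft k x ∘ₗ Q.antipode) LinearMap.id = c • ((TensorProduct.lid k H).toLinearMap
        ∘ₗ TensorProduct.map (lam ∘ₗ LinearMap.mulLeft k x ∘ₗ Q.antipode) LinearMap.id) := by
    rw [LinearMap.smul_comp, TensorProduct.map_smul_left, LinearMap.comp_smul]
  rw [e2, TensorProduct.map_smul_right, LinearMap.smul_apply, map_smul]

variable [FiniteDimensional k H] {t : H}

/-- The general formula leaves `evMap (Δ(t) p)`, which is `ε(t) S(p¹) α p² = 1`. -/
theorem IsLeftIntegral.pairing_traceFunctional (ht : Q.IsLeftIntegral t) (h1 : Q.counit t = 1)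
    (h : H) : Q.pairing Q.traceFunctional (Q.qR * (Q.comul t * Q.pR)) h = h := by
  rw [QuasiHopfAlgebra.pairing_traceFunctional, ← mul_assoc Q.qR, ← mul_assoc,
    ht.antipodeInv_β_mul, evMap_comul_mul, evMap_pR, h1, one_smul, mul_one]
  intro x
  rw [← mul_assoc Q.qR, ← mul_assoc, ht.antipode_tmul_one_mul_qR, mul_assoc]

/-- `λ(m t₂ n) t₁ = β S(m) S⁻¹(α n)` for the trace functional `λ`. -/
theorem IsLeftIntegral.traceFunctional_comul (ht : Q.IsLeftIntegral t) (h1 : Q.counit t = 1)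
    (m n : H) : TensorProduct.rid k H (TensorProduct.map LinearMap.id (Q.traceFunctional ∘ₗ
      LinearMap.mulRight k n ∘ₗ LinearMap.mulLeft k m) (Q.comul t)) =
      Q.β * Q.antipode m * Q.antipodeInv (Q.α * n) := by
  set D := Q.qR * (Q.comul t * Q.pR) with hD
  -- Being a two-sided integral, `t` allows both `q` and `p` to be inserted around `Δ(t)`; the `m`
  -- on the left is then exchanged for `S(m)` in the first leg.
  have e1 : Q.comul t = (1 ⊗ₜ Q.antipodeInv Q.β) * D * (1 ⊗ₜ Q.α) := by
    rw [hD, mul_assoc, mul_assoc, (ht.isRightIntegral h1).comul_mul_pR_mul_α, ht.antipodeInv_β_mul]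
  have e2 : ∀ x, (Q.antipode x ⊗ₜ 1) * D = (1 ⊗ₜ x) * D := by
    intro x
    rw [hD, ← mul_assoc Q.qR, ← mul_assoc, ht.antipode_tmul_one_mul_qR, mul_assoc]
  have e3 : ∀ D : H ⊗[k] H, TensorProduct.rid k H (TensorProduct.map LinearMap.id
      (Q.traceFunctional ∘ₗ LinearMap.mulRight k n ∘ₗ LinearMap.mulLeft k m)
        ((1 ⊗ₜ Q.antipodeInv Q.β) * D * (1 ⊗ₜ Q.α))) = TensorProduct.rid k H (TensorProduct.map
        LinearMap.id (Q.traceFunctional ∘ₗ LinearMap.mulRight k (Q.α * n))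
          ((1 ⊗ₜ (m * Q.antipodeInv Q.β)) * D)) := by
    intro D
    induction D using TensorProduct.induction_on with
    | zero => simp
    | add x y hx hy => simp only [map_add, mul_add, add_mul, hx, hy]
    | tmul a b => simp [mul_assoc]
  have e4 : ∀ (x : H) (ξ : Module.Dual k H) (D : H ⊗[k] H), TensorProduct.rid k H
      (TensorProduct.map LinearMap.id ξ ((x ⊗ₜ 1) * D)) =
        x * TensorProduct.rid k H (TensorProduct.map LinearMap.id ξ D) := by
    intro x ξ D
    induction D using TensorProduct.induction_on with
    | zero => simp
    | add x y hx hy => simp only [map_add, mul_add, hx, hy]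
    | tmul a b => simp
  rw [e1, e3, ← e2, e4, tmul_apply_eq_of_pairing (ht.pairing_traceFunctional h1)]
  simp

/-- Quasi-coassociativity replaces `(id ⊗ Δ)Δ(t)` by `Φ (Δ ⊗ id)Δ(t) Φ⁻¹`. Applying `λ` to the third
leg turns `t` into `β S(c) S⁻¹(α c')`, whose coproduct factors between the two sides. The left part,
with `V`, `q`, `Φ`, and the right part, with `Φ⁻¹`, `p`, `U`, are each `1 ⊗ 1`. -/
theorem IsLeftIntegral.map_cointegralMap (ht : Q.IsLeftIntegral t) (h1 : Q.counit t = 1) :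
    TensorProduct.map LinearMap.id (Q.cointegralMap Q.traceFunctional)
      (Q.qR * (Q.comul t * Q.pR)) = 1 := by
  have e : ∀ w z : H ⊗[k] (H ⊗[k] H), TensorProduct.map LinearMap.id
      ((TensorProduct.rid k H).toLinearMap ∘ₗ TensorProduct.map LinearMap.id Q.traceFunctional)
        (w * Algebra.TensorProduct.assoc k k k H H H
          (Algebra.TensorProduct.map Q.comul (AlgHom.id k H) (Q.comul t)) * z) =
      Q.comulCoev w * Q.comulEvInv z := by
    intro w z
    induction w using TensorProduct.triple_induction with
    | zero => simp
    | add x y hx hy => simp only [map_add, add_mul, hx, hy]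
    | tmul a b c =>
      induction z using TensorProduct.triple_induction with
      | zero => simp
      | add x y hx hy => simp only [map_add, mul_add, hx, hy]
      | tmul a' b' c' =>
        have e1 : ∀ s : H ⊗[k] H, TensorProduct.map LinearMap.id
            ((TensorProduct.rid k H).toLinearMap ∘ₗ TensorProduct.map LinearMap.id
              Q.traceFunctional) ((a ⊗ₜ (b ⊗ₜ c)) * Algebra.TensorProduct.assoc k k k H H H
              (Algebra.TensorProduct.map Q.comul (AlgHom.id k H) s) * (a' ⊗ₜ (b' ⊗ₜ c'))) =
            (a ⊗ₜ b) * Q.comul (TensorProduct.rid k H (TensorProduct.map LinearMap.id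
              (Q.traceFunctional ∘ₗ LinearMap.mulRight k c' ∘ₗ LinearMap.mulLeft k c) s)) *
                (a' ⊗ₜ b') := by
          intro s
          induction s using TensorProduct.induction_on with
          | zero => simp
          | add x y hx hy => simp only [map_add, mul_add, add_mul, hx, hy]
          | tmul x y =>
            rw [Algebra.TensorProduct.map_tmul]
            simp only [TensorProduct.map_tmul, TensorProduct.rid_tmul, map_smul,
              AlgHom.id_apply, LinearMap.id_apply]
            generalize Q.comul x = d
            induction d using TensorProduct.induction_on with
            | zero => simp
            | add x y hx hy =>
              simp only [map_add, TensorProduct.add_tmul, mul_add, add_mul, smul_add, hx, hy]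
            | tmul u v => simp [mul_assoc]
        rw [e1, ht.traceFunctional_comul h1, comulCoev_tmul, comulEvInv_tmul, map_mul]
        simp only [mul_assoc]
  rw [map_cointegralMap_mul, Q.quasi_coassoc]
  change TensorProduct.map LinearMap.id _ (_ * (Q.Phi * _ * Q.PhiInv) * _) = _
  have := e ((1 ⊗ₜ Q.V) * (Algebra.TensorProduct.map (AlgHom.id k H) Q.comul Q.qR * Q.Phi))
    (Q.PhiInv * (Algebra.TensorProduct.map (AlgHom.id k H) Q.comul Q.pR * (1 ⊗ₜ Q.U)))
  rw [comulCoev_eq_one, comulEvInv_eq_one, mul_one] at this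
  rw [← this]
  simp only [mul_assoc]

theorem IsLeftIntegral.isLeftCointegral_traceFunctional (ht : Q.IsLeftIntegral t)
    (h1 : Q.counit t = 1) : Q.IsLeftCointegral Q.counit.toLinearMap Q.traceFunctional :=
  isLeftCointegral_of_map_cointegralMap (ht.pairing_traceFunctional h1) (ht.map_cointegralMap h1)

/-- Formula (ii), with its factor `λ(S(r))`, for `r = S(t)` and `ε(t) = 1` exhibits `1` as a
multiple of the trace. -/
theorem trace_ne_zero_of_isSemisimpleRing [IsSemisimpleRing H] (hQ : Q.IsCosemisimple) :
    LinearMap.trace k H Q.sqAntipodeEnd ≠ 0 := by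
  obtain ⟨t, ht, h1⟩ := Q.exists_isLeftIntegral_of_isSemisimpleRing
  obtain ⟨μ, lam, hμ, hlam, hl⟩ := hQ
  obtain ⟨m, rfl⟩ := hμ.exists_algHom
  intro h0
  have := trace_sqAntipodeEnd ht.antipode hμ hlam
  rw [h0, hl, counit_antipode, h1] at this
  simp at this

/-- The trace is the counit of some left integral, so it can be divided out to give `ε(t) = 1`. It
is also the value of the trace functional at `S⁻¹(α) β`, so the same division normalises the
cointegral. -/
theorem isSemisimpleRing_and_isCosemisimple_of_trace_ne_zero
    (h : LinearMap.trace k H Q.sqAntipodeEnd ≠ 0) : IsSemisimpleRing H ∧ Q.IsCosemisimple := by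
  obtain ⟨s, hs, hs1⟩ := Q.exists_isLeftIntegral_counit_eq_trace
  obtain ⟨t, ht, h1⟩ : ∃ t, Q.IsLeftIntegral t ∧ Q.counit t = 1 := by
    refine ⟨(LinearMap.trace k H Q.sqAntipodeEnd)⁻¹ • s, fun x => ?_, ?_⟩
    · rw [mul_smul_comm, hs, smul_comm]
    · rw [map_smul, hs1, smul_eq_mul, inv_mul_cancel₀ h]
  refine ⟨Q.isSemisimpleRing_of_isLeftIntegral ht h1, _, _, ht.isDistinguished_counit h1,
    (ht.isLeftCointegral_traceFunctional h1).smul (LinearMap.trace k H Q.sqAntipodeEnd)⁻¹, ?_⟩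
  rw [LinearMap.smul_apply, traceFunctional_apply, ← trace_sqAntipodeEnd_eq_trace, smul_eq_mul,
    inv_mul_cancel₀ h]

end QuasiHopfAlgebra

theorem theorem5p1 {k H : Type*} [Field k] [Ring H] [Algebra k H] [FiniteDimensional k H]
    (Q : QuasiHopfAlgebra k H) :
    Function.Bijective Q.antipode ∧
    (∀ μ lam : Module.Dual k H, Q.IsDistinguished μ → Q.IsLeftCointegral μ lam → lam ≠ 0 →
      ∀ r : H, Q.IsRightIntegral r → lam (Q.antipode r) = 1 →
        (∀ χ : H →ₗ[k] H, LinearMap.trace k H χ = Q.traceForm μ lam r χ) ∧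
        LinearMap.trace k H Q.sqAntipodeEnd =
          Q.counit r * lam (Q.antipodeInv Q.α * Q.β)) ∧
    ((IsSemisimpleRing H ∧ Q.IsCosemisimple) ↔ LinearMap.trace k H Q.sqAntipodeEnd ≠ 0) := by
  refine ⟨Q.antipode_bijective, fun μ lam hμ hlam _ r hr h1 => ?_, fun h => ?_, fun h => ?_⟩
  · obtain ⟨m, rfl⟩ := hμ.exists_algHom
    refine ⟨fun χ => ?_, ?_⟩
    · rw [← QuasiHopfAlgebra.trace_eq_traceForm hr hμ hlam, h1, one_mul]
    · rw [← QuasiHopfAlgebra.trace_sqAntipodeEnd hr hμ hlam, h1, one_mul]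
  · have := h.1
    exact QuasiHopfAlgebra.trace_ne_zero_of_isSemisimpleRing h.2
  · exact QuasiHopfAlgebra.isSemisimpleRing_and_isCosemisimple_of_trace_ne_zero h
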